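/- A \emph{tied link diagram} is a nonempty unoriented link diagram in $S^2$ together with a partition of the set of its components; two components are \emph{tied together} if they belong to the same block of the partition. (Ties are drawn between points of the diagram; the components joined by ties generate the partition, and only the partition matters.) Diagrams are considered up to isotopy of $S^2$. There exists a unique function $$\mathcal L:\{\text{unoriented tied link diagrams}\}\to \mathbb Z[a^{\pm1},z^{\pm1},x^{-1}]$$ satisfying the following rules. (i) $\mathcal L(\bigcirc)=1$, where $\bigcirc$ is the diagram of the unknotted circle without crossings. (ii) $\mathcal L(D\sqcup\bigcirc)=x^{-1}\mathcal L(D)$, where $D\sqcup\bigcirc$ is the disjoint union of $D$ with a circle without crossings that is not tied to any component of $D$. (iii) $\mathcal L$ is invariant under Reidemeister moves II and III (which keep the partition of the components). (iv) If $D'$ is obtained from $D$ by inserting a curl with a positive crossing into a strand, then $\mathcal L(D')=a\,\mathcal L(D)$. (v) If $D'$ is obtained from $D$ by inserting a curl with a negative crossing into a strand, then $\mathcal L(D')=a^{-1}\mathcal L(D)$. (vi) $\mathcal L(D_+)+\mathcal L(D_-)=z\,\bigl(\mathcal L(D_e)+\mathcal L(D_f)\bigr)$, where $D_+,D_-,D_e,D_f$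 are tied link diagrams that are identical outside a disc; inside the disc $D_+$ and $D_-$ have a single crossing, of the two opposite kinds, and $D_e$ and $D_f$ are the two smoothings of this crossing, in each of which the two strands in the disc are joined by a tie (so that the blocks of the two strands are united). Moreover, there is a unique function $L$ from unoriented classical (nonempty) link diagrams in $S^2$ to $\mathbb Z[a^{\pm1},z^{\pm1}]$ which satisfies (i), (iii), (iv), (v) and $L(D_+)+L(D_-)=z\,(L(D_0)+L(D_\infty))$, where $D_0$ and $D_\infty$ are the two smoothings without ties; it is the (regular isotopy) Kauffman polynomial. If all components of a tied link diagram $D$ are tied together, then $\mathcal L(D)=L(D^{\nsim})$, where $D^{\nsim}$ is the classical link diagram obtained from $D$ by forgetting all ties. -/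

import Mathlib

namespace TiedLink

/-! ### Link diagrams in Morse position

A link diagram is put in general position with respect to the height function and read from
bottom to top as a word in elementary pieces. Every strand carries a colour in `κ`; a colour is
constant along each component. Components of the same colour form one class of the partition,
i.e. are tied together. With `κ = Unit` the colours carry no information, and the words are
diagrams of classical links. -/

/-- An elementary piece, with `i` vertical strands to the left of it.
`cup i c`: a local minimum, creating two neighbouring strands of colour `c`.
`cap i`: a local maximum, joining the strands at places `i` and `i + 1`.
`cross i b`: a crossing of the strands at places `i` and `i + 1`. If `b = true`, the strand which
runs from the lower left to the upper right is the overpass; if `b = false`, it is the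
underpass. -/
inductive Letter (κ : Type) : Type
  | cup (i : ℕ) (c : κ) : Letter κ
  | cap (i : ℕ) : Letter κ
  | cross (i : ℕ) (b : Bool) : Letter κ

/-- A word of elementary pieces, the lowest one first. -/
abbrev Word (κ : Type) : Type := List (Letter κ)

namespace Letter

variable {κ κ' : Type}

/-- Number of strands to the left of the piece. -/
def pos : Letter κ → ℕ
  | cup i _ => i
  | cap i => i
  | cross i _ => i

/-- Number of strands which enter the piece from below. -/
def inp : Letter κ → ℕ
  | cup _ _ => 0
  | cap _ => 2
  | cross _ _ => 2

/-- Number of strands which leave the piece at the top. -/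
def out : Letter κ → ℕ
  | cup _ _ => 2
  | cap _ => 0
  | cross _ _ => 2

/-- Insert `k` further strands on the left. -/
def shift (k : ℕ) : Letter κ → Letter κ
  | cup i c => cup (i + k) c
  | cap i => cap (i + k)
  | cross i b => cross (i + k) b

/-- Change the colours. -/
def recolor (f : κ → κ') : Letter κ → Letter κ'
  | cup i c => cup i (f c)
  | cap i => cap i
  | cross i b => cross i b

/-- `x.Acts s t`: the piece `x` fits on top of strands coloured `s` (listed from left to right),
and the strands which leave it at the top are coloured `t`. -/
inductive Acts : Letter κ → List κ → List κ → Prop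
  | cup (l r : List κ) (c : κ) : Acts (cup l.length c) (l ++ r) (l ++ c :: c :: r)
  | cap (l r : List κ) (c : κ) : Acts (cap l.length) (l ++ c :: c :: r) (l ++ r)
  | cross (l r : List κ) (c d : κ) (b : Bool) :
      Acts (cross l.length b) (l ++ c :: d :: r) (l ++ d :: c :: r)

theorem Acts.recolor (f : κ → κ') {x : Letter κ} {s t : List κ} (h : x.Acts s t) :
    (x.recolor f).Acts (s.map f) (t.map f) := by
  cases h with
  | cup l r c => simpa [Letter.recolor] using Acts.cup (l.map f) (r.map f) (f c)
  | cap l r c => simpa [Letter.recolor] using Acts.cap (l.map f) (r.map f) (f c)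
  | cross l r c d b =>
      simpa [Letter.recolor] using Acts.cross (l.map f) (r.map f) (f c) (f d) b

end Letter

open Letter

namespace Word

variable {κ κ' : Type}

/-- Insert `k` further strands on the left of the word. -/
def shift (k : ℕ) (w : Word κ) : Word κ := List.map (Letter.shift k) w

/-- Change the colours of a word. -/
def recolor (f : κ → κ') (w : Word κ) : Word κ' := List.map (Letter.recolor f) w

/-- `Typed w s t`: the word `w` is a coloured tangle diagram with lower ends `s` and
upper ends `t`. -/
inductive Typed : Word κ → List κ → List κ → Prop
  | nil (s : List κ) : Typed [] s s
  | cons {x : Letter κ} {w : Word κ} {s t t' : List κ} :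
      x.Acts s t → Typed w t t' → Typed (x :: w) s t'

/-- The colour `c` occurs in the word. -/
def Uses (w : Word κ) (c : κ) : Prop := ∃ i, Letter.cup i c ∈ w

theorem Typed.recolor (f : κ → κ') {w : Word κ} {s t : List κ} (h : Typed w s t) :
    Typed (Word.recolor f w) (s.map f) (t.map f) := by
  induction h with
  | nil s => exact Typed.nil _
  | cons hx _ ih => exact Typed.cons (hx.recolor f) ih

end Word

open Word

/-! ### Isotopy of diagrams in the sphere -/

section Isotopy

variable {κ : Type}

/-- The local moves between words which represent isotopic diagrams in the plane: exchange of the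
heights of two pieces that lie side by side, cancellation of a maximum with a minimum, and
passage of a maximum or a minimum through a crossing. -/
inductive PlanarMove : Word κ → Word κ → Prop
  | exchange (x y : Letter κ) : x.pos ≤ y.pos →
      PlanarMove [x, y.shift x.out] [y.shift x.inp, x]
  | zigzag_left (i : ℕ) (c : κ) : PlanarMove [cup (i + 1) c, cap i] []
  | zigzag_right (i : ℕ) (c : κ) : PlanarMove [cup i c, cap (i + 1)] []
  | cap_slide (i : ℕ) (b : Bool) :
      PlanarMove [cross i b, cap (i + 1)] [cross (i + 1) (!b), cap i]
  | cup_slide (i : ℕ) (c : κ) (b : Bool) :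
      PlanarMove [cup (i + 1) c, cross i b] [cup i c, cross (i + 1) (!b)]

/-- Elementary steps between words which represent the same diagram in the sphere with the same
partition of the components: the local moves, the passage of an outermost arc
through the point at infinity (from the right of a tangle with one lower and one upper end to its
left), and a renaming of the colours, which does not change the partition. -/
inductive IsotopyStep : Word κ → Word κ → Prop
  | planar (u v : Word κ) {m m' : Word κ} :
      PlanarMove m m' → IsotopyStep (u ++ m ++ v) (u ++ m' ++ v)
  | sphere (T : Word κ) (c : κ) : Typed T [c] [c] →
      IsotopyStep ([cup 0 c] ++ T ++ [cap 0]) ([cup 0 c] ++ Word.shift 1 T ++ [cap 0])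
  | rename (w : Word κ) (π : Equiv.Perm κ) : IsotopyStep w (w.recolor π)

end Isotopy

/-- A nonempty link diagram in Morse position, with its components coloured by `κ`. -/
structure MorseDiagram (κ : Type) : Type where
  word : Word κ
  nonempty : word ≠ []
  closed : Typed word [] []

/-- Link diagrams in the sphere with components coloured by `κ`, up to isotopy of the
sphere and renaming of the colours. -/
def Diagram (κ : Type) : Type :=
  Quot fun D D' : MorseDiagram κ => IsotopyStep D.word D'.word

/-- The diagram represented by a diagram in Morse position. -/
def MorseDiagram.diagram {κ : Type} (D : MorseDiagram κ) : Diagram κ := Quot.mk _ D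

/-- Unoriented tied link diagrams: the components are partitioned, two components being tied
together when they have the same colour. -/
abbrev TiedDiagram : Type := Diagram ℕ

/-- Unoriented classical link diagrams. -/
abbrev ClassicalDiagram : Type := Diagram Unit

/-- All components are tied together. -/
def MorseDiagram.AllTied (D : MorseDiagram ℕ) : Prop :=
  ∀ c d : ℕ, Uses D.word c → Uses D.word d → c = d

/-- The classical link diagram obtained by forgetting all ties. -/
def MorseDiagram.forget (D : MorseDiagram ℕ) : MorseDiagram Unit where
  word := Word.recolor (fun _ => ()) D.word
  nonempty := by simpa [Word.recolor] using D.nonempty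
  closed := by simpa using D.closed.recolor fun _ => ()

/-! ### Reidemeister moves and curls -/

section Moves

variable {κ : Type}

/-- Reidemeister moves II and III. In move III the three strands are at three different levels,
which excludes only `b₁ = b₃ ≠ b₂`. -/
inductive Reidemeister : Word κ → Word κ → Prop
  | two (i : ℕ) (b : Bool) : Reidemeister [cross i b, cross i (!b)] []
  | three (i : ℕ) (b₁ b₂ b₃ : Bool) : (b₂ = b₁ ∨ b₂ = b₃) →
      Reidemeister [cross i b₁, cross (i + 1) b₂, cross i b₃]
        [cross (i + 1) b₃, cross i b₂, cross (i + 1) b₁]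

/-- A curl on one strand, with the loop to its right or to its left. For either orientation of
the strand, the crossing is positive if `b = true` and negative if `b = false`. -/
inductive Curl (b : Bool) : Word κ → Prop
  | right (i : ℕ) (c : κ) : Curl b [cup (i + 1) c, cross i b, cap (i + 1)]
  | left (i : ℕ) (c : κ) : Curl b [cup i c, cross (i + 1) b, cap i]

end Moves

/-! ### The rings -/

/-- The ring `ℤ[a^±1, z^±1]`: Laurent polynomials in `z` over Laurent polynomials in `a`. -/
abbrev RingAZ : Type := LaurentPolynomial (LaurentPolynomial ℤ)

/-- The ring `ℤ[a^±1, z^±1, x⁻¹]`: polynomials in the variable `x⁻¹` over `ℤ[a^±1, z^±1]`. -/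
abbrev RingAZX : Type := Polynomial RingAZ

/-- The monomial `a ^ n`. -/
noncomputable def aPow (n : ℤ) : RingAZ := LaurentPolynomial.C (LaurentPolynomial.T n)

/-- The variable `z`. -/
noncomputable def zVar : RingAZ := LaurentPolynomial.T 1

/-- The variable `x⁻¹`. -/
noncomputable def xInv : RingAZX := Polynomial.X

/-! ### The two polynomials -/

/-- The map of colours which unites the classes `c` and `d`. -/
def merge (c d : ℕ) : ℕ → ℕ := fun k => if k = d then c else k

/-- The defining rules of the Kauffman polynomial for unoriented tied links. -/
structure IsTiedKauffman (L : TiedDiagram → RingAZX) : Prop where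
  /-- The diagram of the unknot without crossings has value `1`. -/
  unknot : ∀ (D : MorseDiagram ℕ) (c : ℕ), D.word = [cup 0 c, cap 0] → L D.diagram = 1
  /-- A disjoint circle, tied to no other component, multiplies the value by `x⁻¹`. -/
  circle : ∀ (D D' : MorseDiagram ℕ) (u v : Word ℕ) (i c : ℕ), ¬ Uses (u ++ v) c →
    D.word = u ++ v → D'.word = u ++ [cup i c, cap i] ++ v →
    L D'.diagram = xInv * L D.diagram
  /-- Invariance under Reidemeister moves II and III. -/
  reidemeister : ∀ (D D' : MorseDiagram ℕ) (u v m m' : Word ℕ), Reidemeister m m' →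
    D.word = u ++ m ++ v → D'.word = u ++ m' ++ v → L D.diagram = L D'.diagram
  /-- A positive curl contributes a factor `a`. -/
  curl_pos : ∀ (D D' : MorseDiagram ℕ) (u v m : Word ℕ), Curl true m →
    D.word = u ++ m ++ v → D'.word = u ++ v →
    L D.diagram = Polynomial.C (aPow 1) * L D'.diagram
  /-- A negative curl contributes a factor `a⁻¹`. -/
  curl_neg : ∀ (D D' : MorseDiagram ℕ) (u v m : Word ℕ), Curl false m →
    D.word = u ++ m ++ v → D'.word = u ++ v →
    L D.diagram = Polynomial.C (aPow (-1)) * L D'.diagram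
  /-- The tied skein relation at a crossing of two strands of classes `c` and `d`: in the two
  smoothings `De` and `Df` the two strands in the disc are tied, so the classes are united. -/
  skein : ∀ (Dp Dm De Df : MorseDiagram ℕ) (u v : Word ℕ) (l r : List ℕ) (c d : ℕ),
    Typed u [] (l ++ c :: d :: r) → Typed v (l ++ d :: c :: r) [] →
    Dp.word = u ++ [cross l.length true] ++ v →
    Dm.word = u ++ [cross l.length false] ++ v →
    De.word = Word.recolor (merge c d) (u ++ v) →
    Df.word = Word.recolor (merge c d) (u ++ [cap l.length, cup l.length c] ++ v) →
    L Dp.diagram + L Dm.diagram = Polynomial.C zVar * (L De.diagram + L Df.diagram)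

/-- The defining rules of the (unnormalized) Kauffman polynomial of classical unoriented link
diagrams. -/
structure IsKauffman (K : ClassicalDiagram → RingAZ) : Prop where
  /-- The diagram of the unknot without crossings has value `1`. -/
  unknot : ∀ D : MorseDiagram Unit, D.word = [cup 0 (), cap 0] → K D.diagram = 1
  /-- Invariance under Reidemeister moves II and III. -/
  reidemeister : ∀ (D D' : MorseDiagram Unit) (u v m m' : Word Unit), Reidemeister m m' →
    D.word = u ++ m ++ v → D'.word = u ++ m' ++ v → K D.diagram = K D'.diagram
  /-- A positive curl contributes a factor `a`. -/
  curl_pos : ∀ (D D' : MorseDiagram Unit) (u v m : Word Unit), Curl true m →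
    D.word = u ++ m ++ v → D'.word = u ++ v → K D.diagram = aPow 1 * K D'.diagram
  /-- A negative curl contributes a factor `a⁻¹`. -/
  curl_neg : ∀ (D D' : MorseDiagram Unit) (u v m : Word Unit), Curl false m →
    D.word = u ++ m ++ v → D'.word = u ++ v → K D.diagram = aPow (-1) * K D'.diagram
  /-- The skein relation. -/
  skein : ∀ (Dp Dm Do Di : MorseDiagram Unit) (u v : Word Unit) (i : ℕ),
    Dp.word = u ++ [cross i true] ++ v →
    Dm.word = u ++ [cross i false] ++ v →
    Do.word = u ++ v →
    Di.word = u ++ [cap i, cup i ()] ++ v →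
    K Dp.diagram + K Dm.diagram = zVar * (K Do.diagram + K Di.diagram)

end TiedLink

/-! Uniqueness and integrality come from one reduction theorem, existence from a state sum.

`Rules` states the skein rules for functions of coloured words with values in an arbitrary module.
The reduction is `Rules.exists_smul`: the value of every nonempty closed word is a multiple, with
coefficient in the base ring, of the value of the unknot. To see this, open diagrams are rewritten
as combinations of layered ones (`Std`), in which every arc lies over all earlier arcs.
`Rules.preserves` shows, by induction on the number of strands, that a letter placed on top does not
lead out of the span of layered diagrams: either the letter slides below the last arc, or it meets
an end of that arc and is absorbed by an isotopy, if necessary after its crossing is switched by the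
skein relation. Applied to a pair of solutions, with values in `B × B`, the reduction forces the two
to agree (`Rules.unique`).

For existence, `exists_isModel` gives vertex models with `z = q + q⁻¹` and `a = q(-q²)^k`, starting
from the empty label set and adding two labels at a time. Ties enter as follows: every block gets
one of `m` colours, strands of equal colour interact through the vertex model, and a crossing of
different colours only contributes a sign that says which colour is on top. The two signs cancel in
the skein relation, so only colourings with equal colours at the crossing survive, and these are
exactly the colourings of the merged partition. A circle of a fresh block contributes `m` times the
loop value. The normalized sum thus solves the rules over a field for these parameters
(`IsModel.rules`).

Over `ℚ` the parameter triples obtained in this way detect every element of `ℤ[a^±1, z^±1, x⁻¹]`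
(`eq_zero_of_evalAZX`), so this ring embeds into a product of copies of `ℚ`. The family of all state
sums is a solution with values in that product. By the reduction its values are multiples of `1` by
ring elements, hence lie in the image of the ring, and a solution over the ring itself results
(`exists_rules`).

The classical polynomial is the case of the single colour `Unit`, where the rule for an untied
circle is vacuous; the comparison for completely tied diagrams is then uniqueness once more.
Invariance under the passage through infinity and under renaming of colours also follows from the
rules (`Rules.sphere`, `Rules.recolor_perm`). -/

namespace TiedLink

/-! ### Vertex models for the Kauffman skein relation -/

section VertexModel

variable {F I : Type} [Field F] [Fintype I]

/-- The action of a crossing with weights `X` on functions of the labels of two strands. -/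
def crossOp (X : I → I → I → I → F) (f : I → I → F) (x y : I) : F :=
  ∑ k, ∑ l, X x y k l * f k l

/-- The action of a minimum with weights `u`. -/
def cupOp (u : I → I → F) (f : I → I → F) : F := ∑ k, ∑ l, u k l * f k l

section Linear

variable (X : I → I → I → I → F) (u : I → I → F) (f g : I → I → F) (c : F) (x y : I)

theorem crossOp_add : crossOp X (fun k l => f k l + g k l) x y = crossOp X f x y + crossOp X g x y := by
  simp [crossOp, mul_add, Finset.sum_add_distrib]

theorem crossOp_mul : crossOp X (fun k l => c * f k l) x y = c * crossOp X f x y := by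
  simp [crossOp, Finset.mul_sum, mul_left_comm]

theorem crossOp_neg : crossOp X (fun k l => -f k l) x y = -crossOp X f x y := by
  simp [crossOp]

theorem crossOp_sub : crossOp X (fun k l => f k l - g k l) x y = crossOp X f x y - crossOp X g x y := by
  simp [crossOp, mul_sub, Finset.sum_sub_distrib]

theorem cupOp_add : cupOp u (fun k l => f k l + g k l) = cupOp u f + cupOp u g := by
  simp [cupOp, mul_add, Finset.sum_add_distrib]

theorem cupOp_mul : cupOp u (fun k l => c * f k l) = c * cupOp u f := by
  simp [cupOp, Finset.mul_sum, mul_left_comm]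

theorem cupOp_neg : cupOp u (fun k l => -f k l) = -cupOp u f := by
  simp [cupOp]

theorem cupOp_sub : cupOp u (fun k l => f k l - g k l) = cupOp u f - cupOp u g := by
  simp [cupOp, mul_sub, Finset.sum_sub_distrib]

theorem crossOp_zero : crossOp X (fun _ _ => 0) x y = 0 := by
  simp [crossOp]

theorem cupOp_zero : cupOp u (fun _ _ => 0) = 0 := by
  simp [cupOp]

end Linear

/-- A vertex model for the Kauffman skein relation with `z = q + q⁻¹`: weights `X` of a positive
crossing, `n` of a maximum and `u` of a minimum. -/
structure IsModel (q a : F) (X : I → I → I → I → F) (n u : I → I → F) : Prop where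
  zigzag_left : ∀ (f : I → F) x, cupOp u (fun k l => n x k * f l) = f x
  zigzag_right : ∀ (f : I → F) x, cupOp u (fun k l => n l x * f k) = f x
  kink_cup : ∀ f, cupOp u (crossOp X f) = a⁻¹ * cupOp u f
  kink_cap : ∀ x y, crossOp X n x y = a⁻¹ * n x y
  slide : ∀ (f : I → F) x y w, crossOp X (fun k l => n l w * f k) x y + crossOp X (fun k l => n x k * f l) y w
    = (q + q⁻¹) * (n x y * f w + n y w * f x)
  inv : ∀ f x y, crossOp X (crossOp X f) x y =
    (q + q⁻¹) * crossOp X f x y + (q + q⁻¹) * a⁻¹ * n x y * cupOp u f - f x y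
  braid : ∀ (f : I → I → I → F) x y w,
    crossOp X (fun k l => crossOp X (fun k' m => crossOp X (fun i j => f i j m) k k') l w) x y =
    crossOp X (fun k l => crossOp X (fun i k' => crossOp X (fun j m => f i j m) k' l) x k) y w
  loop : (q + q⁻¹) * (cupOp u n + 1) = a + a⁻¹

/-- Add a new lowest label `none` and a new highest label `some none`. -/
def extX (q a : F) (X : I → I → I → I → F) (n u : I → I → F) [DecidableEq I] :
    Option (Option I) → Option (Option I) → Option (Option I) → Option (Option I) → F
  | none, none => fun
    | none, none => q
    | _, _ => 0
  | some none, some none => fun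
    | some none, some none => q
    | _, _ => 0
  | none, some none => fun
    | some none, none => q⁻¹
    | _, _ => 0
  | some none, none => fun
    | none, some none => q⁻¹
    | some none, none => (q + q⁻¹) * (1 - (a * q)⁻¹)
    | some (some v), some (some w) => -(q + q⁻¹) * (a * q)⁻¹ * u v w
    | _, _ => 0
  | none, some (some v) => fun
    | some (some w), none => if v = w then 1 else 0
    | _, _ => 0
  | some (some v), none => fun
    | none, some (some w) => if v = w then -1 else 0
    | some (some w), none => if v = w then q + q⁻¹ else 0
    | _, _ => 0
  | some (some v), some none => fun
    | some none, some (some w) => if v = w then -1 else 0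
    | _, _ => 0
  | some none, some (some v) => fun
    | some (some w), some none => if v = w then 1 else 0
    | some none, some (some w) => if v = w then q + q⁻¹ else 0
    | _, _ => 0
  | some (some v), some (some w) => fun
    | some (some x), some (some y) => X v w x y
    | some none, none => (q + q⁻¹) * n v w
    | _, _ => 0

/-- The extended weights of a maximum. -/
def extN (q a : F) (n : I → I → F) : Option (Option I) → Option (Option I) → F
  | none, some none => 1
  | some none, none => -(a * q)⁻¹
  | some (some v), some (some w) => n v w
  | _, _ => 0

/-- The extended weights of a minimum. -/
def extU (q a : F) (u : I → I → F) : Option (Option I) → Option (Option I) → F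
  | none, some none => -(a * q)
  | some none, none => 1
  | some (some v), some (some w) => u v w
  | _, _ => 0

section Ext

variable [DecidableEq I] (q a : F) (X : I → I → I → I → F) (n u : I → I → F)
  (f : Option (Option I) → Option (Option I) → F) (v w : I)

theorem crossOp_ext_low_low :
    crossOp (extX q a X n u) f none none = q * f none none := by
  simp [crossOp, Fintype.sum_option, extX]

theorem crossOp_ext_high_high :
    crossOp (extX q a X n u) f (some none) (some none) = q * f (some none) (some none) := by
  simp [crossOp, Fintype.sum_option, extX]

theorem crossOp_ext_low_high :
    crossOp (extX q a X n u) f none (some none) = q⁻¹ * f (some none) none := by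
  simp [crossOp, Fintype.sum_option, extX]

theorem crossOp_ext_high_low :
    crossOp (extX q a X n u) f (some none) none = q⁻¹ * f none (some none)
      + (q + q⁻¹) * (1 - (a * q)⁻¹) * f (some none) none
      + -(q + q⁻¹) * (a * q)⁻¹ * cupOp u (fun k l => f (some (some k)) (some (some l))) := by
  simp only [crossOp, Fintype.sum_option, extX, zero_mul, zero_add, add_zero,
    Finset.sum_const_zero, cupOp, Finset.mul_sum, mul_assoc]
  abel

theorem crossOp_ext_low_mid :
    crossOp (extX q a X n u) f none (some (some v)) = f (some (some v)) none := by
  simp [crossOp, Fintype.sum_option, extX]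

theorem crossOp_ext_mid_low :
    crossOp (extX q a X n u) f (some (some v)) none =
      -f none (some (some v)) + (q + q⁻¹) * f (some (some v)) none := by
  simp [crossOp, Fintype.sum_option, extX]

theorem crossOp_ext_mid_high :
    crossOp (extX q a X n u) f (some (some v)) (some none) = -f (some none) (some (some v)) := by
  simp [crossOp, Fintype.sum_option, extX]

theorem crossOp_ext_high_mid :
    crossOp (extX q a X n u) f (some none) (some (some v)) =
      f (some (some v)) (some none) + (q + q⁻¹) * f (some none) (some (some v)) := by
  simp [crossOp, Fintype.sum_option, extX, add_comm]

theorem crossOp_ext_mid_mid :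
    crossOp (extX q a X n u) f (some (some v)) (some (some w)) =
      crossOp X (fun k l => f (some (some k)) (some (some l))) v w
        + (q + q⁻¹) * n v w * f (some none) none := by
  simp [crossOp, Fintype.sum_option, extX, add_comm]

omit [DecidableEq I] in
theorem cupOp_ext : cupOp (extU q a u) f = -(a * q) * f none (some none) + f (some none) none
    + cupOp u (fun k l => f (some (some k)) (some (some l))) := by
  simp [cupOp, Fintype.sum_option, extU]
  ring

end Ext

theorem crossOp_comm_cupOp (X : I → I → I → I → F) (u : I → I → F) (f : I → I → I → I → F) (x y : I) :
    crossOp X (fun k l => cupOp u (f k l)) x y = cupOp u (fun i j => crossOp X (fun k l => f k l i j) x y) := by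
  simp only [crossOp, cupOp, Finset.mul_sum]
  simp only [← Fintype.sum_prod_type']
  refine Finset.sum_nbij' (fun p => (p.2.2.1, p.2.2.2, p.1, p.2.1))
    (fun p => (p.2.2.1, p.2.2.2, p.1, p.2.1)) ?_ ?_ ?_ ?_ ?_ <;> simp [mul_left_comm]

theorem cupOp_comm (u v : I → I → F) (f : I → I → I → I → F) :
    cupOp u (fun k l => cupOp v (f k l)) = cupOp v (fun i j => cupOp u (fun k l => f k l i j)) := by
  simp only [cupOp, Finset.mul_sum]
  simp only [← Fintype.sum_prod_type']
  refine Finset.sum_nbij' (fun p => (p.2.2.1, p.2.2.2, p.1, p.2.1))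
    (fun p => (p.2.2.1, p.2.2.2, p.1, p.2.1)) ?_ ?_ ?_ ?_ ?_ <;> simp [mul_left_comm]

namespace IsModel

variable {q a : F} {X : I → I → I → I → F} {n u : I → I → F} (h : IsModel q a X n u)
include h

/-- The field `slide` says that a positive crossing rotated by a maximum is the negative crossing,
the latter being expressed by the skein relation. Thus the crossing under the curl is traded for two
smoothings minus a kink at the minimum. The kink gives `a⁻¹`, the smoothings give a loop and a plain
strand, and `loop` is what makes the total equal to `a`. -/
theorem curl_left (f : I → F) (x : I) :
    cupOp u (fun k l => crossOp X (fun p r => n k p * f r) l x) = a * f x := by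
  have e (k l : I) : crossOp X (fun p r => n k p * f r) l x =
      (q + q⁻¹) * (f x * n k l + n l x * f k) - crossOp X (fun p r => n r x * f p) k l := by
    linear_combination h.slide f k l x
  simp only [e, cupOp_sub, cupOp_mul, cupOp_add, h.zigzag_right]
  have := h.kink_cup (fun p r => n r x * f p)
  rw [h.zigzag_right] at this
  rw [this]
  linear_combination f x * h.loop

theorem curl_right (f : I → F) (x : I) :
    cupOp u (fun k l => crossOp X (fun p r => n r l * f p) x k) = a * f x := by
  have e (k l : I) : crossOp X (fun p r => n r l * f p) x k =
      (q + q⁻¹) * (n x k * f l + f x * n k l) - crossOp X (fun p r => n x p * f r) k l := by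
    linear_combination h.slide f x k l
  simp only [e, cupOp_sub, cupOp_mul, cupOp_add, h.zigzag_left]
  have := h.kink_cup (fun p r => n x p * f r)
  rw [h.zigzag_left] at this
  rw [this]
  linear_combination f x * h.loop

/-- A strand passes entirely over or under a maximum. Rotating the inner crossing by `slide` leaves
two crossings on the same two strands, to which the quadratic relation `inv` applies; the smoothing
terms cancel by `kink_cap`. -/
theorem cap_slide_left (f : I → F) (x y w : I) :
    crossOp X (fun k l => crossOp X (fun i j => n k i * f j) l w) x y = n y w * f x := by
  have e (k l : I) : crossOp X (fun p r => n k p * f r) l w =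
      (q + q⁻¹) * (f w * n k l + n l w * f k) - crossOp X (fun p r => n r w * f p) k l := by
    linear_combination h.slide f k l w
  simp only [e, crossOp_sub, crossOp_mul, crossOp_add]
  have := h.inv (fun p r => n r w * f p) x y
  rw [h.zigzag_right] at this
  have h2 := h.kink_cap x y
  rw [this, h2]
  ring

theorem cap_slide_right (f : I → F) (x y w : I) :
    crossOp X (fun k l => crossOp X (fun i j => n j l * f i) x k) y w = n x y * f w := by
  have e (k l : I) : crossOp X (fun p r => n r l * f p) x k =
      (q + q⁻¹) * (n x k * f l + f x * n k l) - crossOp X (fun p r => n x p * f r) k l := by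
    linear_combination h.slide f x k l
  simp only [e, crossOp_sub, crossOp_mul, crossOp_add]
  have := h.inv (fun p r => n x p * f r) y w
  rw [h.zigzag_left] at this
  have h2 := h.kink_cap y w
  rw [this, h2]
  ring

/-- This is the dual of the field `slide`. It need not be an axiom: a zigzag is inserted in one
strand, its maximum is moved through the crossing by `slide`, and the zigzags that remain are
straightened. -/
theorem cup_slide (f : I → I → I → F) (x : I) :
    cupOp u (fun k l => crossOp X (f k) l x)
      + cupOp u (fun k l => crossOp X (fun i j => f i j l) x k) =
    (q + q⁻¹) * (cupOp u (fun k l => f k l x) + cupOp u (f x)) := by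
  -- Inserts the zigzag, with its sum over `s` and `t` pulled out of the crossing.
  have e1 : cupOp u (fun k l => crossOp X (f k) l x) =
      cupOp u (fun k l => cupOp u (fun s t => crossOp X (fun j m => n m s * f k j t) l x)) := by
    congr! 3 with k l
    rw [← crossOp_comm_cupOp (f := fun j m s t => n m s * f k j t)]
    congr! 3 with j m
    exact (h.zigzag_left (fun t => f k j t) m).symm
  have e2 (k l s t : I) : crossOp X (fun j m => n m s * f k j t) l x =
      (q + q⁻¹) * (n l x * f k s t + n x s * f k l t) - crossOp X (fun p r => n l p * f k r t) x s := by
    linear_combination h.slide (fun j => f k j t) l x s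
  rw [e1]
  simp only [e2, cupOp_sub, cupOp_mul, cupOp_add]
  have e3 : cupOp u (fun k l => n l x * cupOp u (f k)) = cupOp u (f x) :=
    h.zigzag_right (fun k => cupOp u (f k)) x
  have e4 : cupOp u (fun k l => cupOp u (fun s t => n x s * f k l t)) = cupOp u (fun k l => f k l x) := by
    congr! 3 with k l
    exact h.zigzag_left (fun t => f k l t) x
  have e5 : cupOp u (fun k l => cupOp u (fun s t => crossOp X (fun p r => n l p * f k r t) x s)) =
      cupOp u (fun k l => crossOp X (fun i j => f i j l) x k) := by
    rw [cupOp_comm]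
    congr! 3 with s t
    rw [← crossOp_comm_cupOp (f := fun p r k l => n l p * f k r t)]
    congr! 3 with p r
    exact h.zigzag_right (fun k => f k r t) p
  rw [e3, e4, e5]
  ring

/-- As for maxima, with `cup_slide` in the role of `slide` and `kink_cup` in that of `kink_cap`. -/
theorem cup_slide_left (f : I → I → I → F) (x : I) :
    cupOp u (fun k l => crossOp X (fun p m => crossOp X (fun i j => f i j m) k p) l x) =
      cupOp u (f x) := by
  have := h.cup_slide (fun k p m => crossOp X (fun i j => f i j m) k p) x
  have e (k l : I) := h.inv (fun i j => f i j l) x k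
  have e' (k l : I) : crossOp X (fun i j => crossOp X (fun i j => f i j l) i j) x k = _ := e k l
  have e3 := h.zigzag_left (fun l => cupOp u (fun i j => f i j l)) x
  simp only [e', cupOp_sub, cupOp_add, cupOp_mul, mul_assoc, e3] at this
  rw [h.kink_cup (fun i j => f i j x)] at this
  linear_combination this

theorem cup_slide_right (f : I → I → I → F) (x : I) :
    cupOp u (fun k l => crossOp X (fun i p => crossOp X (fun j m => f i j m) p l) x k) =
      cupOp u (fun k l => f k l x) := by
  have := h.cup_slide (fun k p m => crossOp X (fun i j => f k i j) p m) x
  have e (k l : I) := h.inv (fun i j => f k i j) l x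
  have e' (k l : I) : crossOp X (fun i j => crossOp X (fun i j => f k i j) i j) l x = _ := e k l
  have e3 := h.zigzag_right (fun l => cupOp u (fun i j => f l i j)) x
  simp only [e', cupOp_sub, cupOp_add, cupOp_mul, mul_assoc, e3] at this
  rw [h.kink_cup (fun i j => f x i j)] at this
  linear_combination this

theorem crossOp_cap (c : F) (x y : I) :
    crossOp X (fun k l => n k l * c) x y = a⁻¹ * n x y * c := by
  simp only [mul_comm _ c, crossOp_mul]
  rw [h.kink_cap]

omit h in
theorem _root_.TiedLink.cupOp_cap (c : F) : cupOp u (fun k l => n k l * c) = cupOp u n * c := by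
  simp only [mul_comm _ c, cupOp_mul]

theorem loop_eq (hq : q ≠ 0) (hq2 : q ^ 2 + 1 ≠ 0) :
    cupOp u n = (a + a⁻¹) / (q + q⁻¹) - 1 := by
  have hz : q + q⁻¹ ≠ 0 := by
    intro h0
    apply hq2
    rw [← mul_right_inj' (inv_ne_zero hq), mul_zero, ← h0]
    field_simp
  rw [eq_sub_iff_add_eq, eq_div_iff hz, ← h.loop]
  ring

variable [DecidableEq I]

omit h in
-- Each of the three labels is low, high or old, which gives 27 cases. In all of them the new
-- weights reduce the identity to isotopies, curls and loops of the old model. This is why the old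
-- model's `cap_slide`, `cup_slide`, curl and loop lemmas were prepared.
theorem ext_braid (h : IsModel q a X n u) (hq : q ≠ 0) (hq2 : q ^ 2 + 1 ≠ 0) (ha : a ≠ 0) (f : Option (Option I) → Option (Option I) → Option (Option I) → F)
    (x y w : Option (Option I)) :
    crossOp (extX q a X n u) (fun k l => crossOp (extX q a X n u) (fun k' m => crossOp (extX q a X n u) (fun i j => f i j m) k k') l w) x y =
    crossOp (extX q a X n u) (fun k l => crossOp (extX q a X n u) (fun i k' => crossOp (extX q a X n u) (fun j m => f i j m) k' l) x k) y w := by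
  rcases x with _ | _ | x <;> rcases y with _ | _ | y <;> rcases w with _ | _ | w <;>
  simp only [crossOp_ext_low_low, crossOp_ext_low_high, crossOp_ext_low_mid, crossOp_ext_high_low,
    crossOp_ext_high_high, crossOp_ext_high_mid, crossOp_ext_mid_low, crossOp_ext_mid_high,
    crossOp_ext_mid_mid, crossOp_add, crossOp_mul, crossOp_neg, cupOp_add, cupOp_mul, cupOp_neg, h.cap_slide_left, h.cap_slide_right,
    h.cup_slide_left (fun i j k => f (some (some i)) (some (some j)) (some (some k))), h.cup_slide_right (fun i j k => f (some (some i)) (some (some j)) (some (some k))), h.curl_left, h.curl_right, h.zigzag_left, h.zigzag_right, h.inv, h.kink_cup,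
    h.crossOp_cap, cupOp_cap, h.braid (fun i j k => f (some (some i)) (some (some j)) (some (some k))), h.loop_eq hq hq2, mul_assoc]
  all_goals first | ring1 | (field_simp; done) | (field_simp; ring1) | skip
  -- Labels high, old, low: the two sides differ by a multiple of the `cup_slide` relation of the
  -- old model.
  · have := h.cup_slide (fun i j k => f (some (some i)) (some (some j)) (some (some k))) y
    field_simp at this ⊢
    linear_combination (-(1 + q ^ 2)) * this
  -- Three old labels: besides the old braid relation there are terms in which a maximum emits the
  -- pair high, low around a strand. They cancel by the old `slide`.
  · have := h.slide (fun k => f (some none) (some (some k)) none) x y w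
    simp only [mul_neg, crossOp_neg]
    linear_combination -(q + q⁻¹) * this

/-- The model with two more labels. -/
theorem ext (hq : q ≠ 0) (hq2 : q ^ 2 + 1 ≠ 0) (ha : a ≠ 0) :
    -- The new parameter can be read off from the kink at the labels low, high: the crossing gives
    -- `q⁻¹` times the weight `-(a * q)⁻¹` of high, low, and the weight of low, high is `1`.
    IsModel q (-(a * q ^ 2)) (extX q a X n u) (extN q a n) (extU q a u) where
  zigzag_left f x := by
    rcases x with _ | _ | x <;>
    simp only [cupOp_ext, extN, h.zigzag_left (fun l => f (some (some l))), cupOp_zero, zero_mul,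
      mul_zero, add_zero, zero_add, one_mul]
    all_goals field_simp
  zigzag_right f x := by
    rcases x with _ | _ | x <;>
    simp only [cupOp_ext, extN, h.zigzag_right (fun l => f (some (some l))), cupOp_zero, zero_mul,
      mul_zero, add_zero, zero_add, one_mul]
    all_goals field_simp
  kink_cup f := by
    simp only [cupOp_ext, crossOp_ext_low_high, crossOp_ext_high_low, crossOp_ext_mid_mid,
      cupOp_add, h.kink_cup, mul_assoc, cupOp_mul, cupOp_cap, h.loop_eq hq hq2]
    field_simp
    ring
  kink_cap x y := by
    have e : crossOp X (fun k l => extN q a n (some (some k)) (some (some l))) = crossOp X n := rfl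
    rcases x with _ | _ | x <;> rcases y with _ | _ | y <;>
    simp only [crossOp_ext_low_low, crossOp_ext_low_high, crossOp_ext_low_mid,
      crossOp_ext_high_low, crossOp_ext_high_high, crossOp_ext_high_mid, crossOp_ext_mid_low,
      crossOp_ext_mid_high, crossOp_ext_mid_mid]
    all_goals simp only [extN, h.loop_eq hq hq2, mul_assoc, h.kink_cap, mul_zero, zero_add,
      neg_zero, mul_one]
    all_goals field_simp
    all_goals ring
  slide f x y w := by
    rcases x with _ | _ | x <;> rcases y with _ | _ | y <;> rcases w with _ | _ | w <;>
    simp only [crossOp_ext_low_low, crossOp_ext_low_high, crossOp_ext_low_mid,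
      crossOp_ext_high_low, crossOp_ext_high_high, crossOp_ext_high_mid, crossOp_ext_mid_low,
      crossOp_ext_mid_high, crossOp_ext_mid_mid, extN, zero_mul, mul_zero, add_zero, zero_add,
      cupOp_zero, crossOp_zero, h.zigzag_left, h.zigzag_right]
    all_goals first | ring1 | (field_simp; done) | (field_simp; ring1) | skip
    exact h.slide (fun k => f (some (some k))) x y w
  inv f x y := by
    have e (g : I → I → F) : crossOp X (fun k l => crossOp X g k l) = crossOp X (crossOp X g) := rfl
    rcases x with _ | _ | x <;> rcases y with _ | _ | y <;>
    simp only [crossOp_ext_low_low, crossOp_ext_low_high, crossOp_ext_low_mid,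
      crossOp_ext_high_low, crossOp_ext_high_high, crossOp_ext_high_mid, crossOp_ext_mid_low,
      crossOp_ext_mid_high, crossOp_ext_mid_mid, extN, zero_mul, mul_zero, add_zero,
      crossOp_mul, crossOp_add, h.kink_cup, cupOp_cap, cupOp_ext, cupOp_add, cupOp_mul,
      h.loop_eq hq hq2, mul_assoc, h.inv, h.crossOp_cap]
    all_goals first | ring1 | (field_simp; done) | (field_simp; ring1)
  braid f x y w := h.ext_braid hq hq2 ha f x y w
  loop := by
    have e : cupOp u (fun k l => extN q a n (some (some k)) (some (some l))) = cupOp u n := rfl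
    have := h.loop
    simp only [cupOp_ext, e]
    simp only [extN, h.loop_eq hq hq2]
    field_simp
    ring

end IsModel

/-- The model without labels. -/
theorem isModel_empty {q : F} :
    IsModel (I := PEmpty) q q (fun _ _ _ _ => 0) (fun _ _ => 0) (fun _ _ => 0) where
  zigzag_left _ x := x.elim
  zigzag_right _ x := x.elim
  kink_cup f := by simp [cupOp]
  kink_cap x := x.elim
  slide _ x := x.elim
  inv _ x := x.elim
  braid _ x := x.elim
  loop := by simp [cupOp]

/-- For fixed `q` the exponent `k` supplies the many values of `a` that are needed to recover a
polynomial from its values. -/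
theorem exists_isModel {q : F} (hq : q ≠ 0) (hq2 : q ^ 2 + 1 ≠ 0) (k : ℕ) :
    ∃ (I : Type) (_ : Fintype I) (X : I → I → I → I → F) (n u : I → I → F),
      IsModel q (q * (-q ^ 2) ^ k) X n u := by
  induction k with
  | zero => exact ⟨PEmpty, inferInstance, _, _, _, by simpa using isModel_empty⟩
  | succ k ih =>
    obtain ⟨I, _, X, n, u, h⟩ := ih
    classical
    have e := h.ext hq hq2 (mul_ne_zero hq (pow_ne_zero k (neg_ne_zero.2 (pow_ne_zero 2 hq))))
    rw [show -(q * (-q ^ 2) ^ k * q ^ 2) = q * (-q ^ 2) ^ (k + 1) by ring] at e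
    exact ⟨Option (Option I), inferInstance, _, _, _, e⟩

end VertexModel
end TiedLink

namespace TiedLink

open Letter Word

/-! ### Typing of words and the generating moves -/

section Tangles

variable {κ κ' : Type}

namespace Letter

theorem shift_shift (x : Letter κ) (k l : ℕ) : (x.shift k).shift l = x.shift (k + l) := by
  cases x <;> simp [Letter.shift, add_assoc]

theorem shift_zero (x : Letter κ) : x.shift 0 = x := by cases x <;> rfl

theorem pos_shift (x : Letter κ) (k : ℕ) : (x.shift k).pos = x.pos + k := by cases x <;> rfl

theorem inp_shift (x : Letter κ) (k : ℕ) : (x.shift k).inp = x.inp := by cases x <;> rfl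

theorem out_shift (x : Letter κ) (k : ℕ) : (x.shift k).out = x.out := by cases x <;> rfl

theorem Acts.whisker_right {x : Letter κ} {s t : List κ} (h : x.Acts s t) (r : List κ) :
    x.Acts (s ++ r) (t ++ r) := by
  cases h with
  | cup l r' c => simpa using Acts.cup l (r' ++ r) c
  | cap l r' c => simpa using Acts.cap l (r' ++ r) c
  | cross l r' c d b => simpa using Acts.cross l (r' ++ r) c d b

theorem Acts.whisker_left {x : Letter κ} {s t : List κ} (h : x.Acts s t) (l : List κ) :
    (x.shift l.length).Acts (l ++ s) (l ++ t) := by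
  cases h with
  | cup l' r c => simpa [Letter.shift, add_comm] using Acts.cup (l ++ l') r c
  | cap l' r c => simpa [Letter.shift, add_comm] using Acts.cap (l ++ l') r c
  | cross l' r c d b => simpa [Letter.shift, add_comm] using Acts.cross (l ++ l') r c d b

@[simp] theorem acts_cup_zero {c : κ} {s t : List κ} : (cup 0 c).Acts s t ↔ t = c :: c :: s := by
  constructor
  · intro h
    generalize hx : cup 0 c = x at h
    cases h <;> simp_all
    obtain rfl := List.length_eq_zero_iff.1 hx.1.symm
    simp
  · rintro rfl
    exact Acts.cup [] s c

@[simp] theorem acts_cap_zero {s t : List κ} : (cap 0).Acts s t ↔ ∃ c, s = c :: c :: t := by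
  constructor
  · intro h
    generalize hx : cap 0 = x at h
    cases h <;> simp_all
    rename_i l r _
    obtain rfl : l = [] := List.length_eq_zero_iff.1 hx.symm
    simp
  · rintro ⟨c, rfl⟩
    exact Acts.cap [] t c

@[simp] theorem acts_cross_zero {b : Bool} {s t : List κ} :
    (cross 0 b).Acts s t ↔ ∃ c d r, s = c :: d :: r ∧ t = d :: c :: r := by
  constructor
  · intro h
    generalize hx : cross 0 b = x at h
    cases h <;> simp_all
    rename_i l r _ _ _
    obtain rfl : l = [] := List.length_eq_zero_iff.1 hx.1.symm
    simp
  · rintro ⟨c, d, r, rfl, rfl⟩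
    exact Acts.cross [] r c d b

theorem acts_shift_one {x : Letter κ} {s t : List κ} :
    (x.shift 1).Acts s t ↔ ∃ c s' t', s = c :: s' ∧ t = c :: t' ∧ x.Acts s' t' := by
  constructor
  · intro h
    generalize hy : x.shift 1 = y at h
    cases h with
    | cup l r c =>
      cases x <;> simp [Letter.shift] at hy
      rcases l with _ | ⟨d, l⟩
      · simp at hy
      · obtain ⟨h1, rfl⟩ := hy
        simp at h1; subst h1
        exact ⟨d, _, _, rfl, rfl, Acts.cup l r _⟩
    | cap l r c =>
      cases x <;> simp [Letter.shift] at hy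
      rcases l with _ | ⟨d, l⟩
      · simp at hy
      · simp at hy; subst hy
        exact ⟨d, _, _, rfl, rfl, Acts.cap l r c⟩
    | cross l r c d b =>
      cases x <;> simp [Letter.shift] at hy
      rcases l with _ | ⟨e, l⟩
      · simp at hy
      · obtain ⟨h1, rfl⟩ := hy
        simp at h1; subst h1
        exact ⟨e, _, _, rfl, rfl, Acts.cross l r c d _⟩
  · rintro ⟨c, s, t, rfl, rfl, h⟩
    exact h.whisker_left [c]

@[simp] theorem acts_cup_succ {i : ℕ} {c : κ} {s t : List κ} : (cup (i + 1) c).Acts s t ↔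
    ∃ d s' t', s = d :: s' ∧ t = d :: t' ∧ (cup i c).Acts s' t' := acts_shift_one (x := cup i c)

@[simp] theorem acts_cap_succ {i : ℕ} {s t : List κ} : (cap (i + 1)).Acts s t ↔
    ∃ d s' t', s = d :: s' ∧ t = d :: t' ∧ (cap i).Acts s' t' := acts_shift_one (x := cap i)

@[simp] theorem acts_cross_succ {i : ℕ} {b : Bool} {s t : List κ} :
    (cross (i + 1) b).Acts s t ↔
    ∃ d s' t', s = d :: s' ∧ t = d :: t' ∧ (cross i b).Acts s' t' :=
  acts_shift_one (x := cross i b)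

theorem acts_shift {x : Letter κ} {k : ℕ} {s t : List κ} (h : (x.shift k).Acts s t) :
    ∃ l s' t', l.length = k ∧ s = l ++ s' ∧ t = l ++ t' ∧ x.Acts s' t' := by
  induction k generalizing s t with
  | zero => exact ⟨[], s, t, rfl, rfl, rfl, by simpa [shift_zero] using h⟩
  | succ k ih =>
    rw [← shift_shift, acts_shift_one] at h
    obtain ⟨c, s, t, rfl, rfl, h⟩ := h
    obtain ⟨l, s, t, rfl, rfl, rfl, h⟩ := ih h
    exact ⟨c :: l, s, t, rfl, rfl, rfl, ‹x.Acts s t›⟩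

theorem Acts.unique {x : Letter κ} {s t t' : List κ} (h : x.Acts s t) (h' : x.Acts s t') :
    t = t' := by
  cases h with
  | cup l r c =>
    obtain ⟨l', s', t', h1, h2, rfl, h3⟩ := acts_shift (x := Letter.cup 0 c) (k := l.length) (by simpa [Letter.shift] using h')
    obtain ⟨rfl, rfl⟩ := List.append_inj h2 h1.symm
    simp_all
  | cap l r c =>
    obtain ⟨l', s', t', h1, h2, rfl, h3⟩ := acts_shift (x := Letter.cap 0) (k := l.length) (by simpa [Letter.shift] using h')
    obtain ⟨rfl, rfl⟩ := List.append_inj h2 h1.symm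
    simp_all
  | cross l r c d b =>
    obtain ⟨l', s', t', h1, h2, rfl, h3⟩ := acts_shift (x := Letter.cross 0 b) (k := l.length) (by simpa [Letter.shift] using h')
    obtain ⟨rfl, rfl⟩ := List.append_inj h2 h1.symm
    simp_all

theorem Acts.length {x : Letter κ} {s t : List κ} (h : x.Acts s t) :
    x.pos + x.out ≤ t.length ∧ t.length + x.inp = s.length + x.out := by
  cases h <;> simp [Letter.pos, Letter.inp, Letter.out] <;> omega

theorem Acts.pos_le {x : Letter κ} {s t : List κ} (h : x.Acts s t) : x.pos ≤ s.length := by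
  have := h.length
  cases x <;> simp [Letter.pos, Letter.out, Letter.inp] at this ⊢ <;> omega

end Letter

namespace Word

@[simp] theorem typed_nil {s t : List κ} : Typed [] s t ↔ s = t :=
  ⟨fun h => by cases h; rfl, fun h => h ▸ Typed.nil s⟩

@[simp] theorem typed_cons {x : Letter κ} {w : Word κ} {s t : List κ} :
    Typed (x :: w) s t ↔ ∃ r, x.Acts s r ∧ Typed w r t :=
  ⟨fun h => by cases h with | cons h1 h2 => exact ⟨_, h1, h2⟩, fun ⟨_, h1, h2⟩ => Typed.cons h1 h2⟩

theorem typed_append {u v : Word κ} {s t : List κ} :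
    Typed (u ++ v) s t ↔ ∃ r, Typed u s r ∧ Typed v r t := by
  induction u generalizing s with
  | nil => simp
  | cons x u ih =>
    simp only [List.cons_append, typed_cons, ih]
    constructor
    · rintro ⟨r, h1, r', h2, h3⟩
      exact ⟨r', ⟨r, h1, h2⟩, h3⟩
    · rintro ⟨r', ⟨r, h1, h2⟩, h3⟩
      exact ⟨r, h1, r', h2, h3⟩

theorem Typed.append {u v : Word κ} {s r t : List κ} (hu : Typed u s r) (hv : Typed v r t) :
    Typed (u ++ v) s t := typed_append.2 ⟨r, hu, hv⟩

theorem typed_singleton {x : Letter κ} {s t : List κ} : Typed [x] s t ↔ x.Acts s t := by simp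

theorem Typed.unique {w : Word κ} {s t t' : List κ} (h : Typed w s t) (h' : Typed w s t') :
    t = t' := by
  induction h with
  | nil => simpa using h'
  | cons hx _ ih =>
    obtain ⟨r, h1, h2⟩ := typed_cons.1 h'
    obtain rfl := hx.unique h1
    exact ih h2

theorem Typed.whisker_right {w : Word κ} {s t : List κ} (h : Typed w s t) (r : List κ) :
    Typed w (s ++ r) (t ++ r) := by
  induction h with
  | nil => exact Typed.nil _
  | cons hx _ ih => exact Typed.cons (hx.whisker_right r) ih

theorem Typed.whisker_left {w : Word κ} {s t : List κ} (h : Typed w s t) (l : List κ) :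
    Typed (Word.shift l.length w) (l ++ s) (l ++ t) := by
  induction h with
  | nil => exact Typed.nil _
  | cons hx _ ih => exact Typed.cons (hx.whisker_left l) ih

@[simp] theorem shift_nil (k : ℕ) : Word.shift k ([] : Word κ) = [] := rfl

@[simp] theorem shift_cons (k : ℕ) (x : Letter κ) (w : Word κ) :
    Word.shift k (x :: w) = x.shift k :: Word.shift k w := rfl

@[simp] theorem shift_append (k : ℕ) (u v : Word κ) :
    Word.shift k (u ++ v) = Word.shift k u ++ Word.shift k v := List.map_append

theorem shift_shift (w : Word κ) (k l : ℕ) :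
    Word.shift l (Word.shift k w) = Word.shift (k + l) w := by
  simp [Word.shift, Function.comp_def, Letter.shift_shift]

theorem shift_zero (w : Word κ) : Word.shift 0 w = w := by
  rw [Word.shift, funext (Letter.shift_zero (κ := κ)), List.map_id']

@[simp] theorem recolor_nil (f : κ → κ') : Word.recolor f [] = [] := rfl

@[simp] theorem recolor_cons (f : κ → κ') (x : Letter κ) (w : Word κ) :
    Word.recolor f (x :: w) = x.recolor f :: Word.recolor f w := rfl

@[simp] theorem recolor_append (f : κ → κ') (u v : Word κ) :
    Word.recolor f (u ++ v) = Word.recolor f u ++ Word.recolor f v := List.map_append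

end Word

/-- Generating moves between coloured tangle words; the integer is the exponent of `a`. -/
inductive Gen : ℤ → Word κ → Word κ → Prop
  | exchange (x y : Letter κ) : x.pos ≤ y.pos → Gen 0 [x, y.shift x.out] [y.shift x.inp, x]
  | zigzag_left (i : ℕ) (c : κ) : Gen 0 [cup (i + 1) c, cap i] []
  | zigzag_right (i : ℕ) (c : κ) : Gen 0 [cup i c, cap (i + 1)] []
  | cap_slide (i : ℕ) (b : Bool) : Gen 0 [cross i b, cap (i + 1)] [cross (i + 1) (!b), cap i]
  | two (i : ℕ) (b : Bool) : Gen 0 [cross i b, cross i (!b)] []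
  | three (i : ℕ) : Gen 0 [cross i true, cross (i + 1) true, cross i true]
      [cross (i + 1) true, cross i true, cross (i + 1) true]
  | curl (i : ℕ) (c : κ) (b : Bool) :
      Gen (if b then 1 else -1) [cup (i + 1) c, cross i b, cap (i + 1)] []

theorem Gen.shift {n : ℤ} {m m' : Word κ} (h : Gen n m m') (k : ℕ) :
    Gen n (Word.shift k m) (Word.shift k m') := by
  cases h with
  | exchange x y h =>
    have := Gen.exchange (x.shift k) (y.shift k) (by simpa [Letter.pos_shift] using h)
    simpa [Letter.shift_shift, Letter.out_shift, Letter.inp_shift, add_comm] using this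
  | zigzag_left i c => simpa [Letter.shift, add_right_comm] using Gen.zigzag_left (i + k) c
  | zigzag_right i c => simpa [Letter.shift, add_right_comm] using Gen.zigzag_right (i + k) c
  | cap_slide i b => simpa [Letter.shift, add_right_comm] using Gen.cap_slide (κ := κ) (i + k) b
  | two i b => simpa [Letter.shift, add_right_comm] using Gen.two (κ := κ) (i + k) b
  | three i => simpa [Letter.shift, add_right_comm] using Gen.three (κ := κ) (i + k)
  | curl i c b => simpa [Letter.shift, add_right_comm] using Gen.curl (i + k) c b

/-- The bound on `k` matters for the empty word, which carries no trace of the shift. -/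
theorem Typed.of_shift {w : Word κ} {k : ℕ} {s t : List κ} (h : Typed (Word.shift k w) s t) (hk : k ≤ s.length) :
    ∃ l s' t', l.length = k ∧ s = l ++ s' ∧ t = l ++ t' ∧ Typed w s' t' := by
  induction w generalizing s t with
  | nil =>
    simp at h; subst h
    exact ⟨s.take k, s.drop k, s.drop k, by simpa using hk, by simp, by simp, Typed.nil _⟩
  | cons x w ih =>
    simp only [Word.shift_cons, typed_cons] at h
    obtain ⟨r, h1, h2⟩ := h
    obtain ⟨l, s', r', rfl, rfl, rfl, h3⟩ := acts_shift h1
    obtain ⟨l', s'', t'', h4, h5, rfl, h6⟩ := ih h2 (by simp)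
    obtain ⟨rfl, rfl⟩ := List.append_inj h5 h4.symm
    exact ⟨l, s', t'', rfl, rfl, rfl, Typed.cons h3 h6⟩

/-- The letters in an exchange move are side by side. -/
theorem exchange_split {x y : Letter κ} (hxy : x.pos ≤ y.pos) {s t : List κ} (h : Typed [x, y.shift x.out] s t) :
    ∃ (y' : Letter κ) (s₁ t₁ s₂ t₂ : List κ), x.Acts s₁ t₁ ∧ y'.Acts s₂ t₂ ∧ s = s₁ ++ s₂ ∧
      y.shift x.out = y'.shift t₁.length ∧ y.shift x.inp = y'.shift s₁.length := by
  simp only [typed_cons, typed_nil, exists_eq_right] at h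
  obtain ⟨r, h1, h2⟩ := h
  obtain ⟨y, rfl⟩ : ∃ y', y = Letter.shift x.pos y' := by
    obtain ⟨k, hk⟩ := Nat.exists_eq_add_of_le' hxy
    cases y with
    | cup i c => exact ⟨cup k c, by rw [Letter.shift, ← hk]; rfl⟩
    | cap i => exact ⟨cap k, by rw [Letter.shift, ← hk]; rfl⟩
    | cross i b => exact ⟨cross k b, by rw [Letter.shift, ← hk]; rfl⟩
  rw [Letter.shift_shift] at h2 ⊢
  obtain ⟨l, s', t', h3, hr, rfl, h4⟩ := acts_shift h2
  rw [Letter.shift_shift]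
  cases h1 with
  | cup l' r c =>
    simp only [Letter.pos, Letter.out, Letter.inp] at h3 h4 ⊢
    obtain ⟨rfl, rfl⟩ := List.append_inj (s₁ := l' ++ [c, c]) (t₁ := r) (by simpa using hr) (by simp [h3])
    exact ⟨y, l', l' ++ [c, c], r, t', by simpa using Acts.cup l' [] c, h4, rfl, by simp, by simp⟩
  | cap l' r c =>
    simp only [Letter.pos, Letter.out, Letter.inp] at h3 h4 ⊢
    obtain ⟨rfl, rfl⟩ := List.append_inj hr (by simp [h3])
    exact ⟨y, l' ++ [c, c], l', r, t', by simpa using Acts.cap l' [] c, h4, by simp, by simp, by simp⟩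
  | cross l' r c d b =>
    simp only [Letter.pos, Letter.out, Letter.inp] at h3 h4 ⊢
    obtain ⟨rfl, rfl⟩ := List.append_inj (s₁ := l' ++ [d, c]) (t₁ := r) (by simpa using hr) (by simp [h3])
    exact ⟨y, l' ++ [c, d], l' ++ [d, c], r, t', by simpa using Acts.cross l' [] c d b, h4, by simp, by simp, by simp⟩

/-- Typing is transported in this direction only: a zigzag or a curl prescribes the colour of its
strand, while the empty word fits on every list. All moves but the exchange are reduced to `i = 0`
by removing the strands on the left. -/
theorem Gen.typed {n : ℤ} {m m' : Word κ} (h : Gen n m m') {s t : List κ} (hm : Typed m s t) :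
    Typed m' s t := by
  have shifted {m m' : Word κ} {i : ℕ} (hi : Typed (Word.shift i m) s t)
      (hl : i ≤ s.length)
      (h0 : ∀ s t, Typed m s t → Typed m' s t) : Typed (Word.shift i m') s t := by
    obtain ⟨l, s', t', rfl, rfl, rfl, h⟩ := Typed.of_shift hi hl
    exact (h0 _ _ h).whisker_left l
  have len {x : Letter κ} {w : Word κ} (hi : Typed (x :: w) s t) : x.pos + x.inp ≤ s.length := by
    obtain ⟨r, h1, -⟩ := typed_cons.1 hi
    have := h1.length
    omega
  cases h with
  | exchange x y h =>
    obtain ⟨y', s₁, t₁, s₂, t₂, h1, h2, rfl, h3, h4⟩ := exchange_split h hm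
    rw [h3] at hm
    obtain rfl := hm.unique (Typed.cons (h1.whisker_right s₂) (typed_singleton.2 (h2.whisker_left t₁)))
    rw [h4]
    exact Typed.cons (h2.whisker_left s₁) (typed_singleton.2 (h1.whisker_right t₂))
  | zigzag_left i c =>
    have h0 := len hm
    simp only [Letter.pos, Letter.inp] at h0
    have := shifted (i := i) (m := [cup 1 c, cap 0]) (m' := [])
      (by simpa only [Word.shift_cons, Word.shift_nil, Letter.shift, add_comm, add_zero] using hm)
      (by omega) (by rintro s t h; simp at h ⊢; grind)
    simpa only [Word.shift_cons, Word.shift_nil, Letter.shift, add_comm, add_zero] using this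
  | zigzag_right i c =>
    have h0 := len hm
    simp only [Letter.pos, Letter.inp] at h0
    have := shifted (i := i) (m := [cup 0 c, cap 1]) (m' := [])
      (by simpa only [Word.shift_cons, Word.shift_nil, Letter.shift, add_comm, add_zero] using hm)
      (by omega) (by rintro s t h; simp at h ⊢; grind)
    simpa only [Word.shift_cons, Word.shift_nil, Letter.shift, add_comm, add_zero] using this
  | cap_slide i b =>
    have h0 := len hm
    simp only [Letter.pos, Letter.inp] at h0
    have := shifted (i := i) (m := [cross 0 b, cap 1]) (m' := [cross 1 (!b), cap 0])
      (by simpa only [Word.shift_cons, Word.shift_nil, Letter.shift, add_comm, add_zero] using hm)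
      (by omega) (by rintro s t h; simp at h ⊢; grind)
    simpa only [Word.shift_cons, Word.shift_nil, Letter.shift, add_comm, add_zero] using this
  | two i b =>
    have h0 := len hm
    simp only [Letter.pos, Letter.inp] at h0
    have := shifted (i := i) (m := [cross 0 b, cross 0 (!b)]) (m' := [])
      (by simpa only [Word.shift_cons, Word.shift_nil, Letter.shift, add_comm, add_zero] using hm)
      (by omega) (by rintro s t h; simp at h ⊢; grind)
    simpa only [Word.shift_cons, Word.shift_nil, Letter.shift, add_comm, add_zero] using this
  | three i =>
    have h0 := len hm
    simp only [Letter.pos, Letter.inp] at h0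
    have := shifted (i := i) (m := [cross 0 true, cross 1 true, cross 0 true]) (m' := [cross 1 true, cross 0 true, cross 1 true])
      (by simpa only [Word.shift_cons, Word.shift_nil, Letter.shift, add_comm, add_zero] using hm)
      (by omega) (by rintro s t h; simp at h ⊢; grind)
    simpa only [Word.shift_cons, Word.shift_nil, Letter.shift, add_comm, add_zero] using this
  | curl i c b =>
    have h0 := len hm
    simp only [Letter.pos, Letter.inp] at h0
    have := shifted (i := i) (m := [cup 1 c, cross 0 b, cap 1]) (m' := [])
      (by simpa only [Word.shift_cons, Word.shift_nil, Letter.shift, add_comm, add_zero] using hm)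
      (by omega) (by rintro s t h; simp at h ⊢; grind)
    simpa only [Word.shift_cons, Word.shift_nil, Letter.shift, add_comm, add_zero] using this

theorem Gen.recolor {n : ℤ} {m m' : Word κ} (g : Gen n m m') (f : κ → κ') :
    Gen n (Word.recolor f m) (Word.recolor f m') := by
  cases g with
  | exchange x y hxy =>
    have := Gen.exchange (x.recolor f) (y.recolor f) (by cases x <;> cases y <;> exact hxy)
    cases x <;> cases y <;> exact this
  | zigzag_left i d => exact Gen.zigzag_left i _
  | zigzag_right i d => exact Gen.zigzag_right i _
  | cap_slide i b => exact Gen.cap_slide i b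
  | two i b => exact Gen.two i b
  | three i => exact Gen.three i
  | curl i d b => exact Gen.curl i _ b

end Tangles

end TiedLink

namespace TiedLink

open Letter Word

/-! ### Isotopies of tangles derived from the generators -/

section Tangles

variable {κ : Type}

/-- Tangle words with the same ends which are related by the generating moves, up to a power
of `a`. -/
inductive Iso : ℤ → List κ → List κ → Word κ → Word κ → Prop
  | step {n : ℤ} {m m' : Word κ} {s t : List κ} : Gen n m m' → Typed m s t → Iso n s t m m'
  | refl {w : Word κ} {s t : List κ} : Typed w s t → Iso 0 s t w w
  | symm {n : ℤ} {w w' : Word κ} {s t : List κ} : Iso n s t w w' → Iso (-n) s t w' w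
  | trans {n n' : ℤ} {w w' w'' : Word κ} {s t : List κ} :
      Iso n s t w w' → Iso n' s t w' w'' → Iso (n + n') s t w w''
  | append {n n' : ℤ} {v v' w w' : Word κ} {s r t : List κ} :
      Iso n s r v v' → Iso n' r t w w' → Iso (n + n') s t (v ++ w) (v' ++ w')

namespace Iso

variable {n n' : ℤ} {u v w w' w'' : Word κ} {s r t : List κ}

theorem typed (h : Iso n s t w w') : Typed w s t ∧ Typed w' s t := by
  induction h with
  | step g h => exact ⟨h, g.typed h⟩
  | refl h => exact ⟨h, h⟩
  | symm _ ih => exact ih.symm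
  | trans _ _ ih ih' => exact ⟨ih.1, ih'.2⟩
  | append _ _ ih ih' => exact ⟨ih.1.append ih'.1, ih.2.append ih'.2⟩

theorem symm₀ (h : Iso 0 s t w w') : Iso 0 s t w' w := by simpa using h.symm

theorem trans₀ (h : Iso 0 s t w w') (h' : Iso n s t w' w'') : Iso n s t w w'' := by
  simpa using h.trans h'

theorem trans' (h : Iso n s t w w') (h' : Iso 0 s t w' w'') : Iso n s t w w'' := by
  simpa using h.trans h'

theorem prepend (h : Iso n r t w w') (hu : Typed u s r) : Iso n s t (u ++ w) (u ++ w') := by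
  simpa using (refl hu).append h

theorem postpend (h : Iso n s r w w') (hv : Typed v r t) : Iso n s t (w ++ v) (w' ++ v) := by
  simpa using h.append (refl hv)

theorem whisker_right (h : Iso n s t w w') (r : List κ) : Iso n (s ++ r) (t ++ r) w w' := by
  induction h with
  | step g h => exact step g (h.whisker_right r)
  | refl h => exact refl (h.whisker_right r)
  | symm _ ih => exact ih.symm
  | trans _ _ ih ih' => exact ih.trans ih'
  | append _ _ ih ih' => exact ih.append ih'

theorem whisker_left (h : Iso n s t w w') (l : List κ) :
    Iso n (l ++ s) (l ++ t) (Word.shift l.length w) (Word.shift l.length w') := by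
  induction h with
  | step g h => exact step (g.shift _) (h.whisker_left l)
  | refl h => exact refl (h.whisker_left l)
  | symm _ ih => exact ih.symm
  | trans _ _ ih ih' => exact ih.trans ih'
  | append _ _ ih ih' => simpa using ih.append ih'

/-- A generating move inside of a word. -/
theorem move (u v : Word κ) {m m' : Word κ} (g : Gen n m m') (h : Typed (u ++ m ++ v) s t) :
    Iso n s t (u ++ m ++ v) (u ++ m' ++ v) := by
  obtain ⟨r, h1, h2⟩ := typed_append.1 h
  obtain ⟨r', h3, h4⟩ := typed_append.1 h1
  exact ((step g h4).prepend h3).postpend h2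

/-- Two letters side by side can be exchanged. -/
theorem interchange_letter {x y : Letter κ} {s s' r r' : List κ} (hx : x.Acts s s') (hy : y.Acts r r') :
    Iso 0 (s ++ r) (s' ++ r') [x, y.shift s'.length] [y.shift s.length, x] := by
  have h := hx.length
  obtain ⟨k, hk⟩ := Nat.exists_eq_add_of_le h.1
  have g := Gen.exchange x (y.shift (x.pos + k)) (by simp [Letter.pos_shift]; omega)
  rw [Letter.shift_shift, Letter.shift_shift, show x.pos + k + x.out = s'.length by omega,
    show x.pos + k + x.inp = s.length by omega] at g
  exact step g (Typed.cons (hx.whisker_right r) (Typed.cons (hy.whisker_left s') (Typed.nil _)))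

theorem interchange_letter_word {x : Letter κ} {w : Word κ} {s s' r r' : List κ} (hx : x.Acts s s') (hw : Typed w r r') :
    Iso 0 (s ++ r) (s' ++ r') ([x] ++ Word.shift s'.length w) (Word.shift s.length w ++ [x]) := by
  induction hw with
  | nil r => exact refl (typed_singleton.2 (hx.whisker_right r))
  | @cons y w r r' r'' hy hw ih =>
    have h1 := (interchange_letter hx hy).postpend (hw.whisker_left s')
    have h2 := ih.prepend (typed_singleton.2 (hy.whisker_left s))
    exact h1.trans₀ h2

/-- Two words side by side can be exchanged. -/
theorem interchange {v w : Word κ} {s s' r r' : List κ} (hv : Typed v s s') (hw : Typed w r r') :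
    Iso 0 (s ++ r) (s' ++ r') (v ++ Word.shift s'.length w) (Word.shift s.length w ++ v) := by
  induction hv with
  | nil s => simpa using refl (hw.whisker_left s)
  | @cons x v s s' s'' hx hv ih =>
    have h1 := ih.prepend (typed_singleton.2 (hx.whisker_right r))
    have h2 := (interchange_letter_word hx hw).postpend (hv.whisker_right r')
    refine h1.trans₀ (w' := [x] ++ Word.shift s'.length w ++ v) ?_
    simpa using h2

/-- Rotation of `Gen.cap_slide`: a zigzag is added to the right leg, the crossing passes through its
maximum, and the other minimum is then straightened. Hence no generator for minima is needed. -/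
theorem cup_slide (x c : κ) (b : Bool) :
    Iso 0 [x] [c, x, c] [cup 1 c, cross 0 b] [cup 0 c, cross 1 (!b)] := by
  have h1 : Iso 0 [x] [c, x, c] [cup 0 c, cross 1 (!b), cup 3 c, cap 2] [cup 0 c, cross 1 (!b)] :=
    move [cup 0 c, cross 1 (!b)] [] (Gen.zigzag_left 2 c) (by simp)
  have h2 : Iso 0 [x] [c, x, c] [cup 0 c, cross 1 (!b), cup 3 c, cap 2] [cup 0 c, cup 3 c, cross 1 (!b), cap 2] :=
    move [cup 0 c] [cap 2] (Gen.exchange (cross 1 (!b)) (cup 1 c) le_rfl)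
      (by simp [Letter.shift, Letter.out])
  have h3 : Iso 0 [x] [c, x, c] [cup 0 c, cup 3 c, cross 1 (!b), cap 2] [cup 0 c, cup 3 c, cross 2 b, cap 1] := by
    have := move (s := [x]) (t := [c, x, c]) [cup 0 c, cup 3 c] [] (Gen.cap_slide 1 (!b)) (by simp)
    simpa using this
  have h4 : Iso 0 [x] [c, x, c] [cup 0 c, cup 3 c, cross 2 b, cap 1] [cup 1 c, cup 0 c, cross 2 b, cap 1] :=
    move [] [cross 2 b, cap 1] (Gen.exchange (cup 0 c) (cup 1 c) zero_le_one)
      (by simp [Letter.shift, Letter.out])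
  have h5 : Iso 0 [x] [c, x, c] [cup 1 c, cup 0 c, cross 2 b, cap 1] [cup 1 c, cross 0 b, cup 0 c, cap 1] :=
    move [cup 1 c] [cap 1] (Gen.exchange (cup 0 c) (cross 0 b) le_rfl)
      (by simp [Letter.shift, Letter.out])
  have h6 : Iso 0 [x] [c, x, c] [cup 1 c, cross 0 b, cup 0 c, cap 1] [cup 1 c, cross 0 b] :=
    move [cup 1 c, cross 0 b] [] (Gen.zigzag_right 0 c) (by simp)
  exact (h1.symm₀.trans₀ (h2.trans₀ (h3.trans₀ (h4.trans₀ (h5.trans₀ h6))))).symm₀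

theorem cap_slide (x c : κ) (b : Bool) :
    Iso 0 [c, x, c] [x] [cross 0 b, cap 1] [cross 1 (!b), cap 0] :=
  step (Gen.cap_slide 0 b) (by simp)

theorem zigzag_left (c : κ) : Iso 0 [c] [c] [cup 1 c, cap 0] [] :=
  step (Gen.zigzag_left 0 c) (by simp)

theorem zigzag_right (c : κ) : Iso 0 [c] [c] [cup 0 c, cap 1] [] :=
  step (Gen.zigzag_right 0 c) (by simp)

theorem cancel (c d : κ) (b : Bool) : Iso 0 [c, d] [c, d] [cross 0 b, cross 0 (!b)] [] :=
  step (Gen.two 0 b) (by simp)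

/-- The exponent of `a` which a kink with the given crossing contributes. -/
def sgn (b : Bool) : ℤ := if b then 1 else -1

theorem curl_right (c : κ) (b : Bool) :
    Iso (sgn b) [c] [c] [cup 1 c, cross 0 b, cap 1] [] :=
  step (Gen.curl 0 c b) (by simp)

/-- A curl on the right leg of a minimum, its maximum slid through the crossing, becomes a crossing
directly on a minimum followed by a zigzag. The slide reverses the Boolean of the crossing. -/
theorem kink_cup (c : κ) (b : Bool) :
    Iso (sgn b) [] [c, c] [cup 0 c, cross 0 (!b)] [cup 0 c] := by
  have h0 : Iso (sgn b) [] [c, c] [cup 0 c, cup 2 c, cross 1 b, cap 2] [cup 0 c] :=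
    move [cup 0 c] [] (Gen.curl 1 c b) (by simp)
  have h1 : Iso 0 [] [c, c] [cup 0 c, cup 2 c, cross 1 b, cap 2] [cup 0 c, cup 2 c, cross 2 (!b), cap 1] :=
    move [cup 0 c, cup 2 c] [] (Gen.cap_slide 1 b) (by simp)
  have h2 : Iso 0 [] [c, c] [cup 0 c, cup 2 c, cross 2 (!b), cap 1] [cup 0 c, cross 0 (!b), cup 0 c, cap 1] :=
    (interchange (v := [cup 0 c]) (w := [cup 0 c, cross 0 (!b)]) (s := []) (r := [])
      (s' := [c, c]) (r' := [c, c]) (by simp) (by simp)).postpend (v := [cap 1]) (by simp)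
  have h3 : Iso 0 [] [c, c] [cup 0 c, cross 0 (!b), cup 0 c, cap 1] [cup 0 c, cross 0 (!b)] :=
    move [cup 0 c, cross 0 (!b)] [] (Gen.zigzag_right 0 c) (by simp)
  exact (h1.trans₀ (h2.trans₀ h3)).symm₀.trans₀ h0

theorem kink_cap (c : κ) (b : Bool) :
    Iso (sgn b) [c, c] [] [cross 0 (!b), cap 0] [cap 0] := by
  have h0 : Iso (sgn b) [c, c] [] [cup 2 c, cross 1 b, cap 2, cap 0] [cap 0] :=
    move [] [cap 0] (Gen.curl 1 c b) (by simp)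
  have h1 : Iso 0 [c, c] [] [cup 2 c, cross 1 b, cap 2, cap 0] [cup 1 c, cross 2 (!b), cap 2, cap 0] :=
    ((cup_slide c c b).whisker_left [c]).postpend (v := [cap 2, cap 0]) (by simp)
  have h2 : Iso 0 [c, c] [] [cup 1 c, cap 0, cross 0 (!b), cap 0] [cup 1 c, cross 2 (!b), cap 2, cap 0] :=
    (interchange (v := [cap 0]) (w := [cross 0 (!b), cap 0]) (s := [c, c]) (r := [c, c])
      (s' := []) (r' := []) (by simp) (by simp)).prepend (u := [cup 1 c]) (by simp)
  have h3 : Iso 0 [c, c] [] [cup 1 c, cap 0, cross 0 (!b), cap 0] [cross 0 (!b), cap 0] :=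
    move [] [cross 0 (!b), cap 0] (Gen.zigzag_left 0 c) (by simp)
  exact (h3.symm₀.trans₀ (h2.trans₀ h1.symm₀)).trans₀ h0

/-- `cup_slide` turns the left curl into a kinked maximum inside a zigzag, which `kink_cap`
evaluates. So only right curls have to be generators. -/
theorem curl_left (c : κ) (b : Bool) :
    Iso (sgn b) [c] [c] [cup 0 c, cross 1 b, cap 0] [] := by
  have h1 : Iso 0 [c] [c] [cup 1 c, cross 0 (!b), cap 0] [cup 0 c, cross 1 b, cap 0] := by
    have := (cup_slide c c (!b)).postpend (v := [cap 0]) (t := [c]) (by simp)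
    simpa using this
  have h2 : Iso (sgn b) [c] [c] [cup 1 c, cross 0 (!b), cap 0] [cup 1 c, cap 0] :=
    ((kink_cap c b).whisker_right [c]).prepend (u := [cup 1 c]) (by simp)
  exact h1.symm₀.trans₀ (h2.trans' (zigzag_left c))

/-- Reidemeister III for arbitrary crossings. -/
theorem braid (c d e : κ) (b₁ b₂ b₃ : Bool) (hb : b₂ = b₁ ∨ b₂ = b₃) : Iso 0 [c, d, e] [e, d, c]
    [cross 0 b₁, cross 1 b₂, cross 0 b₃] [cross 1 b₃, cross 0 b₂, cross 1 b₁] := by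
  have red {c d e : κ} {w w' : Word κ} (u v : Word κ) {m m' : Word κ} (g : Gen 0 m m') (hw : u ++ m ++ v = w)
      (hw' : u ++ m' ++ v = w') (h : Typed w [c, d, e] [e, d, c]) :
      Iso 0 [c, d, e] [e, d, c] w w' := by
    subst hw hw'
    exact move u v g h
  let A (b : Bool) : Letter κ := cross 0 b
  let B (b : Bool) : Letter κ := cross 1 b
  have ttt (c d e : κ) : Iso 0 [c, d, e] [e, d, c] [A true, B true, A true] [B true, A true, B true] :=
    red [] [] (Gen.three 0) rfl rfl (by simp [A, B])
  -- Only the version with three `true` crossings is a generator. Every other admissible pattern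
  -- follows from an earlier one by inserting a cancelling pair at one end and removing one at the
  -- other.
  have ttf (c d e : κ) : Iso 0 [c, d, e] [e, d, c] [A true, B true, A false] [B false, A true, B true] := by
    have h1 := red (c := c) (d := d) (e := e) (w := [B false, B true, A true, B true, A false]) [] _ (Gen.two 1 false) rfl rfl (by simp [A, B])
    have h2 := red (c := c) (d := d) (e := e) (w := [B false, A true, B true, A true, A false]) [B false] [A false] (Gen.three 0) rfl rfl (by simp [A, B])
    have h3 := red (c := c) (d := d) (e := e) (w := [B false, A true, B true, A true, A false]) [B false, A true, B true] [] (Gen.two 0 true) rfl rfl (by simp [A, B])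
    exact h1.symm₀.trans₀ (h2.symm₀.trans₀ h3)
  have ftt (c d e : κ) : Iso 0 [c, d, e] [e, d, c] [A false, B true, A true] [B true, A true, B false] := by
    have h1 := red (c := c) (d := d) (e := e) (w := [A false, B true, A true, B true, B false]) [A false, B true, A true] [] (Gen.two 1 true) rfl rfl (by simp [A, B])
    have h2 := red (c := c) (d := d) (e := e) (w := [A false, A true, B true, A true, B false]) [A false] [B false] (Gen.three 0) rfl rfl (by simp [A, B])
    have h3 := red (c := c) (d := d) (e := e) (w := [A false, A true, B true, A true, B false]) [] [B true, A true, B false] (Gen.two 0 false) rfl rfl (by simp [A, B])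
    exact h1.symm₀.trans₀ (h2.symm₀.trans₀ h3)
  have fft (c d e : κ) : Iso 0 [c, d, e] [e, d, c] [A false, B false, A true] [B true, A false, B false] := by
    have h1 := red (c := c) (d := d) (e := e) (w := [A false, B false, A true, B true, B false]) [A false, B false, A true] [] (Gen.two 1 true) rfl rfl (by simp [A, B])
    have h2 := ((ttf d c e).prepend (u := [A false]) (s := [c, d, e]) (by simp [A])).postpend (v := [B false]) (t := [e, d, c]) (by simp [B])
    have h3 := red (c := c) (d := d) (e := e) (w := [A false, A true, B true, A false, B false]) [] [B true, A false, B false] (Gen.two 0 false) rfl rfl (by simp [A, B])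
    exact h1.symm₀.trans₀ (h2.symm₀.trans₀ h3)
  have tff (c d e : κ) : Iso 0 [c, d, e] [e, d, c] [A true, B false, A false] [B false, A false, B true] := by
    have h1 := red (c := c) (d := d) (e := e) (w := [B false, B true, A true, B false, A false]) [] [A true, B false, A false] (Gen.two 1 false) rfl rfl (by simp [A, B])
    have h2 := ((ftt c e d).prepend (u := [B false]) (s := [c, d, e]) (by simp [B])).postpend (v := [A false]) (t := [e, d, c]) (by simp [A])
    have h3 := red (c := c) (d := d) (e := e) (w := [B false, A false, B true, A true, A false]) [B false, A false, B true] [] (Gen.two 0 true) rfl rfl (by simp [A, B])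
    exact h1.symm₀.trans₀ (h2.symm₀.trans₀ h3)
  have fff (c d e : κ) : Iso 0 [c, d, e] [e, d, c] [A false, B false, A false] [B false, A false, B false] := by
    have h1 := red (c := c) (d := d) (e := e) (w := [B false, A false, B false, A true, A false]) [B false, A false, B false] [] (Gen.two 0 true) rfl rfl (by simp [A, B])
    have h2 := ((fft c e d).prepend (u := [B false]) (s := [c, d, e]) (by simp [B])).postpend (v := [A false]) (t := [e, d, c]) (by simp [A])
    have h3 := red (c := c) (d := d) (e := e) (w := [B false, B true, A false, B false, A false]) [] [A false, B false, A false] (Gen.two 1 false) rfl rfl (by simp [A, B])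
    exact h3.symm₀.trans₀ (h2.symm₀.trans₀ h1)
  cases b₁ <;> cases b₂ <;> cases b₃ <;> simp at hb <;>
    first | exact ttt c d e | exact ttf c d e | exact ftt c d e | exact fft c d e | exact tff c d e | exact fff c d e

end Iso

/-- A strand at place `j` passes to the right over `k` strands. -/
def overpass : ℕ → ℕ → Word κ
  | _, 0 => []
  | j, k + 1 => cross j true :: overpass (j + 1) k

theorem shift_overpass (i j k : ℕ) : Word.shift i (overpass j k : Word κ) = overpass (j + i) k := by
  induction k generalizing j with
  | zero => rfl
  | succ k ih => simp [overpass, Letter.shift, ih, add_right_comm]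

theorem overpass_add (j k l : ℕ) : (overpass j (k + l) : Word κ) = overpass j k ++ overpass (j + k) l := by
  induction k generalizing j with
  | zero => simp [overpass]
  | succ k ih => simp [overpass, add_right_comm k 1 l, ih, add_assoc, add_comm 1]

theorem typed_overpass (c : κ) (r : List κ) : Typed (overpass 0 r.length) (c :: r) (r ++ [c]) := by
  induction r with
  | nil => simp [overpass]
  | cons d r ih =>
    refine Typed.cons (t := d :: c :: r) (by simp) ?_
    simpa [shift_overpass] using ih.whisker_left [d]

/-- A strand at place `k` passes to the left over `k` strands. -/
def overLeft : ℕ → Word κ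
  | 0 => []
  | k + 1 => Word.shift 1 (overLeft k) ++ [cross 0 false]

theorem typed_overLeft (c : κ) (r : List κ) : Typed (overLeft r.length) (r ++ [c]) (c :: r) := by
  induction r with
  | nil => simp [overLeft]
  | cons d r ih => exact (ih.whisker_left [d]).append (by simp)

namespace Iso

/-- The part of the overpass that runs over the additional strands `q` lies beside the letter and
commutes with it. -/
theorem over_letter_whisker_right {x : Letter κ} {m m' : List κ} {c : κ} (hx : x.Acts m m')
    (h : Iso 0 (c :: m) (m' ++ [c]) (overpass 0 m.length ++ [x]) (x.shift 1 :: overpass 0 m'.length))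
    (q : List κ) : Iso 0 (c :: (m ++ q)) (m' ++ q ++ [c]) (overpass 0 (m ++ q).length ++ [x])
      (x.shift 1 :: overpass 0 (m' ++ q).length) := by
  have h1 := (interchange (typed_singleton.2 hx) (typed_overpass c q)).prepend
    (by simpa using (typed_overpass c m).whisker_right q)
  have h2 := (h.whisker_right q).postpend (v := Word.shift m'.length (overpass 0 q.length))
    (by simpa using (typed_overpass c q).whisker_left m')
  simp only [shift_overpass, zero_add, ← List.append_assoc] at h1 h2
  simp only [List.length_append, overpass_add, zero_add]
  simpa using h1.symm₀.trans₀ h2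

theorem over_letter_whisker_left {x : Letter κ} {m m' : List κ} {c : κ} (hx : x.Acts m m')
    (h : Iso 0 (c :: m) (m' ++ [c]) (overpass 0 m.length ++ [x]) (x.shift 1 :: overpass 0 m'.length))
    (l : List κ) : Iso 0 (c :: (l ++ m)) (l ++ m' ++ [c])
      (overpass 0 (l ++ m).length ++ [x.shift l.length])
      ((x.shift l.length).shift 1 :: overpass 0 (l ++ m').length) := by
  have h1 := (h.whisker_left l).prepend (by simpa using (typed_overpass c l).whisker_right m)
  have h2 := (interchange (typed_overpass c l) (typed_singleton.2 hx)).postpend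
    (v := overpass l.length m'.length) (t := l ++ m' ++ [c])
    (by simpa [shift_overpass] using (typed_overpass c m').whisker_left l)
  simp only [shift_overpass, zero_add, Word.shift_append, Word.shift_cons, Word.shift_nil, Letter.shift_shift, List.length_append, List.length_cons, List.length_nil, ← List.append_assoc] at h1 h2
  simp only [List.length_append, overpass_add, zero_add, Letter.shift_shift]
  simp [add_comm] at h1 h2 ⊢
  exact h1.trans₀ h2

/-- A strand can be pushed over a letter. -/
theorem over_letter (c : κ) {x : Letter κ} {r r' : List κ} (h : x.Acts r r') :
    Iso 0 (c :: r) (r' ++ [c]) (overpass 0 r.length ++ [x]) (x.shift 1 :: overpass 0 r'.length) := by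
  have wh {x : Letter κ} {m m' : List κ} (hx : x.Acts m m')
    (h : Iso 0 (c :: m) (m' ++ [c]) (overpass 0 m.length ++ [x]) (x.shift 1 :: overpass 0 m'.length))
    (l q : List κ) := over_letter_whisker_right (hx.whisker_left l)
      (over_letter_whisker_left hx h l) q
  cases h with
  | cup l q d =>
    have core : Iso 0 [c] [d, d, c] [cup 0 d] [cup 1 d, cross 0 true, cross 1 true] := by
      have h1 := (cup_slide c d true).postpend (v := [cross 1 true]) (t := [d, d, c]) (by simp)
      have h2 : Iso 0 [c] [d, d, c] [cup 0 d, cross 1 false, cross 1 true] [cup 0 d] :=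
        move [cup 0 d] [] (Gen.two 1 false) (by simp)
      exact (h1.trans₀ h2).symm₀
    simpa [Letter.shift] using wh (x := Letter.cup 0 d) (m := []) (m' := [d, d]) (by simp) core l q
  | cap l q d =>
    have core : Iso 0 [c, d, d] [c] [cross 0 true, cross 1 true, cap 0] [cap 1] := by
      have h1 := (cap_slide c d false).prepend (u := [cross 0 true]) (s := [c, d, d]) (by simp)
      have h2 : Iso 0 [c, d, d] [c] [cross 0 true, cross 0 false, cap 1] [cap 1] :=
        move [] [cap 1] (Gen.two 0 true) (by simp)
      exact h1.symm₀.trans₀ h2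
    simpa [Letter.shift] using wh (x := Letter.cap 0) (m := [d, d]) (m' := []) (by simp) core l q
  | cross l q d e b =>
    simpa [Letter.shift] using wh (x := Letter.cross 0 b) (m := [d, e]) (m' := [e, d]) (by simp)
      (braid c d e true true b (Or.inl rfl)) l q

/-- A strand can be pushed over a word. -/
theorem over_word (c : κ) {w : Word κ} {r r' : List κ} (h : Typed w r r') :
    Iso 0 (c :: r) (r' ++ [c]) (overpass 0 r.length ++ w) (Word.shift 1 w ++ overpass 0 r'.length) := by
  induction h with
  | nil r => simpa using refl (typed_overpass c r)
  | @cons x w r r' r'' hx hw ih =>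
    have h1 := (over_letter c hx).postpend (hw.whisker_right [c])
    have h2 := ih.prepend (typed_singleton.2 (hx.whisker_left [c]))
    simpa using h1.trans₀ h2

/-- The maximum at the right end of an overpass is pulled back to the left end, so that its other
leg becomes the one that passes over `r`. Each strand of `r` costs one `cap_slide`. -/
theorem over_cap (c : κ) (r : List κ) : Iso 0 (c :: (r ++ [c])) r (overpass 0 r.length ++ [cap r.length])
    (Word.shift 1 (overLeft r.length) ++ [cap 0]) := by
  induction r with
  | nil => exact refl (by simp [overpass])
  | cons d r ih =>
    have h1 := (ih.whisker_left [d]).prepend (u := [cross 0 true]) (s := c :: d :: (r ++ [c])) (by simp)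
    have h2 := (interchange (v := [cross 0 true]) (s := [c, d]) (s' := [d, c]) (by simp) (typed_overLeft c r)).postpend
      (v := [cap 1]) (t := d :: r) (by simp)
    have h3 := ((cap_slide d c true).whisker_right r).prepend ((typed_overLeft c r).whisker_left [c, d])
    simp only [shift_overpass, Word.shift_append, Word.shift_shift] at h1 h2 h3
    simp [Letter.shift] at h1 h2 h3
    have := h1.trans₀ (h2.trans₀ h3)
    simpa [overpass, overLeft, Letter.shift, Word.shift_shift] using this

/-- A minimum whose right leg passes over some strands and is then joined to the next strand. -/
theorem arc_cap (c : κ) (r : List κ) : Iso 0 (r ++ [c]) (c :: r)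
    (cup 0 c :: (overpass 1 r.length ++ [cap (r.length + 1)])) (overLeft r.length) := by
  have h1 := ((over_cap c r).whisker_left [c]).prepend (u := [cup 0 c]) (s := r ++ [c]) (by simp)
  have h2 := (interchange (v := [cup 0 c]) (s := []) (s' := [c, c]) (by simp) (typed_overLeft c r)).postpend
    (v := [cap 1]) (t := c :: r) (by simp)
  have h3 := ((zigzag_right c).whisker_right r).prepend (typed_overLeft c r)
  simp only [shift_overpass, Word.shift_append, Word.shift_shift] at h1 h2 h3
  simp [Letter.shift, Word.shift_zero] at h1 h2 h3
  exact h1.trans₀ (h2.trans₀ h3)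

end Iso

end Tangles

end TiedLink

namespace TiedLink

open Letter Word

/-! ### Layered words and the skein rules -/

section Skein

variable {κ : Type}

/-- A standard arc: a minimum whose left leg is the new leftmost strand and whose right leg passes
over `k` strands. -/
def arc (c : κ) (k : ℕ) : Word κ := cup 0 c :: overpass 1 k

theorem arc_succ (c : κ) (k : ℕ) : arc c (k + 1) = arc c k ++ [cross (k + 1) true] := by
  rw [arc, overpass_add 1 k 1, add_comm 1 k]
  rfl

theorem typed_arc (c : κ) (r : List κ) : Typed (arc c r.length) r (c :: (r ++ [c])) := by
  refine Typed.cons (t := c :: c :: r) (by simp) ?_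
  simpa [shift_overpass] using (typed_overpass c r).whisker_left [c]

theorem recolor_overpass {κ' : Type} (f : κ → κ') (j k : ℕ) : Word.recolor f (overpass j k) = overpass j k := by
  induction k generalizing j with
  | zero => rfl
  | succ k ih => simp [overpass, ih, Letter.recolor]

theorem recolor_arc {κ' : Type} (f : κ → κ') (c : κ) (k : ℕ) : Word.recolor f (arc c k) = arc (f c) k := by
  simp [arc, recolor_overpass, Letter.recolor]

/-- Layered words, in which each arc lies over all the previous ones. -/
inductive Std : Word κ → List κ → Prop
  | nil : Std [] []
  | arc {w : Word κ} (c : κ) (r r' : List κ) :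
      Std w (r ++ r') → Std (w ++ arc c r.length) (c :: (r ++ c :: r'))

theorem Std.typed {w : Word κ} {s : List κ} (h : Std w s) : Typed w [] s := by
  induction h with
  | nil => exact Typed.nil _
  | arc c r r' _ ih => exact ih.append (by simpa using (typed_arc c r).whisker_right r')

theorem Std.recolor {κ' : Type} (f : κ → κ') {w : Word κ} {s : List κ} (h : Std w s) :
    Std (Word.recolor f w) (s.map f) := by
  induction h with
  | nil => exact Std.nil
  | arc c r r' _ ih =>
    have := Std.arc (f c) (r.map f) (r'.map f) (by simpa using ih)
    simpa [recolor_arc] using this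

namespace Iso

/-- The right leg of the arc lies on top, so it can be pushed over the letter; the left leg is then
merely to the left of it. -/
theorem arc_letter_left (c : κ) {x : Letter κ} {r r' : List κ} (q : List κ) (h : x.Acts r r') :
    Iso 0 (r ++ q) (c :: (r' ++ c :: q)) (arc c r.length ++ [x.shift 1]) ([x] ++ arc c r'.length) := by
  have h1 := ((over_letter c h).whisker_left [c]).prepend (u := [cup 0 c]) (s := r) (by simp)
  have h2 := (interchange (v := [cup 0 c]) (s := []) (s' := [c, c]) (by simp) (typed_singleton.2 h)).postpend
    (v := overpass 1 r'.length) (t := c :: (r' ++ [c]))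
    (by simpa [shift_overpass] using (typed_overpass c r').whisker_left [c])
  simp [shift_overpass, Letter.shift_shift, Letter.shift_zero] at h1 h2
  simpa [arc] using (h1.trans₀ h2).whisker_right q

theorem arc_letter_right (c : κ) {x : Letter κ} {r r' : List κ} (p : List κ) (h : x.Acts r r') :
    Iso 0 (p ++ r) (c :: (p ++ c :: r')) (arc c p.length ++ [x.shift (p.length + 2)])
      ([x.shift p.length] ++ arc c p.length) := by
  simpa using interchange (typed_arc c p) (typed_singleton.2 h)

/-- The left leg is joined to the first strand beneath the arc. The arc crosses this strand just
before, which creates a left curl; without it a strand running over `r` remains. -/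
theorem arc_cap_zero (c : κ) (r q : List κ) : Iso (sgn true) (c :: (r ++ q)) (r ++ c :: q)
    (arc c (r.length + 1) ++ [cap 0]) (overpass 0 r.length) := by
  have h1 := (interchange (v := [cap 0]) (s := [c, c]) (s' := []) (by simp) (typed_overpass c r)).prepend
    (u := [cup 0 c, cross 1 true]) (s := c :: r) (by simp)
  have h2 := ((curl_left c true).whisker_right r).postpend (typed_overpass c r)
  simp [shift_overpass] at h1 h2
  simpa [arc, overpass] using (h1.symm₀.trans₀ h2).whisker_right q

theorem arc_cap_next (c : κ) (r q : List κ) : Iso 0 (r ++ c :: q) (c :: (r ++ q))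
    (arc c r.length ++ [cap (r.length + 1)]) (overLeft r.length) := by
  simpa [arc] using (arc_cap c r).whisker_right q

/-- The right leg is joined to the strand it has just crossed. The last crossing of the arc is a
kink at this maximum, and removing it leads back to `arc_cap_next`. -/
theorem arc_cap_last (c : κ) (r q : List κ) : Iso (sgn false) (r ++ c :: q) (c :: (r ++ q))
    (arc c (r.length + 1) ++ [cap (r.length + 1)]) (overLeft r.length) := by
  have h1 := (((kink_cap c false).whisker_left (c :: r)).prepend (typed_arc c r |>.whisker_right [c] |> (by simpa using ·))).whisker_right q
  have h2 := h1.trans' (by simpa [Letter.shift] using arc_cap_next c r q)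
  rw [arc_succ]
  simpa [Letter.shift, add_comm 1] using h2

theorem arc_cross_last (c d : κ) (r q : List κ) : Iso 0 (r ++ d :: q) (c :: (r ++ c :: d :: q))
    (arc c (r.length + 1) ++ [cross (r.length + 1) false]) (arc c r.length) := by
  have h1 := (((cancel c d true).whisker_left (c :: r)).prepend (typed_arc c r |>.whisker_right [d] |> (by simpa using ·))).whisker_right q
  rw [arc_succ]
  simpa [Letter.shift, add_comm 1] using h1

/-- With this sign the whole arc is above the strand `d`, so its minimum slides off to the right of
`d`. -/
theorem arc_cross_zero (c d : κ) (r q : List κ) : Iso 0 (d :: (r ++ q)) (d :: c :: (r ++ c :: q))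
    (arc c (r.length + 1) ++ [cross 0 true]) (cup 1 c :: overpass 2 r.length) := by
  have h1 := (interchange (v := [cross 0 true]) (s := [c, d]) (s' := [d, c]) (by simp) (typed_overpass c r)).prepend
    (u := [cup 0 c, cross 1 true]) (s := d :: r) (by simp)
  have h2 : Iso 0 [d] [d, c, c] [cup 0 c, cross 1 true, cross 0 true] [cup 1 c] := by
    have h3 := (cup_slide d c false).postpend (v := [cross 0 true]) (t := [d, c, c]) (by simp)
    exact h3.symm₀.trans₀ (move [cup 1 c] [] (Gen.two 0 false) (by simp))
  have h4 := (h2.whisker_right r).postpend ((typed_overpass c r).whisker_left [d, c])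
  simp [shift_overpass] at h1 h4
  simpa [arc, overpass] using (h1.symm₀.trans₀ h4).whisker_right q

/-- A circle can be moved to the right. -/
theorem circle_right (c : κ) (l : List κ) :
    Iso 0 l l [cup 0 c, cap 0] [cup l.length c, cap l.length] := by
  induction l with
  | nil => exact refl (by simp)
  | cons d l ih =>
    have h1 := (over_word d (w := [cup 0 c, cap 0]) (r := []) (r' := []) (by simp)).whisker_right l
    have h2 := ih.whisker_left [d]
    simp [overpass, Letter.shift] at h1 h2 ⊢
    exact h1.trans₀ h2

end Iso

/-- The map of colours which unites the classes `c` and `d`. -/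
def mergeColor [DecidableEq κ] (c d : κ) : κ → κ := fun k => if k = d then c else k

@[simp] theorem recolor_id (w : Word κ) : Word.recolor id w = w := by
  have : (Letter.recolor id : Letter κ → Letter κ) = id := by
    funext x
    cases x <;> rfl
  simp [Word.recolor, this]

theorem mergeColor_self [DecidableEq κ] (c : κ) : mergeColor c c = id := by
  funext k
  simp only [mergeColor, id]
  split_ifs with h <;> simp [h]

variable [DecidableEq κ] {B A : Type} [CommRing B] [AddCommGroup A] [Module B A]

/-- The skein rules, for a function of words with values in a module; the value of the unknot
is `e`. -/
structure Rules (a z : Bˣ) (y : B) (e : A) (L : Word κ → A) : Prop where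
  gen : ∀ {n : ℤ} {m m' : Word κ} (u v : Word κ), Gen n m m' → u ++ m' ++ v ≠ [] →
    Typed (u ++ m ++ v) [] [] → L (u ++ m ++ v) = (a ^ n) • L (u ++ m' ++ v)
  circle : ∀ (u v : Word κ) (i : ℕ) (c : κ), ¬ Uses (u ++ v) c → u ++ v ≠ [] →
    Typed (u ++ v) [] [] → Typed (u ++ [cup i c, cap i] ++ v) [] [] →
    L (u ++ [cup i c, cap i] ++ v) = y • L (u ++ v)
  skein : ∀ (u v : Word κ) (l r : List κ) (c d : κ),
    Typed u [] (l ++ c :: d :: r) → Typed v (l ++ d :: c :: r) [] →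
    L (u ++ [cross l.length true] ++ v) + L (u ++ [cross l.length false] ++ v) =
      z • (L (Word.recolor (mergeColor c d) (u ++ v)) +
        L (Word.recolor (mergeColor c d) (u ++ [cap l.length, cup l.length c] ++ v)))
  unknot : ∀ c : κ, L [cup 0 c, cap 0] = e

namespace Rules

variable {a z : Bˣ} {y : B} {e : A} {L : Word κ → A} (hL : Rules a z y e L)

include hL in
-- The condition is put on `u ++ v` because a chain of moves may pass through the empty word in the
-- middle, and the empty diagram is not allowed.
theorem iso {n : ℤ} {s t : List κ} {w w' : Word κ} (h : Iso n s t w w') {u v : Word κ}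
    (hu : Typed u [] s) (hv : Typed v t []) (h0 : u ++ v ≠ []) :
    L (u ++ w ++ v) = (a ^ n) • L (u ++ w' ++ v) := by
  induction h generalizing u v with
  | step g h => exact hL.gen u v g (by simp at h0 ⊢; tauto) ((hu.append h).append hv)
  | refl h => simp
  | symm _ ih => rw [ih hu hv h0, smul_smul, ← zpow_add]; simp
  | trans _ _ ih ih' => rw [ih hu hv h0, ih' hu hv h0, smul_smul, ← zpow_add]
  | @append n n' p p' w w' s r t h h' ih ih' =>
    have h1 := ih hu (h'.typed.1.append hv) (by simp at h0 ⊢; tauto)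
    have h2 := ih' (hu.append h.typed.2) hv (by simp at h0 ⊢; tauto)
    simp only [List.append_assoc] at h1 h2 ⊢
    rw [h1, h2, smul_smul, ← zpow_add]

include hL in
theorem iso₀ {s t : List κ} {w w' : Word κ} (h : Iso 0 s t w w') {u v : Word κ}
    (hu : Typed u [] s) (hv : Typed v t []) (h0 : u ++ v ≠ []) :
    L (u ++ w ++ v) = L (u ++ w' ++ v) := by
  simpa using hL.iso h hu hv h0

include hL in
/-- A circle next to a strand of the same colour. -/
theorem circle_next {u v : Word κ} {c : κ} {l r : List κ} (hu : Typed u [] (l ++ c :: r))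
    (hv : Typed v (l ++ c :: r) []) (hv0 : v ≠ []) :
    L (u ++ [cup (l.length + 1) c, cap (l.length + 1)] ++ v) =
      ((z⁻¹ : Bˣ) * ((a : B) + (a⁻¹ : Bˣ)) - 1 : B) • L (u ++ v) := by
  -- The skein relation at the crossing of a curl: its two signs give `a` and `a⁻¹`, and its
  -- smoothings are the circle beside the strand and a pair of zigzags.
  have h1 := hL.skein (u ++ [cup (l.length + 1) c]) ([cap (l.length + 1)] ++ v) l (c :: r) c c
    (hu.append (typed_singleton.2 (by simpa using Letter.Acts.cup (l ++ [c]) r c)))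
    ((typed_singleton.2 (by simpa using Letter.Acts.cap (l ++ [c]) r c)).append hv)
  have curl (b : Bool) := hL.iso (((Iso.curl_right c b).whisker_left l).whisker_right r)
    (by simpa using hu) (by simpa using hv) (by simp [hv0])
  have zig := hL.iso₀ ((((Iso.zigzag_left c).append (Iso.zigzag_right c)).whisker_left l).whisker_right r)
    (by simpa using hu) (by simpa using hv) (by simp [hv0])
  have c1 := curl true
  have c2 := curl false
  simp [Letter.shift, Iso.sgn, add_comm 1] at c1 c2 zig
  simp only [mergeColor_self] at h1
  simp only [recolor_id] at h1
  simp at h1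
  rw [c1, c2, zig] at h1
  have h2 := congrArg (fun x => z⁻¹ • x) h1
  simp only [smul_add, inv_smul_smul] at h2
  simp only [List.append_assoc, List.cons_append, List.nil_append]
  rw [sub_smul, one_smul, eq_sub_iff_add_eq, ← h2, mul_add, add_smul, mul_smul, mul_smul]
  rfl

include hL in
/-- A circle can be removed. -/
theorem exists_circle {u v : Word κ} {c : κ} {s : List κ} (hu : Typed u [] s)
    (hv : Typed v s []) (hv0 : v ≠ []) :
    ∃ β : B, L (u ++ [cup 0 c, cap 0] ++ v) = β • L (u ++ v) := by
  have hO {s : List κ} : Typed [cup 0 c, cap 0] s s := by simp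
  -- If the colour occurs elsewhere, the circle is tied to something and `hL.circle` does not apply.
  -- It is then carried to a minimum of its own colour and evaluated there by `circle_next`.
  by_cases hc : Uses (u ++ v) c
  · refine ⟨(z⁻¹ : Bˣ) * ((a : B) + (a⁻¹ : Bˣ)) - 1, ?_⟩
    obtain ⟨i, hi⟩ := hc
    obtain ⟨p, q, hpq⟩ := List.append_of_mem hi
    have huv := hu.append hv
    rw [hpq] at huv
    obtain ⟨s', hp, hq⟩ := typed_append.1 huv
    obtain ⟨s'', hc, hq⟩ := typed_cons.1 hq
    have com {u v : Word κ} {s : List κ} (hu : Typed u [] s) (hv : Typed v s []) (hv0 : v ≠ []) :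
        L (u ++ [cup 0 c, cap 0] ++ v) = L ([cup 0 c, cap 0] ++ (u ++ v)) := by
      have := hL.iso₀ (Iso.interchange (v := [cup 0 c, cap 0]) (s := []) (s' := []) (by simp) hu) (Typed.nil _) hv (by simp [hv0])
      simpa [Word.shift_zero] using this.symm
    cases hc with
    | cup l r =>
      have hq0 : q ≠ [] := by
        rintro rfl
        simp at hq
      have hp' : Typed (p ++ [cup l.length c]) [] (l ++ c :: c :: r) :=
        hp.append (typed_singleton.2 (Letter.Acts.cup l r c))
      rw [com hu hv hv0, hpq, show p ++ cup l.length c :: q = (p ++ [cup l.length c]) ++ q by simp, ← com hp' hq hq0]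
      have h1 := hL.iso₀ ((Iso.circle_right c (l ++ [c])).whisker_right (c :: r)) (by simpa using hp') (by simpa using hq) (by simp)
      rw [h1]
      simpa using hL.circle_next hp' hq hq0
  · refine ⟨y, hL.circle u v 0 c hc (by simp [hv0]) (hu.append hv) ((hu.append hO).append hv)⟩

end Rules

end Skein

end TiedLink

namespace TiedLink

open Letter Word

/-! ### Reduction of all diagrams to layered ones -/

section Span

variable {κ : Type}

/-- The possible places of a letter relative to a given strand. -/
theorem Letter.Acts.split {x : Letter κ} {p q t : List κ} {c : κ} (h : x.Acts (p ++ c :: q) t) :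
    (∃ p', t = p' ++ c :: q ∧ x.Acts p p') ∨
    (∃ (y : Letter κ) (q' : List κ), x = y.shift (p.length + 1) ∧ t = p ++ c :: q' ∧ y.Acts q q') ∨
    (∃ p', p = p' ++ [c] ∧ x = Letter.cap p'.length ∧ t = p' ++ q) ∨
    (∃ q', q = c :: q' ∧ x = Letter.cap p.length ∧ t = p ++ q') ∨
    (∃ p' d b, p = p' ++ [d] ∧ x = Letter.cross p'.length b ∧ t = p' ++ c :: d :: q) ∨
    (∃ q' d b, q = d :: q' ∧ x = Letter.cross p.length b ∧ t = p ++ d :: c :: q') := by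
  generalize hs : p ++ c :: q = s at h
  cases h with
  | cup l r d =>
    rcases List.append_eq_append_iff.1 hs with ⟨m, rfl, hm⟩ | ⟨m, rfl, rfl⟩
    · rcases m with _ | ⟨e, m⟩
      · simp at hm; subst hm
        refine Or.inl ⟨p ++ [d, d], by simp, by simpa using Acts.cup p [] d⟩
      · simp at hm; obtain ⟨rfl, rfl⟩ := hm
        exact Or.inr (Or.inl ⟨Letter.cup m.length d, m ++ d :: d :: r, by simp [Letter.shift]; omega, by simp,
          Acts.cup _ _ _⟩)
    · exact Or.inl ⟨l ++ d :: d :: m, by simp, Acts.cup _ _ _⟩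
  | cap l r d =>
    rcases List.append_eq_append_iff.1 hs with ⟨m, rfl, hm⟩ | ⟨m, rfl, hm⟩
    · rcases m with _ | ⟨e, m⟩
      · simp at hm; obtain ⟨rfl, rfl⟩ := hm
        exact Or.inr (Or.inr (Or.inr (Or.inl ⟨r, rfl, by simp, by simp⟩)))
      · simp at hm; obtain ⟨rfl, rfl⟩ := hm
        exact Or.inr (Or.inl ⟨Letter.cap m.length, m ++ r, by simp [Letter.shift]; omega, by simp,
          Acts.cap _ _ _⟩)
    · rcases m with _ | ⟨e, _ | ⟨e', m⟩⟩
      · simp at hm; obtain ⟨rfl, rfl⟩ := hm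
        exact Or.inr (Or.inr (Or.inr (Or.inl ⟨r, rfl, by simp, by simp⟩)))
      · simp at hm; obtain ⟨rfl, rfl, rfl⟩ := hm
        exact Or.inr (Or.inr (Or.inl ⟨l, rfl, rfl, rfl⟩))
      · simp at hm; obtain ⟨rfl, rfl, rfl⟩ := hm
        exact Or.inl ⟨l ++ m, by simp, Acts.cap _ _ _⟩
  | cross l r d e b =>
    rcases List.append_eq_append_iff.1 hs with ⟨m, rfl, hm⟩ | ⟨m, rfl, hm⟩
    · rcases m with _ | ⟨f, m⟩
      · simp at hm; obtain ⟨rfl, rfl⟩ := hm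
        exact Or.inr (Or.inr (Or.inr (Or.inr (Or.inr ⟨r, e, b, rfl, by simp, by simp⟩))))
      · simp at hm; obtain ⟨rfl, rfl⟩ := hm
        exact Or.inr (Or.inl ⟨Letter.cross m.length b, m ++ e :: d :: r, by simp [Letter.shift]; omega, by simp,
          Acts.cross _ _ _ _ _⟩)
    · rcases m with _ | ⟨f, _ | ⟨f', m⟩⟩
      · simp at hm; obtain ⟨rfl, rfl⟩ := hm
        exact Or.inr (Or.inr (Or.inr (Or.inr (Or.inr ⟨r, e, b, rfl, by simp, by simp⟩))))
      · simp at hm; obtain ⟨rfl, rfl, rfl⟩ := hm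
        exact Or.inr (Or.inr (Or.inr (Or.inr (Or.inl ⟨l, d, b, rfl, rfl, by simp⟩))))
      · simp at hm; obtain ⟨rfl, rfl, rfl⟩ := hm
        exact Or.inl ⟨l ++ e :: d :: m, by simp, Acts.cross _ _ _ _ _⟩

theorem recolor_recolor {κ' κ'' : Type} (f : κ → κ') (g : κ' → κ'') (w : Word κ) :
    Word.recolor g (Word.recolor f w) = Word.recolor (g ∘ f) w := by
  have : Letter.recolor g ∘ Letter.recolor f = Letter.recolor (g ∘ f) := by
    funext x
    cases x <;> rfl
  rw [Word.recolor, Word.recolor, List.map_map, this]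
  rfl

theorem recolor_ne_nil {κ' : Type} (f : κ → κ') {w : Word κ} (h : w ≠ []) : Word.recolor f w ≠ [] := by
  simpa [Word.recolor] using h

section

variable {B A : Type} [CommRing B] [AddCommGroup A] [Module B A]

variable (B) in
/-- The values on layered words, closed by `v`. -/
def stdSpan (L : Word κ → A) (t : List κ) (v : Word κ) : Submodule B A :=
  Submodule.span B {x | ∃ (h : κ → κ) (w : Word κ), Std w (t.map h) ∧ x = L (w ++ Word.recolor h v)}

variable (B) in
/-- A word whose values are combinations of values of layered words. -/
structure Reduces (L : Word κ → A) (s : List κ) (w : Word κ) : Prop where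
  typed : Typed w [] s
  mem : ∀ (t : List κ) (g : κ → κ) (v : Word κ), s = t.map g → Typed v t [] → v ≠ [] →
    L (w ++ Word.recolor g v) ∈ stdSpan B L t v

theorem Std.reduces (L : Word κ → A) {s : List κ} {w : Word κ} (h : Std w s) : Reduces B L s w where
  typed := h.typed
  mem _ g _ hs _ _ := Submodule.subset_span ⟨g, w, hs ▸ h, rfl⟩

/-- By linearity only layered words beneath `u` have to be considered. The recolouring `f` arises
because a smoothing merges two classes in the entire diagram, including the part above; `Reduces`
therefore quantifies over recoloured closures. -/
theorem Reduces.extend {L : Word κ → A} {s t : List κ} {w u : Word κ} (hw : Reduces B L s w)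
    (hu : Typed u s t)
    (h : ∀ (f : κ → κ) (w' : Word κ), Std w' (s.map f) → Reduces B L (t.map f) (w' ++ Word.recolor f u)) :
    Reduces B L t (w ++ u) where
  typed := hw.typed.append hu
  mem t' g v ht hv hv0 := by
    have h1 := hw.mem s id (u ++ Word.recolor g v) (by simp)
      (hu.append (by simpa [ht] using hv.recolor g)) (by simp [recolor_ne_nil g hv0])
    rw [recolor_id, ← List.append_assoc] at h1
    refine (Submodule.span_le.2 ?_) h1
    rintro _ ⟨f, w', hw', rfl⟩
    have := (h f w' hw').mem t' (f ∘ g) v (by simp [ht]) hv hv0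
    rw [recolor_append, ← List.append_assoc, recolor_recolor]
    exact this

theorem Reduces.arc {L : Word κ → A} {w : Word κ} (c : κ) {r r' : List κ} (hw : Reduces B L (r ++ r') w) :
    Reduces B L (c :: (r ++ c :: r')) (w ++ arc c r.length) := by
  refine hw.extend (by simpa using (typed_arc c r).whisker_right r') fun f w' hw' => ?_
  have := (Std.arc (f c) (r.map f) (r'.map f) (by simpa using hw')).reduces (B := B) L
  simpa [recolor_arc] using this

variable (B) in
/-- Putting the letter on top of `n` strands preserves reducibility. -/
def Preserves (L : Word κ → A) (n : ℕ) (x : Letter κ) : Prop :=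
  ∀ (s t : List κ) (w : Word κ), s.length = n → Reduces B L s w → x.Acts s t → Reduces B L t (w ++ [x])

theorem Preserves.of_std {L : Word κ → A} {n : ℕ} {x : Letter κ}
    (h : ∀ (f : κ → κ) (s t : List κ) (w : Word κ), s.length = n → Std w s → (x.recolor f).Acts s t →
      Reduces B L t (w ++ [x.recolor f])) : Preserves B L n x := by
  intro s t w hs hw hx
  exact hw.extend (typed_singleton.2 hx) fun f w' hw' => h f _ _ _ (by simpa using hs) hw' (hx.recolor f)

/-- Equal numbers of incoming and outgoing strands keep the strand count fixed, so a single
induction hypothesis serves all letters of `u`. -/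
theorem Reduces.append_word {L : Word κ → A} {s t : List κ} {w u : Word κ} (hw : Reduces B L s w)
    (hu : Typed u s t) (h : ∀ x ∈ u, x.inp = x.out ∧ Preserves B L s.length x) : Reduces B L t (w ++ u) := by
  induction hu generalizing w with
  | nil => simpa using hw
  | @cons x u s r t hx hu ih =>
    have h1 := h x (by simp)
    have h2 := ih (h1.2 s r w rfl hw hx) (by
      have := hx.length
      rw [show r.length = s.length by omega]
      exact fun y hy => h y (by simp [hy]))
    simpa using h2

end

theorem mem_overpass {j k : ℕ} {x : Letter κ} (h : x ∈ (overpass j k : Word κ)) :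
    ∃ i, x = cross (i + j) true := by
  induction k generalizing j with
  | zero => simp [overpass] at h
  | succ k ih =>
    rcases List.mem_cons.1 h with rfl | h
    · exact ⟨0, by simp⟩
    · obtain ⟨i, rfl⟩ := ih h
      exact ⟨i + 1, by simp; omega⟩

theorem mem_overLeft {k : ℕ} {x : Letter κ} (h : x ∈ (overLeft k : Word κ)) :
    ∃ i, x = cross i false := by
  induction k generalizing x with
  | zero => simp [overLeft] at h
  | succ k ih =>
    rcases List.mem_append.1 h with h | h
    · obtain ⟨y, hy, rfl⟩ := List.mem_map.1 h
      obtain ⟨i, rfl⟩ := ih hy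
      exact ⟨_, rfl⟩
    · exact ⟨0, by simpa using h⟩

variable [DecidableEq κ] {B A : Type} [CommRing B] [AddCommGroup A] [Module B A]
  {a z : Bˣ} {y : B} {e : A} {L : Word κ → A}

section

variable (hL : Rules a z y e L)
include hL

theorem Rules.reduces_iso {n : ℤ} {s t : List κ} {w u u' : Word κ} (h : Iso n s t u u')
    (hw : Typed w [] s) (hr : Reduces B L t (w ++ u')) : Reduces B L t (w ++ u) where
  typed := hw.append h.typed.1
  mem t' g v ht hv hv0 := by
    rw [hL.iso h hw (by simpa [ht] using hv.recolor g)
      (List.append_ne_nil_of_right_ne_nil _ (recolor_ne_nil g hv0))]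
    exact Submodule.smul_mem _ ((a ^ n : Bˣ) : B) (hr.mem t' g v ht hv hv0)

theorem Rules.reduces_circle {s : List κ} {w : Word κ} (c : κ) (hw : Reduces B L s w) :
    Reduces B L s (w ++ [cup 0 c, cap 0]) where
  typed := hw.typed.append (by simp)
  mem t g v hs hv hv0 := by
    obtain ⟨β, hβ⟩ := hL.exists_circle (c := c) hw.typed (by simpa [hs] using hv.recolor g) (recolor_ne_nil g hv0)
    rw [hβ]
    exact Submodule.smul_mem _ β (hw.mem t g v hs hv hv0)

/-- The skein relation, solved for one of the two crossings. -/
theorem Rules.reduces_flip {w : Word κ} {l r : List κ} {c d : κ} {b : Bool}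
    (hw : Typed w [] (l ++ c :: d :: r))
    (h1 : Reduces B L (l ++ d :: c :: r) (w ++ [cross l.length (!b)]))
    (h2 : Reduces B L ((l ++ d :: c :: r).map (mergeColor c d)) (Word.recolor (mergeColor c d) w))
    (h3 : Reduces B L ((l ++ d :: c :: r).map (mergeColor c d))
      (Word.recolor (mergeColor c d) w ++ [cap l.length] ++ [cup l.length c])) :
    Reduces B L (l ++ d :: c :: r) (w ++ [cross l.length b]) where
  typed := hw.append (typed_singleton.2 (Acts.cross l r c d b))
  mem t g v ht hv hv0 := by
    have hc : mergeColor c d c = c := by simp [mergeColor]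
    have hsk := hL.skein w (Word.recolor g v) l r c d hw (by rw [ht]; exact hv.recolor g)
    have m1 := h1.mem t g v ht hv hv0
    have m2 := h2.mem t (mergeColor c d ∘ g) v (by simp [ht]) hv hv0
    have m3 := h3.mem t (mergeColor c d ∘ g) v (by simp [ht]) hv hv0
    have key : L (w ++ [cross l.length b] ++ Word.recolor g v) =
        (z : B) • (L (Word.recolor (mergeColor c d) w ++ Word.recolor (mergeColor c d ∘ g) v) +
          L (Word.recolor (mergeColor c d) w ++ [cap l.length] ++ [cup l.length c] ++
            Word.recolor (mergeColor c d ∘ g) v)) - L (w ++ [cross l.length !b] ++ Word.recolor g v) := by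
      rw [eq_sub_iff_add_eq]
      simp only [recolor_append, recolor_recolor, Word.recolor_cons, Word.recolor_nil, Letter.recolor, hc] at hsk
      cases b <;> simp only [Bool.not_false, Bool.not_true]
      · rw [add_comm, hsk]; simp [Units.smul_def]
      · rw [hsk]; simp [Units.smul_def]
    rw [key]
    exact Submodule.sub_mem _ (Submodule.smul_mem _ _ (Submodule.add_mem _ m2 m3)) m1

/-- Over a layered word one smoothing is again layered. The other is a maximum on `n + 2` strands
followed by a minimum on `n` strands, which is why maxima are treated before crossings in the
induction. -/
theorem Rules.reduces_flip_std {n : ℕ} {w : Word κ} {l r : List κ} {c d : κ} {b : Bool}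
    (hn : (l ++ c :: d :: r).length = n + 2) (hw : Std w (l ++ c :: d :: r))
    (hcap : ∀ i, Preserves B L (n + 2) (cap i)) (hcup : ∀ x, Preserves B L n x)
    (h1 : Reduces B L (l ++ d :: c :: r) (w ++ [cross l.length (!b)])) :
    Reduces B L (l ++ d :: c :: r) (w ++ [cross l.length b]) := by
  have hc : mergeColor c d c = c := by simp [mergeColor]
  have hd : mergeColor c d d = c := by simp [mergeColor]
  have h2 := (hw.recolor (mergeColor c d)).reduces (B := B) L
  have h3 := hcap l.length _ (l.map (mergeColor c d) ++ r.map (mergeColor c d)) _ (by simpa using hn) h2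
    (by simpa [hc, hd] using Acts.cap (l.map (mergeColor c d)) (r.map (mergeColor c d)) c)
  have h4 := hcup (cup l.length c) _ ((l ++ c :: d :: r).map (mergeColor c d)) _ (by simp at hn ⊢; omega) h3
    (by simpa [hc, hd] using Acts.cup (l.map (mergeColor c d)) (r.map (mergeColor c d)) c)
  refine hL.reduces_flip hw.typed h1 ?_ ?_
  · simpa [hc, hd] using h2
  · simpa [hc, hd] using h4

/-- Letters on top of a layered word. -/
theorem Rules.preserves (n : ℕ) (x : Letter κ) : Preserves B L n x := by
  induction n using Nat.strong_induction_on generalizing x with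
  | _ n ih =>
  -- A letter that does not touch the ends of the last arc slides below it, where there are two
  -- strands fewer.
  have inside {w : Word κ} {c : κ} {p p' q : List κ} {x : Letter κ} (hw : Std w (p ++ q))
      (hn : (p ++ q).length < n) (hx : x.Acts p p') :
      Reduces B L (c :: (p' ++ c :: q)) (w ++ arc c p.length ++ [x.shift 1]) := by
    have h1 := (ih _ hn x _ _ _ rfl (hw.reduces L) (hx.whisker_right q)).arc (c := c)
    have := hL.reduces_iso (Iso.arc_letter_left c q hx) hw.typed (by simpa using h1)
    simpa using this
  have outside {w : Word κ} {c : κ} {p q q' : List κ} {x : Letter κ} (hw : Std w (p ++ q))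
      (hn : (p ++ q).length < n) (hx : x.Acts q q') :
      Reduces B L (c :: (p ++ c :: q')) (w ++ arc c p.length ++ [x.shift (p.length + 2)]) := by
    have h1 := (ih _ hn (x.shift p.length) _ _ _ rfl (hw.reduces L) (hx.whisker_left p)).arc (c := c)
    have := hL.reduces_iso (Iso.arc_letter_right c p hx) hw.typed (by simpa using h1)
    simpa using this
  have crossings {w : Word κ} {s t : List κ} {u : Word κ} (hw : Std w s) (hn : s.length < n)
      (hu : Typed u s t) (hx : ∀ x ∈ u, ∃ i b, x = cross i b) : Reduces B L t (w ++ u) :=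
    (hw.reduces L).append_word hu fun x h => by
      obtain ⟨i, b, rfl⟩ := hx x h
      exact ⟨rfl, ih _ hn _⟩
  -- A maximum at an end of the last arc closes it to a circle or turns it into a strand that runs
  -- over others. In the latter case only crossings on `n - 2` strands remain.
  have hcap (i : ℕ) : Preserves B L n (cap i) := by
    refine Preserves.of_std fun f s t w hs hw hx => ?_
    simp only [Letter.recolor] at hx ⊢
    cases hw with
    | nil =>
      have := hx.length
      simp [Letter.inp, Letter.out, Letter.pos] at this
    | @arc w c p q hw =>
      have hn : (p ++ q).length < n := by simp at hs ⊢; omega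
      rcases i with _ | i
      · rcases p with _ | ⟨d, p⟩
        · simp at hx; subst hx
          simpa [arc, overpass] using hL.reduces_circle c (hw.reduces L)
        · simp at hx
          obtain ⟨rfl, rfl⟩ := hx
          have h1 := crossings (u := overpass 0 p.length) hw hn (by simpa using (typed_overpass d p).whisker_right q)
            fun x hx => by
              obtain ⟨i, rfl⟩ := mem_overpass hx
              exact ⟨_, _, rfl⟩
          have := hL.reduces_iso (Iso.arc_cap_zero d p q) hw.typed h1
          simpa using this
      · simp only [acts_cap_succ] at hx
        obtain ⟨d, s', t, h1, rfl, hx⟩ := hx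
        simp at h1
        obtain ⟨rfl, rfl⟩ := h1
        rcases hx.split with ⟨p', rfl, hx'⟩ | ⟨x, q', hi, rfl, hx'⟩ | ⟨p', rfl, hi, rfl⟩ | ⟨q', rfl, hi, rfl⟩ |
          ⟨_, _, _, -, h, -⟩ | ⟨_, _, _, -, h, -⟩
        · exact inside hw hn hx'
        · have := outside (c := c) hw hn hx'
          rwa [← Letter.shift_shift x (p.length + 1) 1, ← hi] at this
        · simp at hi; subst hi
          have h1 := crossings (u := overLeft p'.length) hw hn
            (by simpa using (typed_overLeft c p').whisker_right q) fun x hx => by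
              obtain ⟨i, rfl⟩ := mem_overLeft hx
              exact ⟨_, _, rfl⟩
          have := hL.reduces_iso (Iso.arc_cap_last c p' q) (by simpa using hw.typed) h1
          simpa using this
        · simp at hi; subst hi
          have h1 := crossings (u := overLeft p.length) hw hn
            (by simpa using (typed_overLeft c p).whisker_right q') fun x hx => by
              obtain ⟨i, rfl⟩ := mem_overLeft hx
              exact ⟨_, _, rfl⟩
          have := hL.reduces_iso (Iso.arc_cap_next c p q') (by simpa using hw.typed) h1
          simpa using this
        · cases h
        · cases h
  -- A crossing at the right end of the arc either undoes the arc's last crossing or lengthens the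
  -- arc by one. For the wrong sign the skein relation is used. Place `0` is postponed, since it
  -- relies on this case.
  have hcross (i : ℕ) (b : Bool) : Preserves B L n (cross (i + 1) b) := by
    refine Preserves.of_std fun f s t w hs hw hx => ?_
    simp only [Letter.recolor] at hx ⊢
    have hw0 := hw
    cases hw with
    | nil =>
      have := hx.length
      have := congrArg List.length (show t = [] by simpa [Letter.inp, Letter.out] using this.2)
      simp at *
    | @arc w c p q hw =>
      have hn : (p ++ q).length < n := by simp at hs ⊢; omega
      obtain ⟨n, rfl⟩ : ∃ m, n = m + 2 := ⟨(p ++ q).length, by simp at hs ⊢; omega⟩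
      simp only [acts_cross_succ] at hx
      obtain ⟨d, s', t, h1, rfl, hx⟩ := hx
      simp at h1
      obtain ⟨rfl, rfl⟩ := h1
      rcases hx.split with ⟨p', rfl, hx'⟩ | ⟨x, q', hi, rfl, hx'⟩ | ⟨_, -, h, -⟩ | ⟨_, -, h, -⟩ |
        ⟨p', d, b, rfl, hi, rfl⟩ | ⟨q', d, b, rfl, hi, rfl⟩
      · exact inside hw hn hx'
      · have := outside (c := c) hw hn hx'
        rwa [← Letter.shift_shift x (p.length + 1) 1, ← hi] at this
      · cases h
      · cases h
      · simp at hi; obtain ⟨rfl, rfl⟩ := hi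
        have h0 : Reduces B L (c :: (p' ++ c :: d :: q)) (w ++ arc c (p' ++ [d]).length ++ [cross (p'.length + 1) false]) := by
          have := hL.reduces_iso (Iso.arc_cross_last c d p' q) (by simpa using hw.typed)
            ((Std.arc c p' (d :: q) (by simpa using hw)).reduces L)
          simpa using this
        cases b
        · exact h0
        · have := hL.reduces_flip_std (l := c :: p') (r := q) (c := d) (d := c) (b := true) (n := n) (by simpa using hs)
            (by simpa using hw0) hcap (ih n (by omega)) (by simpa using h0)
          simpa using this
      · simp at hi; obtain ⟨rfl, rfl⟩ := hi
        have h0 : Reduces B L (c :: (p ++ d :: c :: q')) (w ++ arc c p.length ++ [cross (p.length + 1) true]) := by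
          have := (Std.arc c (p ++ [d]) q' (by simpa using hw)).reduces (B := B) L
          simpa [arc_succ] using this
        cases b
        · have := hL.reduces_flip_std (l := c :: p) (r := q') (c := c) (d := d) (b := false) (n := n) (by simpa using hs)
            (by simpa using hw0) hcap (ih n (by omega)) (by simpa using h0)
          simpa using this
        · exact h0
  have hcross0 (b : Bool) : Preserves B L n (cross 0 b) := by
    refine Preserves.of_std fun f s t w hs hw hx => ?_
    simp only [Letter.recolor] at hx ⊢
    have hw0 := hw
    cases hw with
    | nil =>
      have := hx.length
      have := congrArg List.length (show t = [] by simpa [Letter.inp, Letter.out] using this.2)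
      simp at *
    | @arc w c p q hw =>
      have hn : (p ++ q).length < n := by simp at hs ⊢; omega
      obtain ⟨n, rfl⟩ : ∃ m, n = m + 2 := ⟨(p ++ q).length, by simp at hs ⊢; omega⟩
      rcases p with _ | ⟨d, p⟩
      · simp at hx; subst hx
        have := hL.reduces_iso ((Iso.kink_cup c (!b)).whisker_right q) hw.typed
          (by simpa [arc, overpass] using hw0.reduces (B := B) L)
        simpa [arc, overpass] using this
      · simp at hx; subst hx
        -- After the arc has slid off `d` there are again `n` strands, so the induction hypothesis
        -- is not available for the remaining crossings. They are at places at least `2`, however,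
        -- and `hcross` handles them.
        have h0 : Reduces B L (d :: c :: (p ++ c :: q)) (w ++ arc c (d :: p).length ++ [cross 0 true]) := by
          have h1 := ih _ hn (cup 1 c) _ (d :: c :: c :: (p ++ q)) _ rfl (hw.reduces L) (by simp)
          have h2 := h1.append_word (u := overpass 2 p.length) (t := d :: c :: (p ++ c :: q))
            (by simpa [shift_overpass] using ((typed_overpass c p).whisker_left [d, c]).whisker_right q) fun x hx => by
              obtain ⟨i, rfl⟩ := mem_overpass hx
              refine ⟨rfl, ?_⟩
              convert hcross (i + 1) true using 1
              simp at hs ⊢; omega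
          have := hL.reduces_iso (Iso.arc_cross_zero c d p q) hw.typed (by simpa using h2)
          simpa using this
        cases b
        · have := hL.reduces_flip_std (l := []) (r := p ++ c :: q) (c := c) (d := d) (b := false) (n := n) (by simpa using hs)
            (by simpa using hw0) hcap (ih n (by omega)) (by simpa using h0)
          simpa using this
        · exact h0
  cases x with
  | cap i => exact hcap i
  | cross i b =>
    rcases i with _ | i
    · exact hcross0 b
    · exact hcross i b
  | cup i d =>
    refine Preserves.of_std fun f s t w hs hw hx => ?_
    simp only [Letter.recolor] at hx ⊢
    rcases i with _ | i
    · simp at hx; subst hx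
      simpa [arc, overpass] using (Std.arc (f d) [] s (by simpa using hw)).reduces (B := B) L
    · simp only [acts_cup_succ] at hx
      obtain ⟨c, s', t, rfl, rfl, hx⟩ := hx
      cases hw with
      | @arc w _ p q hw =>
        have hn : (p ++ q).length < n := by simp at hs ⊢; omega
        rcases hx.split with ⟨p', rfl, hx'⟩ | ⟨x, q', hi, rfl, hx'⟩ | ⟨_, -, h, -⟩ | ⟨_, -, h, -⟩ |
          ⟨_, _, _, -, h, -⟩ | ⟨_, _, _, -, h, -⟩
        · exact inside hw hn hx'
        · have := outside (c := c) hw hn hx'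
          rwa [← Letter.shift_shift x (p.length + 1) 1, ← hi] at this
        all_goals cases h

theorem Rules.reduces {s : List κ} {w : Word κ} (hw : Typed w [] s) : Reduces B L s w := by
  induction w using List.reverseRecOn generalizing s with
  | nil => simp at hw; subst hw; exact Std.nil.reduces L
  | append_singleton w x ih =>
    obtain ⟨r, h1, h2⟩ := typed_append.1 hw
    exact hL.preserves _ x r s w rfl (ih h1) (typed_singleton.1 h2)

/-- The value of each diagram is a multiple of the value of the unknot. -/
theorem Rules.exists_smul {w : Word κ} (hw : Typed w [] []) (hw0 : w ≠ []) : ∃ β : B, L w = β • e := by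
  rcases List.eq_nil_or_concat' w with rfl | ⟨w, x, rfl⟩
  · exact absurd rfl hw0
  obtain ⟨r, h1, h2⟩ := typed_append.1 hw
  have h2 := typed_singleton.1 h2
  have hx := h2.length
  cases x with
  | cup i c => simp [Letter.out, Letter.pos] at hx
  | cross i b => simp [Letter.out, Letter.pos] at hx
  | cap i =>
    obtain rfl : i = 0 := by simpa [Letter.out, Letter.pos] using hx.1
    obtain ⟨c, rfl⟩ := acts_cap_zero.1 h2
    have h3 := (hL.reduces h1).mem [c, c] id [cap 0] (by simp) (by simp) (by simp)
    rw [recolor_id] at h3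
    -- The last letter of a closed word is a maximum on two strands, and the only layered word with
    -- two ends is a single minimum. Its closure is the unknot.
    suffices stdSpan B L [c, c] [cap 0] ≤ Submodule.span B {e} by
      obtain ⟨β, hβ⟩ := Submodule.mem_span_singleton.1 (this h3)
      exact ⟨β, hβ.symm⟩
    refine Submodule.span_le.2 ?_
    rintro _ ⟨f, w', hw', rfl⟩
    refine Submodule.subset_span ?_
    generalize hs : [c, c].map f = s at hw'
    cases hw' with
    | nil => simp at hs
    | arc d p q hw' =>
      simp at hs
      obtain ⟨rfl, hs⟩ := hs
      rcases p with _ | ⟨d, p⟩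
      · simp at hs; subst hs
        cases hw'
        simpa [arc, overpass, Letter.recolor] using hL.unknot (f c)
      · simp at hs

end

end Span

end TiedLink

namespace TiedLink

open Letter Word

/-! ### The state sum of a coloured diagram -/

section StateSum

variable {F I G : Type} [Field F] [Fintype I]

namespace IsModel

variable {q a : F} {X : I → I → I → I → F} {n u : I → I → F} (h : IsModel q a X n u)

/-- The action of a crossing of either kind. -/
def signedOp (q : F) (X : I → I → I → I → F) (n u : I → I → F) (b : Bool) (f : I → I → F) (x y : I) : F :=
  if b then crossOp X f x y else (q + q⁻¹) * (f x y + n x y * cupOp u f) - crossOp X f x y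

theorem signedOp_mul (b : Bool) (c : F) (f : I → I → F) (x y : I) :
    signedOp q X n u b (fun k l => c * f k l) x y = c * signedOp q X n u b f x y := by
  cases b <;> simp [signedOp, crossOp_mul, cupOp_mul]
  ring

theorem signedOp_expand [DecidableEq I] (b : Bool) (x y : I) : ∃ c : I → I → F, ∀ f : I → I → F,
    signedOp q X n u b f x y = ∑ k, ∑ l, c k l * f k l := by
  cases b
  · refine ⟨fun k l => (q + q⁻¹) * ((if x = k then if y = l then 1 else 0 else 0) + n x y * u k l) - X x y k l, fun f => ?_⟩
    simp [signedOp, crossOp, cupOp, sub_mul, mul_add, add_mul, Finset.sum_add_distrib, Finset.sum_sub_distrib,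
      Finset.mul_sum, mul_assoc]
  · exact ⟨X x y, fun f => rfl⟩

include h

/-- The negative crossing is defined by the skein relation; the field `inv` says precisely that it
is inverse to the positive one. -/
theorem signedOp_cancel (b : Bool) (f : I → I → F) (x y : I) :
    signedOp q X n u b (signedOp q X n u (!b) f) x y = f x y := by
  have h1 := h.inv f x y
  have h2 := h.kink_cup f
  have h3 := h.kink_cap x y
  have h4 : crossOp X (fun k l => n k l * cupOp u f) x y = a⁻¹ * n x y * cupOp u f := h.crossOp_cap _ x y
  cases b
  · have : signedOp q X n u true f = crossOp X f := rfl
    simp only [Bool.not_false, this]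
    simp only [signedOp, Bool.false_eq_true, if_false, h1, h2]
    ring
  · have : signedOp q X n u false f = fun k l => (q + q⁻¹) * (f k l + n k l * cupOp u f) - crossOp X f k l := by
      funext k l
      simp [signedOp]
    have h1' : crossOp X (fun k l => crossOp X f k l) x y = _ := h1
    simp only [Bool.not_true, this]
    simp only [signedOp, if_true, crossOp_sub, crossOp_mul, crossOp_add, h1', h4]
    ring

theorem signedOp_slide (b : Bool) (f : I → F) (x y w : I) :
    signedOp q X n u b (fun k l => n l w * f k) x y = signedOp q X n u (!b) (fun k l => n x k * f l) y w := by
  have h1 := h.slide f x y w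
  cases b <;> simp [signedOp, h.zigzag_left, h.zigzag_right]
  · linear_combination -h1
  · linear_combination h1

theorem signedOp_curl (b : Bool) (f : I → F) (x : I) :
    cupOp u (fun k l => signedOp q X n u b (fun p r => n r l * f p) x k) = (if b then a else a⁻¹) * f x := by
  have h1 := h.curl_right f x
  cases b
  · simp only [signedOp, Bool.false_eq_true, if_false, cupOp_sub, cupOp_mul, cupOp_add, h1, h.zigzag_right, h.zigzag_left]
    have : cupOp u (fun k l => n k l * f x) = cupOp u n * f x := cupOp_cap _
    rw [this]
    linear_combination f x * h.loop
  · simpa [signedOp] using h1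

end IsModel

variable [LinearOrder G]

/-- The weight of a crossing of strands of different colours. -/
def colorSign (F : Type) [Field F] (b : Bool) (g h : G) : F := if decide (g < h) = b then 1 else -1

/-- For different colours the sign is `1` exactly when the strand of the smaller colour is on top.
Exchanging the two places and reversing `b` does not change which strand that is, so the sign is
unaffected by rotation of the crossing. -/
theorem colorSign_swap {g h : G} (hgh : g ≠ h) (b : Bool) :
    colorSign F (!b) h g = colorSign F b g h := by
  rcases lt_or_gt_of_ne hgh with h1 | h1 <;> cases b <;> simp [colorSign, h1, h1.le]

theorem colorSign_mul_self (b : Bool) (g h : G) : colorSign F b g h * colorSign F b g h = 1 := by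
  unfold colorSign
  split_ifs <;> simp

theorem colorSign_false (g h : G) : colorSign F false g h = -colorSign F true g h := by
  by_cases h1 : g < h <;> simp [colorSign, h1]

namespace IsModel

section Eval

variable (q : F) (X : I → I → I → I → F) (n u : I → I → F)

/-- The action of a crossing of two coloured strands. -/
def crossAct (b : Bool) (f : G × I → G × I → F) (p r : G × I) : F :=
  if p.1 = r.1 then signedOp q X n u b (fun k l => f (p.1, k) (p.1, l)) p.2 r.2
  else colorSign F b p.1 r.1 * f r p

/-- The weight of a maximum of coloured strands. -/
def capWeight (p r : G × I) : F := if p.1 = r.1 then n p.2 r.2 else 0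

/-- The action of a letter on functions of the labels of the strands, when no strands are to the
left of the letter. -/
def act : Letter G → (List (G × I) → F) → List (G × I) → F
  | .cup _ c, f, s => cupOp u fun k l => f ((c, k) :: (c, l) :: s)
  | .cap _, f, p :: r :: s => capWeight n p r * f s
  | .cross _ b, f, p :: r :: s => crossAct q X n u b (fun p r => f (p :: r :: s)) p r
  | _, _, _ => 0

/-- Let an operation act on all strands but the first `i`. -/
def lift {P : Type} : ℕ → ((List P → F) → List P → F) → (List P → F) → List P → F
  | 0, T, f, s => T f s
  | _ + 1, _, _, [] => 0
  | i + 1, T, f, p :: s => lift i T (fun t => f (p :: t)) s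

/-- The action of a letter on functions of the labels of the strands. -/
def letterOp (x : Letter G) : (List (G × I) → F) → List (G × I) → F := lift x.pos (act q X n u x)

/-- The action of a word on functions of the labels of the strands. -/
def wordOp : Word G → (List (G × I) → F) → List (G × I) → F
  | [], f => f
  | x :: w, f => letterOp q X n u x (wordOp w f)

end Eval

variable {q a : F} {X : I → I → I → I → F} {n u : I → I → F}

theorem letterOp_shift_one (x : Letter G) (f : List (G × I) → F) (p : G × I) (s : List (G × I)) :
    letterOp q X n u (x.shift 1) f (p :: s) = letterOp q X n u x (fun t => f (p :: t)) s := by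
  have : act q X n u (x.shift 1) = act q X n u x := by
    funext f s
    cases x <;> rcases s with _ | ⟨_, _ | ⟨_, _⟩⟩ <;> rfl
  rw [letterOp, this, Letter.pos_shift]
  rfl

theorem letterOp_shift (x : Letter G) (l : List (G × I)) (f : List (G × I) → F) (s : List (G × I)) :
    letterOp q X n u (x.shift l.length) f (l ++ s) = letterOp q X n u x (fun t => f (l ++ t)) s := by
  induction l generalizing f with
  | nil => simp [Letter.shift_zero]
  | cons p l ih =>
    rw [List.length_cons, ← Letter.shift_shift, List.cons_append, letterOp_shift_one, ih]
    rfl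

theorem wordOp_shift (w : Word G) (l : List (G × I)) (f : List (G × I) → F) (s : List (G × I)) :
    wordOp q X n u (Word.shift l.length w) f (l ++ s) = wordOp q X n u w (fun t => f (l ++ t)) s := by
  induction w generalizing s with
  | nil => rfl
  | cons x w ih => simp [wordOp, letterOp_shift, ih]

theorem wordOp_append (v w : Word G) (f : List (G × I) → F) :
    wordOp q X n u (v ++ w) f = wordOp q X n u v (wordOp q X n u w f) := by
  induction v with
  | nil => rfl
  | cons x v ih => simp [wordOp, ih]

/-- Each letter acts by a matrix which respects the colours. -/
theorem letterOp_expand {x : Letter G} {s t : List G} (hx : x.Acts s t) {l : List (G × I)}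
    (hl : l.map Prod.fst = s) : ∃ (ι : Type) (_ : Fintype ι) (c : ι → F) (m : ι → List (G × I)),
      (∀ i, (m i).map Prod.fst = t) ∧ ∀ f r, letterOp q X n u x f (l ++ r) = ∑ i, c i * f (m i ++ r) := by
  classical
  have wh {y : Letter G} (l : List (G × I)) {l' : List (G × I)} {t : List G}
      (h : ∃ (ι : Type) (_ : Fintype ι) (c : ι → F) (m : ι → List (G × I)), (∀ i, (m i).map Prod.fst = t) ∧
        ∀ f r, letterOp q X n u y f (l' ++ r) = ∑ i, c i * f (m i ++ r)) :
      ∃ (ι : Type) (_ : Fintype ι) (c : ι → F) (m : ι → List (G × I)), (∀ i, (m i).map Prod.fst = l.map Prod.fst ++ t) ∧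
        ∀ f r, letterOp q X n u (y.shift l.length) f (l ++ l' ++ r) = ∑ i, c i * f (m i ++ r) := by
    obtain ⟨ι, _, c, m, h1, h2⟩ := h
    refine ⟨ι, inferInstance, c, fun i => l ++ m i, by simp [h1], fun f r => ?_⟩
    rw [List.append_assoc, letterOp_shift, h2]
    simp
  cases hx with
  | cup s s' c =>
    obtain ⟨l, l', rfl, rfl, rfl⟩ := List.map_eq_append_iff.1 hl
    have := wh (y := Letter.cup 0 c) (l' := l') (t := c :: c :: l'.map Prod.fst) l
      ⟨I × I, inferInstance, fun i => u i.1 i.2, fun i => (c, i.1) :: (c, i.2) :: l', by simp, fun f r => by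
        simp [letterOp, lift, act, Letter.pos, cupOp, Fintype.sum_prod_type]⟩
    simpa [Letter.shift] using this
  | cap s s' c =>
    obtain ⟨l, l', rfl, rfl, h⟩ := List.map_eq_append_iff.1 hl
    obtain ⟨p, l', rfl, rfl, h'⟩ := List.map_eq_cons_iff.1 h
    obtain ⟨r, l', rfl, hc, rfl⟩ := List.map_eq_cons_iff.1 h'
    have := wh (y := Letter.cap 0) (l' := p :: r :: l') (t := l'.map Prod.fst) l
      ⟨Unit, inferInstance, fun _ => capWeight n p r, fun _ => l', by simp, fun f r => by
        simp [letterOp, lift, act, Letter.pos]⟩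
    simpa [Letter.shift] using this
  | cross s s' c d b =>
    obtain ⟨l, l', rfl, rfl, h⟩ := List.map_eq_append_iff.1 hl
    obtain ⟨p, l', rfl, rfl, h'⟩ := List.map_eq_cons_iff.1 h
    obtain ⟨r, l', rfl, rfl, rfl⟩ := List.map_eq_cons_iff.1 h'
    have := wh (y := Letter.cross 0 b) (l' := p :: r :: l') (t := r.1 :: p.1 :: l'.map Prod.fst) l (by
      by_cases hpr : p.1 = r.1
      · obtain ⟨c, hc⟩ := signedOp_expand (q := q) (X := X) (n := n) (u := u) b p.2 r.2
        refine ⟨I × I, inferInstance, fun i => c i.1 i.2, fun i => (p.1, i.1) :: (p.1, i.2) :: l', by simp [hpr],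
          fun f s => ?_⟩
        simp [letterOp, lift, act, Letter.pos, crossAct, hpr, hc, Fintype.sum_prod_type]
      · exact ⟨Unit, inferInstance, fun _ => colorSign F b p.1 r.1, fun _ => r :: p :: l', by simp,
          fun f s => by simp [letterOp, lift, act, Letter.pos, crossAct, hpr]⟩)
    simpa [Letter.shift] using this

theorem letterOp_expand' {x : Letter G} {s t : List G} (hx : x.Acts s t) {l : List (G × I)}
    (hl : l.map Prod.fst = s) : ∃ (ι : Type) (_ : Fintype ι) (c : ι → F) (m : ι → List (G × I)),
      (∀ i, (m i).map Prod.fst = t) ∧ ∀ f, letterOp q X n u x f l = ∑ i, c i * f (m i) := by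
  obtain ⟨ι, _, c, m, h1, h2⟩ := letterOp_expand (q := q) (X := X) (n := n) (u := u) hx hl
  exact ⟨ι, inferInstance, c, m, h1, fun f => by simpa using h2 f []⟩

/-- Each word acts by a matrix which respects the colours. -/
theorem wordOp_expand {w : Word G} {s t : List G} (hw : Typed w s t) {l : List (G × I)}
    (hl : l.map Prod.fst = s) : ∃ (ι : Type) (_ : Fintype ι) (c : ι → F) (m : ι → List (G × I)),
      (∀ i, (m i).map Prod.fst = t) ∧ ∀ f, wordOp q X n u w f l = ∑ i, c i * f (m i) := by
  induction hw generalizing l with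
  | nil => exact ⟨Unit, inferInstance, fun _ => 1, fun _ => l, fun _ => hl, fun f => by simp [wordOp]⟩
  | cons hx _ ih =>
    obtain ⟨ι, _, c, m, h1, h2⟩ := letterOp_expand' (q := q) (X := X) (n := n) (u := u) hx hl
    choose κ _ d k h3 h4 using fun i => ih (h1 i)
    refine ⟨Σ i, κ i, inferInstance, fun i => c i.1 * d i.1 i.2, fun i => k i.1 i.2, fun i => h3 _ _, fun f => ?_⟩
    simp only [wordOp, h2, h4, Fintype.sum_sigma, Finset.mul_sum, mul_assoc]

/-- Makes the default values of `act` and `lift` on lists of the wrong shape harmless: only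
correctly coloured lists at the top are ever consulted. -/
theorem wordOp_congr {w : Word G} {s t : List G} (hw : Typed w s t) {l : List (G × I)} (hl : l.map Prod.fst = s)
    {f g : List (G × I) → F} (h : ∀ m : List (G × I), m.map Prod.fst = t → f m = g m) :
    wordOp q X n u w f l = wordOp q X n u w g l := by
  obtain ⟨ι, _, c, m, h1, h2⟩ := wordOp_expand (q := q) (X := X) (n := n) (u := u) hw hl
  simp [h2, h _ (h1 _)]

theorem wordOp_mul {w : Word G} {s t : List G} (hw : Typed w s t) {l : List (G × I)} (hl : l.map Prod.fst = s)
    (c : F) (f : List (G × I) → F) :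
    wordOp q X n u w (fun m => c * f m) l = c * wordOp q X n u w f l := by
  obtain ⟨ι, _, c, m, h1, h2⟩ := wordOp_expand (q := q) (X := X) (n := n) (u := u) hw hl
  simp [h2, Finset.mul_sum, mul_left_comm]

theorem wordOp_add {w : Word G} {s t : List G} (hw : Typed w s t) {l : List (G × I)} (hl : l.map Prod.fst = s)
    (f g : List (G × I) → F) :
    wordOp q X n u w (fun m => f m + g m) l = wordOp q X n u w f l + wordOp q X n u w g l := by
  obtain ⟨ι, _, c, m, h1, h2⟩ := wordOp_expand (q := q) (X := X) (n := n) (u := u) hw hl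
  simp [h2, mul_add, Finset.sum_add_distrib]

/-- Matrices acting on disjoint blocks of strands commute; after `letterOp_expand` this is an
interchange of finite sums. -/
theorem letterOp_exchange {x y : Letter G} {s s' r r' : List G} (hx : x.Acts s s') (hy : y.Acts r r')
    {l k : List (G × I)} (hl : l.map Prod.fst = s) (hk : k.map Prod.fst = r) (f : List (G × I) → F) :
    wordOp q X n u [x, y.shift s'.length] f (l ++ k) = wordOp q X n u [y.shift s.length, x] f (l ++ k) := by
  obtain ⟨ι, _, c, m, h1, h2⟩ := letterOp_expand (q := q) (X := X) (n := n) (u := u) hx hl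
  obtain ⟨ι', _, c', m', h1', h2'⟩ := letterOp_expand' (q := q) (X := X) (n := n) (u := u) hy hk
  have e (i : ι) : s'.length = (m i).length := by rw [← h1 i, List.length_map]
  have e' : s.length = l.length := by rw [← hl, List.length_map]
  have h3 (i : ι) : letterOp q X n u (y.shift s'.length) f (m i ++ k) = ∑ j, c' j * f (m i ++ m' j) := by
    rw [e i, letterOp_shift, h2']
  simp only [wordOp, h2, h3]
  rw [e', letterOp_shift]
  simp only [h2, h2', Finset.mul_sum]
  rw [Finset.sum_comm]
  simp only [mul_left_comm]

end IsModel

end StateSum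

end TiedLink

namespace TiedLink

open Letter Word

/-! ### Invariance and skein relation of the state sum -/

section StateSum

variable {F I G : Type} [Field F] [Fintype I] [LinearOrder G]

namespace IsModel

variable {q a : F} {X : I → I → I → I → F} {n u : I → I → F} (h : IsModel q a X n u)
include h

theorem crossAct_cancel (b : Bool) (f : G × I → G × I → F) (p r : G × I) :
    crossAct q X n u b (crossAct q X n u (!b) f) p r = f p r := by
  obtain ⟨g, x⟩ := p
  obtain ⟨k, y⟩ := r
  by_cases hgk : g = k
  · subst hgk
    simpa [crossAct] using h.signedOp_cancel b (fun x y => f (g, x) (g, y)) x y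
  · simp [crossAct, hgk, Ne.symm hgk, colorSign_swap hgk, ← mul_assoc, colorSign_mul_self]

theorem crossAct_slide (b : Bool) (f : G × I → F) (p r t : G × I) :
    crossAct q X n u b (fun k l => capWeight n l t * f k) p r =
      crossAct q X n u (!b) (fun k l => capWeight n p k * f l) r t := by
  obtain ⟨g, x⟩ := p
  obtain ⟨k, y⟩ := r
  obtain ⟨m, w⟩ := t
  have zero (b : Bool) (x y : I) : signedOp q X n u b (fun _ _ => 0) x y = 0 := by
    simpa using signedOp_mul (q := q) (X := X) (n := n) (u := u) b 0 (fun _ _ => 0) x y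
  by_cases hgk : g = k
  · subst hgk
    by_cases hgm : g = m
    · subst hgm
      simpa [crossAct, capWeight] using h.signedOp_slide b (fun x => f (g, x)) x y w
    · simp [crossAct, capWeight, hgm, zero]
  · by_cases hkm : k = m
    · subst hkm
      simp [crossAct, capWeight, hgk, zero]
    · by_cases hgm : g = m
      · subst hgm
        simp [crossAct, capWeight, hgk, hkm, colorSign_swap hgk, mul_left_comm]
      · simp [crossAct, capWeight, hgk, hkm, hgm]

/-- If all colours agree this is the braid relation of the model. Otherwise crossings of different
colours only permute labels and contribute the same signs on both sides, and at most one pair of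
strands interacts through `X`. -/
theorem crossAct_braid (f : G × I → G × I → G × I → F) (p r t : G × I) :
    crossAct q X n u true (fun k l => crossAct q X n u true (fun k' m => crossAct q X n u true
      (fun i j => f i j m) k k') l t) p r =
    crossAct q X n u true (fun k l => crossAct q X n u true (fun i k' => crossAct q X n u true
      (fun j m => f i j m) k' l) p k) r t := by
  obtain ⟨g, x⟩ := p
  obtain ⟨k, y⟩ := r
  obtain ⟨m, w⟩ := t
  have mul (c : F) (f : I → I → F) (x y : I) : crossOp X (fun k l => c * f k l) x y = c * crossOp X f x y :=
    crossOp_mul X f c x y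
  by_cases hgk : g = k
  · subst hgk
    by_cases hgm : g = m
    · subst hgm
      simpa [crossAct, signedOp] using h.braid (fun x y z => f (g, x) (g, y) (g, z)) x y w
    · simp [crossAct, signedOp, hgm, mul]
  · by_cases hkm : k = m
    · subst hkm
      simp [crossAct, signedOp, hgk, mul]
    · by_cases hgm : g = m
      · subst hgm
        simp only [crossAct, signedOp, hgk, hkm, if_true, if_false, mul]
        ring
      · simp [crossAct, hgk, hkm, hgm, mul_left_comm]

theorem wordOp_gen {e : ℤ} {m m' : Word G} (g : Gen e m m') {s t : List G} (hm : Typed m s t)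
    {l : List (G × I)} (hl : l.map Prod.fst = s) (f : List (G × I) → F) :
    wordOp q X n u m f l = a ^ e * wordOp q X n u m' f l := by
  have shifted {m m' : Word G} {i : ℕ} {c : F} (hi : Typed (Word.shift i m) s t) (hs : i ≤ s.length)
      (h0 : ∀ (l : List (G × I)) (t : List G), Typed m (l.map Prod.fst) t → ∀ f, wordOp q X n u m f l = c * wordOp q X n u m' f l) :
      wordOp q X n u (Word.shift i m) f l = c * wordOp q X n u (Word.shift i m') f l := by
    obtain ⟨s₁, s₂, t', rfl, rfl, rfl, h1⟩ := Typed.of_shift hi hs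
    obtain ⟨l₁, l₂, rfl, rfl, rfl⟩ := List.map_eq_append_iff.1 hl
    rw [List.length_map, wordOp_shift, wordOp_shift]
    exact h0 l₂ t' h1 _
  have len {x : Letter G} {w : Word G} (hi : Typed (x :: w) s t) : x.pos + x.inp ≤ s.length := by
    obtain ⟨r, h1, -⟩ := typed_cons.1 hi
    have := h1.length
    omega
  cases g with
  | exchange x y hxy =>
    obtain ⟨y', s₁, t₁, s₂, t₂, h1, h2, rfl, h3, h4⟩ := exchange_split hxy hm
    obtain ⟨l₁, l₂, rfl, h5, h6⟩ := List.map_eq_append_iff.1 hl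
    rw [h3, h4, zpow_zero, one_mul]
    exact letterOp_exchange h1 h2 h5 h6 f
  | zigzag_left i c =>
    have h0 := len hm
    simp only [Letter.pos, Letter.inp] at h0
    have := shifted (i := i) (m := [cup 1 c, cap 0]) (m' := []) (c := a ^ (0 : ℤ))
      (by simpa only [Word.shift_cons, Word.shift_nil, Letter.shift, add_comm, add_zero] using hm)
      (by omega) (by
        intro l t hl f
        rcases l with _ | ⟨⟨d, x⟩, l⟩
        · simp at hl
        · obtain rfl : d = c := by simp at hl; grind
          simpa [wordOp, letterOp, lift, act, Letter.pos, capWeight] using h.zigzag_left (fun k => f ((d, k) :: l)) x)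
    simpa only [Word.shift_cons, Word.shift_nil, Letter.shift, add_comm, add_zero] using this
  | zigzag_right i c =>
    have h0 := len hm
    simp only [Letter.pos, Letter.inp] at h0
    have := shifted (i := i) (m := [cup 0 c, cap 1]) (m' := []) (c := a ^ (0 : ℤ))
      (by simpa only [Word.shift_cons, Word.shift_nil, Letter.shift, add_comm, add_zero] using hm)
      (by omega) (by
        intro l t hl f
        rcases l with _ | ⟨⟨d, x⟩, l⟩
        · simp at hl
        · obtain rfl : d = c := by simp at hl; grind
          simpa [wordOp, letterOp, lift, act, Letter.pos, capWeight] using h.zigzag_right (fun k => f ((d, k) :: l)) x)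
    simpa only [Word.shift_cons, Word.shift_nil, Letter.shift, add_comm, add_zero] using this
  | cap_slide i b =>
    have h0 := len hm
    simp only [Letter.pos, Letter.inp] at h0
    have := shifted (i := i) (m := [cross 0 b, cap 1]) (m' := [cross 1 (!b), cap 0]) (c := a ^ (0 : ℤ))
      (by simpa only [Word.shift_cons, Word.shift_nil, Letter.shift, add_comm, add_zero] using hm)
      (by omega) (by
        intro l t hl f
        rcases l with _ | ⟨p, _ | ⟨r, _ | ⟨t, l⟩⟩⟩ <;> simp at hl
        simpa [wordOp, letterOp, lift, act, Letter.pos] using h.crossAct_slide b (fun k => f (k :: l)) p r t)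
    simpa only [Word.shift_cons, Word.shift_nil, Letter.shift, add_comm, add_zero] using this
  | two i b =>
    have h0 := len hm
    simp only [Letter.pos, Letter.inp] at h0
    have := shifted (i := i) (m := [cross 0 b, cross 0 (!b)]) (m' := []) (c := a ^ (0 : ℤ))
      (by simpa only [Word.shift_cons, Word.shift_nil, Letter.shift, add_comm, add_zero] using hm)
      (by omega) (by
        intro l t hl f
        rcases l with _ | ⟨p, _ | ⟨r, l⟩⟩ <;> simp at hl
        simpa [wordOp, letterOp, lift, act, Letter.pos] using h.crossAct_cancel b (fun k m => f (k :: m :: l)) p r)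
    simpa only [Word.shift_cons, Word.shift_nil, Letter.shift, add_comm, add_zero] using this
  | three i =>
    have h0 := len hm
    simp only [Letter.pos, Letter.inp] at h0
    have := shifted (i := i) (m := [cross 0 true, cross 1 true, cross 0 true]) (m' := [cross 1 true, cross 0 true, cross 1 true])
      (c := a ^ (0 : ℤ))
      (by simpa only [Word.shift_cons, Word.shift_nil, Letter.shift, add_comm, add_zero] using hm)
      (by omega) (by
        intro l t hl f
        rcases l with _ | ⟨p, _ | ⟨r, _ | ⟨t, l⟩⟩⟩ <;> simp at hl
        simpa [wordOp, letterOp, lift, act, Letter.pos] using h.crossAct_braid (fun i j k => f (i :: j :: k :: l)) p r t)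
    simpa only [Word.shift_cons, Word.shift_nil, Letter.shift, add_comm, add_zero] using this
  | curl i c b =>
    have h0 := len hm
    simp only [Letter.pos, Letter.inp] at h0
    have := shifted (i := i) (m := [cup 1 c, cross 0 b, cap 1]) (m' := []) (c := a ^ (if b then 1 else -1 : ℤ))
      (by simpa only [Word.shift_cons, Word.shift_nil, Letter.shift, add_comm, add_zero] using hm)
      (by omega) (by
        intro l t hl f
        rcases l with _ | ⟨⟨d, x⟩, l⟩
        · simp at hl
        · obtain rfl : d = c := by simp at hl; grind
          have := h.signedOp_curl b (fun k => f ((d, k) :: l)) x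
          cases b <;> simpa [wordOp, letterOp, lift, act, Letter.pos, capWeight, crossAct] using this)
    simpa only [Word.shift_cons, Word.shift_nil, Letter.shift, add_comm, add_zero] using this

omit h in
/-- The value of a closed coloured diagram. -/
def eval (q : F) (X : I → I → I → I → F) (n u : I → I → F) (w : Word G) : F :=
  wordOp q X n u w (fun _ => 1) []

theorem eval_gen {e : ℤ} {v m m' w : Word G} (g : Gen e m m')
    (hw : Typed (v ++ m ++ w) [] []) :
    eval q X n u (v ++ m ++ w) = a ^ e * eval q X n u (v ++ m' ++ w) := by
  obtain ⟨t, h1, h3⟩ := typed_append.1 hw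
  obtain ⟨s, h1, h2⟩ := typed_append.1 h1
  simp only [eval, wordOp_append]
  rw [← wordOp_mul h1 rfl]
  exact wordOp_congr h1 rfl fun l hl => h.wordOp_gen g h2 hl _

omit h in
theorem eval_circle {v w : Word G} {s : List G} {i : ℕ} {c : G} (hv : Typed v [] s)
    (hc : Typed [cup i c, cap i] s s) :
    eval q X n u (v ++ [cup i c, cap i] ++ w) = cupOp u n * eval q X n u (v ++ w) := by
  simp only [eval, wordOp_append]
  rw [← wordOp_mul hv rfl]
  refine wordOp_congr hv rfl fun l hl => ?_
  subst hl
  obtain ⟨s, h1, h2⟩ := typed_cons.1 hc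
  have hi := h1.length
  simp [Letter.pos, Letter.inp, Letter.out] at hi
  obtain ⟨l₁, l₂, rfl, rfl⟩ : ∃ l₁ l₂, l = l₁ ++ l₂ ∧ i = l₁.length :=
    ⟨l.take i, l.drop i, by simp, by simp; omega⟩
  have := wordOp_shift (q := q) (X := X) (n := n) (u := u) [cup 0 c, cap 0] l₁ (wordOp q X n u w fun _ => 1) l₂
  simp [Letter.shift] at this
  rw [this]
  simp [wordOp, letterOp, lift, act, Letter.pos, capWeight, cupOp_cap]

omit h in
-- For different colours the two crossings have opposite signs and cancel. For equal colours this is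
-- how the negative crossing was defined.
theorem eval_skein {v w : Word G} {l r : List G} {c d : G} (hv : Typed v [] (l ++ c :: d :: r))
    (hw : Typed w (l ++ d :: c :: r) []) :
    eval q X n u (v ++ [cross l.length true] ++ w) + eval q X n u (v ++ [cross l.length false] ++ w) =
      if c = d then (q + q⁻¹) * (eval q X n u (v ++ w) + eval q X n u (v ++ [cap l.length, cup l.length c] ++ w))
      else 0 := by
  simp only [eval, wordOp_append]
  have key (f : List (G × I) → F) (m : List (G × I)) (hm : m.map Prod.fst = l ++ c :: d :: r) :
      wordOp q X n u [cross l.length true] f m + wordOp q X n u [cross l.length false] f m =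
      if c = d then (q + q⁻¹) * (f m + wordOp q X n u [cap l.length, cup l.length c] f m) else 0 := by
    obtain ⟨m, m', rfl, rfl, h'⟩ := List.map_eq_append_iff.1 hm
    obtain ⟨⟨c, x⟩, m', rfl, rfl, h''⟩ := List.map_eq_cons_iff.1 h'
    obtain ⟨⟨d, y⟩, m', rfl, rfl, rfl⟩ := List.map_eq_cons_iff.1 h''
    have sh (w : Word G) := wordOp_shift (q := q) (X := X) (n := n) (u := u) w m f ((c, x) :: (d, y) :: m')
    have h1 (b : Bool) := sh [cross 0 b]
    have h2 := sh [cap 0, cup 0 c]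
    simp [Letter.shift] at h1 h2
    simp only [List.length_map, h1, h2]
    by_cases hcd : c = d
    · subst hcd
      simp [wordOp, letterOp, lift, act, Letter.pos, crossAct, capWeight, signedOp]
    · simp [wordOp, letterOp, lift, act, Letter.pos, crossAct, hcd, colorSign_false]
  rw [← wordOp_add hv rfl, wordOp_congr hv rfl fun m hm => key _ m hm]
  split_ifs with hcd
  · rw [wordOp_mul hv rfl, wordOp_add hv rfl]
  · simpa using wordOp_mul (q := q) (X := X) (n := n) (u := u) hv rfl 0 (fun _ => 0)

end IsModel

end StateSum

end TiedLink

namespace TiedLink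

open Letter Word

/-! ### Colours in use, and sums over colourings of the classes -/

section Colors

variable {κ κ' : Type}

theorem uses_append {v w : Word κ} {c : κ} : Uses (v ++ w) c ↔ Uses v c ∨ Uses w c := by
  simp [Uses, exists_or]

theorem uses_cons {x : Letter κ} {w : Word κ} {c : κ} : Uses (x :: w) c ↔ (∃ i, cup i c = x) ∨ Uses w c := by
  simp [Uses, exists_or]

theorem not_uses_nil {c : κ} : ¬ Uses ([] : Word κ) c := by
  simp [Uses]

theorem uses_recolor {f : κ → κ'} {w : Word κ} {c : κ'} :
    Uses (Word.recolor f w) c ↔ ∃ d, Uses w d ∧ f d = c := by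
  induction w with
  | nil => simp [not_uses_nil]
  | cons x w ih =>
    rw [recolor_cons, uses_cons, ih]
    simp only [uses_cons, or_and_right, exists_or]
    refine or_congr ?_ Iff.rfl
    cases x <;> simp [Letter.recolor]
    exact eq_comm

theorem recolor_congr {f g : κ → κ'} {w : Word κ} (h : ∀ c, Uses w c → f c = g c) :
    Word.recolor f w = Word.recolor g w := by
  refine List.map_congr_left fun x hx => ?_
  cases x with
  | cup i c => simp [Letter.recolor, h c ⟨i, hx⟩]
  | cap i => rfl
  | cross i b => rfl

theorem Word.Typed.uses {w : Word κ} {s t : List κ} (h : Typed w s t) {c : κ} (hc : c ∈ t) : c ∈ s ∨ Uses w c := by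
  induction h with
  | nil => exact Or.inl hc
  | cons hx _ ih =>
    rcases ih hc with h | h
    · cases hx <;> simp [uses_cons] at h ⊢ <;> grind
    · exact Or.inr (uses_cons.2 (Or.inr h))

/-- A colour that disappears with a zigzag or a curl is carried by an incoming strand. In a closed
diagram that strand was created further down, so the set of colours in use does not change. -/
theorem Gen.uses {n : ℤ} {m m' : Word κ} (g : Gen n m m') {s t : List κ} (h : Typed m s t) (c : κ) :
    (Uses m' c → Uses m c) ∧ (Uses m c → c ∈ s ∨ Uses m' c) := by
  have shifted {w : Word κ} {i : ℕ} (hi : Typed (Word.shift i w) s t) (hl : i ≤ s.length)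
      (h0 : ∀ s t, Typed w s t → c ∈ s) : c ∈ s := by
    obtain ⟨l, s', t', rfl, rfl, rfl, h'⟩ := Typed.of_shift hi hl
    simp [h0 _ _ h']
  have len {x : Letter κ} {w : Word κ} (hi : Typed (x :: w) s t) : x.pos + x.inp ≤ s.length := by
    obtain ⟨r, h1, -⟩ := typed_cons.1 hi
    have := h1.length
    omega
  cases g with
  | exchange x y =>
    cases x <;> cases y <;> simp [uses_cons, not_uses_nil, Letter.shift] <;> tauto
  | zigzag_left i d =>
    refine ⟨fun h => absurd h not_uses_nil, fun hc => Or.inl ?_⟩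
    have h0 := len h
    simp only [Letter.pos, Letter.inp] at h0
    obtain rfl : c = d := by simpa [uses_cons, not_uses_nil] using hc
    refine shifted (w := [cup 1 c, cap 0]) (i := i)
      (by simpa only [Word.shift_cons, Word.shift_nil, Letter.shift, add_comm, add_zero] using h) (by omega) ?_
    rintro s t h
    simp at h
    grind
  | zigzag_right i d =>
    refine ⟨fun h => absurd h not_uses_nil, fun hc => Or.inl ?_⟩
    have h0 := len h
    simp only [Letter.pos, Letter.inp] at h0
    obtain rfl : c = d := by simpa [uses_cons, not_uses_nil] using hc
    refine shifted (w := [cup 0 c, cap 1]) (i := i)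
      (by simpa only [Word.shift_cons, Word.shift_nil, Letter.shift, add_comm, add_zero] using h) (by omega) ?_
    rintro s t h
    simp at h
    grind
  | curl i d b =>
    refine ⟨fun h => absurd h not_uses_nil, fun hc => Or.inl ?_⟩
    have h0 := len h
    simp only [Letter.pos, Letter.inp] at h0
    obtain rfl : c = d := by simpa [uses_cons, not_uses_nil] using hc
    refine shifted (w := [cup 1 c, cross 0 b, cap 1]) (i := i)
      (by simpa only [Word.shift_cons, Word.shift_nil, Letter.shift, add_comm, add_zero] using h) (by omega) ?_
    rintro s t h
    simp at h
    grind
  | _ => simp [uses_cons, not_uses_nil]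

variable [DecidableEq κ]

/-- The colours which occur in a word. -/
def colors : Word κ → Finset κ
  | [] => ∅
  | cup _ c :: w => insert c (colors w)
  | _ :: w => colors w

theorem mem_colors {w : Word κ} {c : κ} : c ∈ colors w ↔ Uses w c := by
  induction w with
  | nil => simp [colors, not_uses_nil]
  | cons x w ih => cases x <;> simp [colors, uses_cons, ih, eq_comm]

theorem colors_eq {v w : Word κ} (h : ∀ c, Uses v c ↔ Uses w c) : colors v = colors w := by
  ext c
  rw [mem_colors, mem_colors, h]

theorem colors_gen {n : ℤ} {v m m' w : Word κ} (g : Gen n m m') (h : Typed (v ++ m ++ w) [] []) :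
    colors (v ++ m ++ w) = colors (v ++ m' ++ w) := by
  obtain ⟨t, h1, h3⟩ := typed_append.1 h
  obtain ⟨s, h1, h2⟩ := typed_append.1 h1
  refine colors_eq fun c => ?_
  have h4 := g.uses h2 c
  have h5 := h1.uses (c := c)
  simp only [uses_append]
  simp at h5
  tauto

variable {m : ℕ} [NeZero m]

open Classical in
/-- The colourings by `Fin m` of a set of classes. -/
noncomputable def colorings (m : ℕ) [NeZero m] (S : Finset κ) : Finset (κ → Fin m) :=
  Finset.univ.image fun (g : S → Fin m) k => if h : k ∈ S then g ⟨k, h⟩ else 0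

theorem mem_colorings {S : Finset κ} {g : κ → Fin m} : g ∈ colorings m S ↔ ∀ k, k ∉ S → g k = 0 := by
  simp only [colorings, Finset.mem_image, Finset.mem_univ, true_and]
  constructor
  · rintro ⟨f, rfl⟩ k hk
    simp [hk]
  · intro h
    refine ⟨fun k => g k, ?_⟩
    funext k
    by_cases hk : k ∈ S
    · simp [hk]
    · simp [hk, h k hk]

variable {F : Type} [Field F]

/-- The new class can be coloured independently in `m` ways; this is the source of the factor `m` in
the value of an untied circle. -/
theorem sum_colorings_insert {S : Finset κ} {c : κ} (hc : c ∉ S) (φ : (κ → Fin m) → F)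
    (hφ : ∀ g x, φ (Function.update g c x) = φ g) :
    ∑ g ∈ colorings m (insert c S), φ g = m * ∑ g ∈ colorings m S, φ g := by
  have : ∑ g ∈ colorings m (insert c S), φ g = ∑ p ∈ colorings m S ×ˢ (Finset.univ : Finset (Fin m)), φ p.1 := by
    refine Finset.sum_nbij' (fun g => (Function.update g c 0, g c)) (fun p => Function.update p.1 c p.2) ?_ ?_ ?_ ?_ ?_
    · intro g hg
      rw [mem_colorings] at hg
      simp only [Finset.mem_product, Finset.mem_univ, and_true, mem_colorings]
      intro k hk
      by_cases hkc : k = c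
      · simp [hkc]
      · simp [hkc, hg k (by simp [hkc, hk])]
    · rintro ⟨g, x⟩ hg
      simp only [Finset.mem_product, Finset.mem_univ, and_true, mem_colorings] at hg
      rw [mem_colorings]
      intro k hk
      simp at hk
      simp [hk.1, hg k hk.2]
    · intro g _
      simp
    · rintro ⟨g, x⟩ hg
      simp only [Finset.mem_product, Finset.mem_univ, and_true, mem_colorings] at hg
      have : Function.update g c 0 = g := by rw [← hg c hc, Function.update_eq_self]
      simp [this]
    · intro g _
      simp [hφ]
  rw [this, Finset.sum_product]
  simp [Finset.mul_sum]

/-- Colourings that agree on `c` and `d` are the colourings of the merged partition. The value at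
the absorbed class `d` is reset to `0`, the default outside the set. -/
theorem sum_colorings_merge {S : Finset κ} {c d : κ} (hcd : c ≠ d) (hd : d ∈ S) (φ : (κ → Fin m) → F) :
    ∑ g ∈ colorings m S, (if g c = g d then φ g else 0) =
      ∑ g ∈ colorings m (S.erase d), φ (g ∘ mergeColor c d) := by
  rw [← Finset.sum_filter]
  have e (g : κ → Fin m) (h : g c = g d) : Function.update g d 0 ∘ mergeColor c d = g := by
    funext k
    by_cases hk : k = d
    · simp [mergeColor, hk, hcd, h]
    · simp [mergeColor, hk]
  refine Finset.sum_nbij' (fun g => Function.update g d 0) (fun g => g ∘ mergeColor c d) ?_ ?_ ?_ ?_ ?_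
  · intro g hg
    simp only [Finset.mem_filter, mem_colorings] at hg ⊢
    intro k hk
    by_cases hkd : k = d
    · simp [hkd]
    · simp [hkd, hg.1 k (by simpa [hkd] using hk)]
  · intro g hg
    simp only [Finset.mem_filter, mem_colorings] at hg ⊢
    refine ⟨fun k hk => ?_, by simp [mergeColor]⟩
    have hkd : k ≠ d := by rintro rfl; exact hk hd
    simp [mergeColor, hkd, hg k (by simp [hk])]
  · intro g hg
    exact e g (by simpa using (Finset.mem_filter.1 hg).2)
  · intro g hg
    rw [mem_colorings] at hg
    funext k
    by_cases hk : k = d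
    · simp [hk, hg d]
    · simp [mergeColor, hk]
  · intro g hg
    rw [e g (by simpa using (Finset.mem_filter.1 hg).2)]

end Colors

/-! ### The tied state sum solves the skein rules -/

section StateSum

variable {F I κ : Type} [Field F] [Fintype I] [DecidableEq κ] {m : ℕ} [NeZero m]

/-- The sum of the values of all colourings which are constant on the classes, normalized. -/
noncomputable def tiedSum (m : ℕ) [NeZero m] (q : F) (X : I → I → I → I → F) (n u : I → I → F) (w : Word κ) : F :=
  (m * cupOp u n)⁻¹ * ∑ g ∈ colorings m (colors w), IsModel.eval q X n u (Word.recolor g w)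

variable {q a : F} {X : I → I → I → I → F} {n u : I → I → F}

theorem IsModel.rules (h : IsModel q a X n u) (ha : a ≠ 0) (hz : q + q⁻¹ ≠ 0) (hm : (m * cupOp u n : F) ≠ 0) :
    Rules (Units.mk0 a ha) (Units.mk0 _ hz) (m * cupOp u n) (1 : F) (tiedSum (κ := κ) m q X n u) where
  gen := by
    intro e l l' v w g _ ht
    have hs (c : κ → Fin m) := h.eval_gen (v := Word.recolor c v) (m := Word.recolor c l) (w := Word.recolor c w)
      (e := e) (m' := Word.recolor c l') (g.recolor c) (by simpa using ht.recolor c)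
    simp only [tiedSum, colors_gen g ht, recolor_append, hs, ← Finset.mul_sum]
    rw [Units.smul_def]
    simp [mul_left_comm]
  circle := by
    intro v w i c hc _ ht ht'
    have h1 : colors (v ++ [cup i c, cap i] ++ w) = insert c (colors (v ++ w)) := by
      ext k
      simp [mem_colors, uses_append, uses_cons, eq_comm]
      tauto
    obtain ⟨s, hv, hw⟩ := typed_append.1 ht
    have h2 (g : κ → Fin m) := eval_circle (q := q) (X := X) (n := n) (u := u) (v := Word.recolor g v)
      (w := Word.recolor g w) (i := i) (c := g c) (s := s.map g) (hv.recolor g) (by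
        have h3 : Typed [cup i c, cap i] s s := by
          obtain ⟨t, h4, h5⟩ := typed_append.1 ht'
          obtain ⟨s', h6, h7⟩ := typed_append.1 h4
          obtain rfl := h6.unique hv
          obtain ⟨r, h8, h9⟩ := typed_cons.1 h7
          have h8' := h8.length
          simp [Letter.pos, Letter.inp, Letter.out] at h8'
          obtain ⟨l₁, l₂, rfl, rfl⟩ : ∃ l₁ l₂, s' = l₁ ++ l₂ ∧ i = l₁.length :=
            ⟨s'.take i, s'.drop i, by simp, by simp; omega⟩
          simpa [Letter.shift] using
            (show Typed [cup 0 c, cap 0] l₂ l₂ by simp).whisker_left l₁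
        exact h3.recolor g)
    have h3 := sum_colorings_insert (m := m) (F := F) (S := colors (v ++ w)) (c := c) (by rwa [mem_colors])
      (fun g => IsModel.eval q X n u (Word.recolor g (v ++ w))) (fun g x => by
        rw [recolor_congr (g := g)]
        intro k hk
        have : k ≠ c := by rintro rfl; exact hc hk
        simp [this])
    simp only [recolor_append] at h3
    simp only [tiedSum, h1, recolor_append, Word.recolor_cons, Word.recolor_nil, Letter.recolor, h2, ← Finset.mul_sum, h3]
    simp only [smul_eq_mul]
    ring
  skein := by
    intro v w l r c d hv hw
    have h1 (g : κ → Fin m) := eval_skein (q := q) (X := X) (n := n) (u := u) (v := Word.recolor g v)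
      (w := Word.recolor g w) (l := l.map g) (r := r.map g) (c := g c) (d := g d)
      (by simpa using hv.recolor g) (by simpa using hw.recolor g)
    have hc : Uses v c := by simpa using hv.uses (c := c) (by simp)
    have hd : Uses v d := by simpa using hv.uses (c := d) (by simp)
    have h2 (b : Bool) : colors (v ++ [cross l.length b] ++ w) = colors (v ++ w) :=
      colors_eq fun k => by simp [uses_append, uses_cons]
    have hμ : mergeColor c d c = c := by simp [mergeColor]
    -- This is where ties enter: the surviving terms have equal colours at the crossing, so they are
    -- summed over the colourings of both merged smoothings, which use the same colours.
    have key : ∑ g ∈ colorings m (colors (v ++ w)), (if g c = g d then (q + q⁻¹) *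
          (IsModel.eval q X n u (Word.recolor g v ++ Word.recolor g w) +
            IsModel.eval q X n u (Word.recolor g v ++ [cap l.length, cup l.length (g c)] ++ Word.recolor g w)) else 0) =
        (q + q⁻¹) * (∑ g ∈ colorings m (colors (Word.recolor (mergeColor c d) (v ++ w))),
          IsModel.eval q X n u (Word.recolor g (Word.recolor (mergeColor c d) (v ++ w))) +
          ∑ g ∈ colorings m (colors (Word.recolor (mergeColor c d) (v ++ [cap l.length, cup l.length c] ++ w))),
            IsModel.eval q X n u (Word.recolor g (Word.recolor (mergeColor c d) (v ++ [cap l.length, cup l.length c] ++ w)))) := by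
      have h4 : colors (Word.recolor (mergeColor c d) (v ++ [cap l.length, cup l.length c] ++ w)) =
          colors (Word.recolor (mergeColor c d) (v ++ w)) := by
        refine colors_eq fun k => ?_
        simp only [uses_recolor, uses_append, uses_cons, not_uses_nil]
        simp
        grind
      rw [h4, ← Finset.sum_add_distrib, Finset.mul_sum]
      by_cases hcd : c = d
      · subst hcd
        simp [mergeColor_self, Letter.recolor]
      · have h3 : colors (Word.recolor (mergeColor c d) (v ++ w)) = (colors (v ++ w)).erase d := by
          ext k
          rw [mem_colors, uses_recolor, Finset.mem_erase, mem_colors]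
          constructor
          · rintro ⟨j, hj, rfl⟩
            by_cases hjd : j = d
            · simp [mergeColor, hjd, hcd, uses_append, hc]
            · simp [mergeColor, hjd, hj]
          · rintro ⟨h1, h2⟩
            exact ⟨k, h2, by simp [mergeColor, h1]⟩
        rw [h3, sum_colorings_merge hcd (by simp [mem_colors, uses_append, hd])]
        refine Finset.sum_congr rfl fun g _ => ?_
        simp only [recolor_recolor, recolor_append, Word.recolor_cons, Word.recolor_nil, Letter.recolor, hμ,
          Function.comp_apply]
    simp only [tiedSum, h2, ← mul_add, ← Finset.sum_add_distrib]
    simp only [recolor_append, Word.recolor_cons, Word.recolor_nil, Letter.recolor, List.length_map] at h1 key ⊢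
    simp only [h1, key, Units.smul_def, Units.val_mk0, smul_eq_mul]
    ring
  unknot := by
    intro c
    have h1 : colors [cup 0 c, cap 0] = {c} := by simp [colors]
    have h2 (g : κ → Fin m) : IsModel.eval q X n u [cup 0 (g c), cap 0] = cupOp u n := by
      simpa [IsModel.eval, IsModel.wordOp] using IsModel.eval_circle (q := q) (X := X) (n := n) (u := u) (v := []) (w := []) (s := []) (i := 0) (c := g c)
        (Typed.nil _) (by simp)
    have h3 := sum_colorings_insert (m := m) (F := F) (S := ∅) (c := c) (by simp) (fun g => (1 : F)) (by simp)
    have h4 : colorings m (∅ : Finset κ) = {fun _ => 0} := by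
      ext g
      simp [mem_colorings, funext_iff]
    simp only [tiedSum, h1, Word.recolor_cons, Word.recolor_nil, Letter.recolor, h2, Finset.sum_const]
    simp [h4] at h3
    rw [nsmul_eq_mul, h3]
    exact inv_mul_cancel₀ hm

end StateSum

end TiedLink

namespace TiedLink

/-! ### Laurent polynomials determined by rational values -/

section Density

open LaurentPolynomial

theorem laurent_eval₂_eq_sum {R S : Type} [CommRing R] [CommRing S] (f : R →+* S) (x : Sˣ) (p : LaurentPolynomial R) :
    eval₂ f x p = p.coeff.sum fun n r => f r * (x ^ n : Sˣ) := by
  induction p using LaurentPolynomial.induction_on' with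
  | add p q hp hq =>
    rw [map_add, hp, hq, AddMonoidAlgebra.coeff_add, Finsupp.sum_add_index'] <;> simp [add_mul]
  | C_mul_T n r =>
    rw [eval₂_C_mul_T, ← single_eq_C_mul_T, AddMonoidAlgebra.coeff_single, Finsupp.sum_single_index]
    simp

/-- A Laurent polynomial with infinitely many roots vanishes. -/
theorem eq_zero_of_sum_zpow {S : Finset ℤ} {g : ℤ → ℚ} {x : ℕ → ℚˣ} (hx : Function.Injective x)
    (h : ∀ k, ∑ i ∈ S, g i * (x k ^ i : ℚˣ) = 0) {i : ℤ} (hi : i ∈ S) : g i = 0 := by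
  obtain ⟨N, hN⟩ : ∃ N : ℕ, ∀ i ∈ S, 0 ≤ i + N := by
    obtain ⟨b, hb⟩ := S.bddBelow
    refine ⟨b.natAbs, fun i hi => ?_⟩
    have : b ≤ i := hb hi
    omega
  -- Multiplication by the `N`th power of the variable removes the negative exponents.
  have hp : (∑ i ∈ S, Polynomial.monomial (i + N).toNat (g i)) = 0 := by
    refine Polynomial.eq_zero_of_infinite_isRoot _ ?_
    refine Set.infinite_of_injective_forall_mem (f := fun k => (x k : ℚ)) (fun j k e => hx (Units.ext e)) fun k => ?_
    have e : (∑ i ∈ S, Polynomial.monomial (i + N).toNat (g i)).eval (x k : ℚ) =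
        (x k : ℚ) ^ N * ∑ i ∈ S, g i * (x k ^ i : ℚˣ) := by
      rw [Polynomial.eval_finsetSum, Finset.mul_sum]
      refine Finset.sum_congr rfl fun i hi => ?_
      rw [Polynomial.eval_monomial, ← zpow_natCast, Int.toNat_of_nonneg (hN i hi), zpow_add₀ (x k).ne_zero, zpow_natCast]
      push_cast
      ring
    rw [Set.mem_ofPred_eq, Polynomial.IsRoot, e, h, mul_zero]
  have := congrArg (fun p => p.coeff (i + N).toNat) hp
  simp only [Polynomial.finsetSum_coeff, Polynomial.coeff_monomial, Polynomial.coeff_zero] at this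
  rw [Finset.sum_eq_single i] at this
  · simpa using this
  · intro j hj hji
    have := hN j hj
    have := hN i hi
    rw [if_neg]
    omega
  · exact fun h => absurd hi h

/-- Evaluation of a Laurent polynomial in two variables. -/
noncomputable def evalAZ (α ζ : ℚˣ) : RingAZ →+* ℚ := eval₂ (eval₂ (Int.castRingHom ℚ) α) ζ

/-- Evaluation in three variables. -/
noncomputable def evalAZX (α ζ : ℚˣ) (y : ℚ) : RingAZX →+* ℚ := Polynomial.eval₂RingHom (evalAZ α ζ) y

/-- The values of `a` may depend on that of `z`: for fixed `ζ j` infinitely many `α j k` kill each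
coefficient of a power of `a`, and these coefficients then vanish at infinitely many `ζ j`. -/
theorem eq_zero_of_evalAZ {α : ℕ → ℕ → ℚˣ} {ζ : ℕ → ℚˣ} (hα : ∀ j, Function.Injective (α j))
    (hζ : Function.Injective ζ) {p : RingAZ} (h : ∀ j k, evalAZ (α j k) (ζ j) p = 0) : p = 0 := by
  let I : Finset ℤ := p.coeff.support.biUnion fun n => (p.coeff n).coeff.support
  have key (j k : ℕ) : ∑ i ∈ I, (∑ n ∈ p.coeff.support, ((p.coeff n).coeff i : ℚ) * (ζ j ^ n : ℚˣ)) * (α j k ^ i : ℚˣ) = 0 := by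
    rw [← h j k, evalAZ, laurent_eval₂_eq_sum, Finsupp.sum]
    symm
    have hn (n : ℤ) (hn : n ∈ p.coeff.support) : eval₂ (Int.castRingHom ℚ) (α j k) (p.coeff n) =
        ∑ i ∈ I, ((p.coeff n).coeff i : ℚ) * (α j k ^ i : ℚˣ) := by
      rw [laurent_eval₂_eq_sum, Finsupp.sum_of_support_subset _ (s := I)
        (Finset.subset_biUnion_of_mem (fun n => (p.coeff n).coeff.support) hn) _ (by simp)]
      simp
    rw [Finset.sum_congr (g := fun n => (∑ i ∈ I, ((p.coeff n).coeff i : ℚ) * (α j k ^ i : ℚˣ)) * (ζ j ^ n : ℚˣ)) rfl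
      fun n h => by rw [hn n h]]
    simp only [Finset.sum_mul]
    rw [Finset.sum_comm]
    exact Finset.sum_congr rfl fun n _ => Finset.sum_congr rfl fun i _ => by ring
  have h2 (n i : ℤ) (hn : n ∈ p.coeff.support) (hi : i ∈ I) : ((p.coeff n).coeff i : ℚ) = 0 :=
    eq_zero_of_sum_zpow (g := fun n => ((p.coeff n).coeff i : ℚ)) hζ
      (fun j => eq_zero_of_sum_zpow (g := fun i => ∑ n ∈ p.coeff.support, ((p.coeff n).coeff i : ℚ) * (ζ j ^ n : ℚˣ)) (hα j) (key j) hi) hn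
  refine LaurentPolynomial.ext fun n => LaurentPolynomial.ext fun i => ?_
  by_cases hn : n ∈ p.coeff.support
  · by_cases hi : i ∈ I
    · simpa using h2 n i hn hi
    · have : i ∉ (p.coeff n).coeff.support := fun h => hi (Finset.mem_biUnion.2 ⟨n, hn, h⟩)
      simpa using this
  · have : p.coeff n = 0 := by simpa using hn
    simp [this]

/-- For fixed `j` and `k` the multiples of `δ j k` are infinitely many roots in the last variable,
provided that `δ j k ≠ 0`. The coefficients are then treated by `eq_zero_of_evalAZ`. -/
theorem eq_zero_of_evalAZX {α : ℕ → ℕ → ℚˣ} {ζ : ℕ → ℚˣ} {δ : ℕ → ℕ → ℚ} (hα : ∀ j, Function.Injective (α j))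
    (hζ : Function.Injective ζ) (hδ : ∀ j k, δ j k ≠ 0) {p : RingAZX}
    (h : ∀ j k m : ℕ, evalAZX (α j k) (ζ j) ((m + 1 : ℕ) * δ j k) p = 0) : p = 0 := by
  ext1 i
  refine eq_zero_of_evalAZ hα hζ fun j k => ?_
  have h0 : p.map (evalAZ (α j k) (ζ j)) = 0 := by
    refine Polynomial.eq_zero_of_infinite_isRoot _ ?_
    refine Set.infinite_of_injective_forall_mem (f := fun m : ℕ => ((m + 1 : ℕ) * δ j k : ℚ)) (fun m n e => ?_) fun m => ?_
    · simpa [hδ] using e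
    · simpa [Polynomial.IsRoot, Polynomial.eval_map, evalAZX] using h j k m
  have := congrArg (fun p => p.coeff i) h0
  simpa using this

end Density

/-! ### Rational solutions -/

section Existence

variable {κ : Type} [DecidableEq κ]

/-- There are enough rational solutions of the skein rules. -/
theorem exists_rules_rat : ∃ (α : ℕ → ℕ → ℚˣ) (ζ : ℕ → ℚˣ) (δ : ℕ → ℕ → ℚ) (L : ℕ → ℕ → ℕ → Word κ → ℚ),
    (∀ j, Function.Injective (α j)) ∧ Function.Injective ζ ∧ (∀ j k, δ j k ≠ 0) ∧
    ∀ j k m, Rules (α j k) (ζ j) ((m + 1 : ℕ) * δ j k) (1 : ℚ) (L j k m) := by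
  -- With `Q j ≥ 2` the map `q ↦ q + q⁻¹` is injective on these values, and powers of `Q j ^ 2` are
  -- distinct.
  let Q (j : ℕ) : ℚ := j + 2
  have hQ (j : ℕ) : 2 ≤ Q j := by simp [Q]
  have hQ0 (j : ℕ) : Q j ≠ 0 := by have := hQ j; positivity
  have hα0 (j k : ℕ) : Q j * (-Q j ^ 2) ^ (k + 1) ≠ 0 :=
    mul_ne_zero (hQ0 j) (pow_ne_zero _ (neg_ne_zero.2 (pow_ne_zero 2 (hQ0 j))))
  have hζ0 (j : ℕ) : Q j + (Q j)⁻¹ ≠ 0 := by have := hQ j; positivity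
  have hQ2 (j : ℕ) : Q j ^ 2 + 1 ≠ 0 := by positivity
  -- The exponent starts at `1`: for `0` the label set is empty and the loop value is `0`.
  choose I hI X n u hM using fun j k : ℕ => exists_isModel (hQ0 j) (hQ2 j) (k + 1)
  have habs (j k : ℕ) : |Q j * (-Q j ^ 2) ^ (k + 1)| = Q j * (Q j ^ 2) ^ (k + 1) := by
    have := hQ j
    rw [abs_mul, abs_pow, abs_neg, abs_of_nonneg (by positivity : 0 ≤ Q j ^ 2), abs_of_nonneg (by positivity : 0 ≤ Q j)]
  have hsq (j : ℕ) : 1 < Q j ^ 2 := by nlinarith [hQ j]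
  -- A vanishing loop value would mean `a + a⁻¹ = q + q⁻¹`, hence `a = q` or `a = q⁻¹`. Both
  -- contradict `|a| > q ≥ 2`.
  have hδ (j k : ℕ) : cupOp (u j k) (n j k) ≠ 0 := by
    intro h0
    have hl := (hM j k).loop
    rw [h0] at hl
    have h1 := habs j k
    have h4 := hα0 j k
    set a := Q j * (-Q j ^ 2) ^ (k + 1)
    have h2 : (a - Q j) * (a * Q j - 1) = 0 := by
      have := hQ0 j
      field_simp at hl
      linear_combination -hl
    have h3 : Q j < |a| := by
      rw [h1]
      exact lt_mul_of_one_lt_right (by linarith [hQ j]) (one_lt_pow₀ (hsq j) (Nat.succ_ne_zero k))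
    rcases mul_eq_zero.1 h2 with h2 | h2
    · rw [sub_eq_zero.1 h2, abs_of_nonneg (by linarith [hQ j])] at h3
      exact lt_irrefl _ h3
    · have h5 : |a * Q j| = 1 := by rw [sub_eq_zero.1 h2, abs_one]
      rw [abs_mul, abs_of_nonneg (by linarith [hQ j] : 0 ≤ Q j)] at h5
      nlinarith [hQ j]
  refine ⟨fun j k => Units.mk0 _ (hα0 j k), fun j => Units.mk0 _ (hζ0 j), fun j k => cupOp (u j k) (n j k),
    fun j k m => tiedSum (m + 1) (Q j) (X j k) (n j k) (u j k), fun j k k' e => ?_, fun j j' e => ?_, hδ,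
    fun j k m => (hM j k).rules _ _ (mul_ne_zero (by positivity) (hδ j k))⟩
  · have h1 := congrArg (fun x : ℚˣ => |(x : ℚ)|) e
    simp only [Units.val_mk0, habs] at h1
    have h2 := pow_right_injective₀ (by positivity) (hsq j).ne' (mul_left_cancel₀ (hQ0 j) h1)
    omega
  · have h1 := congrArg (fun x : ℚˣ => (x : ℚ)) e
    simp only [Units.val_mk0] at h1
    have := hQ0 j
    have := hQ0 j'
    have h2 : (Q j - Q j') * (Q j * Q j' - 1) = 0 := by
      field_simp at h1
      linear_combination h1
    rcases mul_eq_zero.1 h2 with h2 | h2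
    · simpa [Q] using sub_eq_zero.1 h2
    · nlinarith [hQ j, hQ j']

end Existence

end TiedLink

namespace TiedLink

open Letter Word

/-! ### Change of colours and coefficients, and uniqueness -/

section Transfer

variable {κ κ' : Type} [DecidableEq κ] [DecidableEq κ'] {B A : Type} [CommRing B] [AddCommGroup A] [Module B A]
  {a z : Bˣ} {y : B}

omit [DecidableEq κ] in
theorem ne_nil_of_typed_cons {u : Word κ} {l r : List κ} {c : κ} (h : Typed u [] (l ++ c :: r)) : u ≠ [] := by
  rintro rfl
  simp at h

omit [DecidableEq κ'] in
-- The smoothings fit only because the merge gives both strands the colour `c`.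
theorem skein_typed {u v : Word κ} {l r : List κ} {c d : κ} (hu : Typed u [] (l ++ c :: d :: r))
    (hv : Typed v (l ++ d :: c :: r) []) : Typed (Word.recolor (mergeColor c d) (u ++ v)) [] [] ∧
    Typed (Word.recolor (mergeColor c d) (u ++ [cap l.length, cup l.length c] ++ v)) [] [] := by
  have hc : mergeColor c d c = c := by simp [mergeColor]
  have hd : mergeColor c d d = c := by simp [mergeColor]
  have hu' := hu.recolor (mergeColor c d)
  have hv' := hv.recolor (mergeColor c d)
  simp only [List.map_append, List.map_cons, hc, hd, List.map_nil] at hu' hv'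
  have hcc : Typed [cap l.length, cup l.length c] (l.map (mergeColor c d) ++ c :: c :: r.map (mergeColor c d))
      (l.map (mergeColor c d) ++ c :: c :: r.map (mergeColor c d)) := by
    simpa [Letter.shift] using (show Typed [cap 0, cup 0 c] (c :: c :: r.map (mergeColor c d))
      (c :: c :: r.map (mergeColor c d)) by simp).whisker_left (l.map (mergeColor c d))
  exact ⟨by simpa using hu'.append hv', by simpa [Letter.recolor, hc] using (hu'.append hcc).append hv'⟩

/-- A nonempty closed classical diagram has a component. -/
theorem uses_of_closed {w : Word Unit} (hw : Typed w [] []) (h0 : w ≠ []) {c : Unit} : Uses w c := by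
  obtain ⟨x, w, rfl⟩ := List.exists_cons_of_ne_nil h0
  obtain ⟨r, h1, -⟩ := typed_cons.1 hw
  have := h1.length
  cases x with
  | cup i d => exact ⟨i, by simp⟩
  | cap i => simp [Letter.out, Letter.inp] at this
  | cross i b =>
    simp [Letter.out, Letter.inp, Letter.pos] at this
    simp [this.2] at this

/-- The values of recoloured words satisfy the rules. -/
theorem Rules.comp_recolor {e : A} {L : Word κ' → A} (hL : Rules a z y e L) {f : κ → κ'} (hf : Function.Injective f) :
    Rules a z y e fun w => L (Word.recolor f w) where
  gen u v g h0 ht := by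
    have := hL.gen (Word.recolor f u) (Word.recolor f v) (g.recolor f) (by simpa using recolor_ne_nil f h0)
      (by simpa using ht.recolor f)
    simpa using this
  circle u v i c hc h0 ht ht' := by
    have := hL.circle (Word.recolor f u) (Word.recolor f v) i (f c) (by
      rw [← recolor_append, uses_recolor]
      rintro ⟨d, hd, he⟩
      exact hc (hf he ▸ hd)) (by simpa using recolor_ne_nil f h0) (by simpa using ht.recolor f)
      (by simpa [Letter.recolor] using ht'.recolor f)
    simpa [Letter.recolor] using this
  skein u v l r c d hu hv := by
    have h1 := hL.skein (Word.recolor f u) (Word.recolor f v) (l.map f) (r.map f) (f c) (f d)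
      (by simpa using hu.recolor f) (by simpa using hv.recolor f)
    have h2 : mergeColor (f c) (f d) ∘ f = f ∘ mergeColor c d := by
      funext k
      by_cases hk : k = d <;> simp [mergeColor, hk, hf.eq_iff]
    have h3 := congrFun h2 c
    simp only [Function.comp_apply] at h3
    simpa [Letter.recolor, recolor_recolor, h2, h3] using h1
  unknot c := hL.unknot (f c)

theorem Rules.map {B' : Type} [CommRing B'] {L : Word κ → B} (hL : Rules a z y (1 : B) L) (φ : B →+* B') :
    Rules (Units.map φ.toMonoidHom a) (Units.map φ.toMonoidHom z) (φ y) (1 : B') fun w => φ (L w) where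
  gen u v g h0 ht := by
    rw [hL.gen u v g h0 ht, ← map_zpow]
    exact map_mul φ _ _
  circle u v i c hc h0 ht ht' := by
    rw [hL.circle u v i c hc h0 ht ht']
    exact map_mul φ _ _
  skein u v l r c d hu hv := by
    have := congrArg φ (hL.skein u v l r c d hu hv)
    simp only [Units.smul_def, smul_eq_mul, map_add, map_mul] at this ⊢
    exact this
  unknot c := by rw [hL.unknot, map_one]

/-- The rules determine the values of all diagrams. -/
theorem Rules.unique {L L' : Word κ → B} (hL : Rules a z y (1 : B) L) (hL' : Rules a z y (1 : B) L') {w : Word κ}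
    (hw : Typed w [] []) (h0 : w ≠ []) : L w = L' w := by
  -- The pair is itself a solution with values in the module `B × B`, so one and the same scalar
  -- computes both components.
  have h : Rules a z y ((1 : B), (1 : B)) fun w => (L w, L' w) := {
    gen := fun u v g h0 ht => Prod.ext (hL.gen u v g h0 ht) (hL'.gen u v g h0 ht)
    circle := fun u v i c hc h0 ht ht' => Prod.ext (hL.circle u v i c hc h0 ht ht') (hL'.circle u v i c hc h0 ht ht')
    skein := fun u v l r c d hu hv => Prod.ext (hL.skein u v l r c d hu hv) (hL'.skein u v l r c d hu hv)
    unknot := fun c => Prod.ext (hL.unknot c) (hL'.unknot c) }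
  obtain ⟨β, hβ⟩ := h.exists_smul hw h0
  have h1 := congrArg Prod.fst hβ
  have h2 := congrArg Prod.snd hβ
  simp only [Prod.smul_mk] at h1 h2
  rw [h1, h2]

end Transfer

/-! ### A solution over the polynomial ring -/

section Existence

/-- The unit `a`. -/
noncomputable def aUnit : RingAZˣ where
  val := aPow 1
  inv := aPow (-1)
  val_inv := by
    rw [aPow, aPow, ← map_mul, ← LaurentPolynomial.T_add]
    exact map_one _
  inv_val := by
    rw [aPow, aPow, ← map_mul, ← LaurentPolynomial.T_add]
    exact map_one _

/-- The unit `z`. -/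
noncomputable def zUnit : RingAZˣ where
  val := zVar
  inv := LaurentPolynomial.T (-1)
  val_inv := by
    rw [zVar, ← LaurentPolynomial.T_add]
    exact LaurentPolynomial.T_zero
  inv_val := by
    rw [zVar, ← LaurentPolynomial.T_add]
    exact LaurentPolynomial.T_zero

/-- The inclusion of the units of `ℤ[a^±1, z^±1]` into those of `ℤ[a^±1, z^±1, x⁻¹]`. -/
noncomputable def unitC : RingAZˣ →* RingAZXˣ := Units.map (Polynomial.C : RingAZ →+* RingAZX).toMonoidHom

theorem evalAZX_aUnit (α ζ : ℚˣ) (y : ℚ) : Units.map (evalAZX α ζ y).toMonoidHom (unitC aUnit) = α := by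
  ext
  simp [evalAZX, evalAZ, aUnit, unitC, aPow, LaurentPolynomial.eval₂_C, LaurentPolynomial.eval₂_T]

theorem evalAZX_zUnit (α ζ : ℚˣ) (y : ℚ) : Units.map (evalAZX α ζ y).toMonoidHom (unitC zUnit) = ζ := by
  ext
  simp [evalAZX, evalAZ, zUnit, unitC, zVar, LaurentPolynomial.eval₂_T]

/-- All rational solutions together form one solution in a product of copies of `ℚ`, viewed as a
module over the ring through the injective map `φ`. The reduction theorem shows that its values lie
in the image of `φ`; the rules descend by injectivity. -/
theorem exists_rules (κ : Type) [DecidableEq κ] :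
    ∃ L : Word κ → RingAZX, Rules (unitC aUnit) (unitC zUnit) xInv (1 : RingAZX) L := by
  obtain ⟨α, ζ, δ, L, hα, hζ, hδ, hL⟩ := exists_rules_rat (κ := κ)
  let φ : RingAZX →+* (ℕ × ℕ × ℕ → ℚ) :=
    RingHom.pi fun i => evalAZX (α i.1 i.2.1) (ζ i.1) ((i.2.2 + 1 : ℕ) * δ i.1 i.2.1)
  have hφ : Function.Injective φ := fun p p' hp =>
    sub_eq_zero.1 (eq_zero_of_evalAZX hα hζ hδ fun j k m => by
      rw [map_sub, sub_eq_zero]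
      exact congrFun hp (j, k, m))
  let : Module RingAZX (ℕ × ℕ × ℕ → ℚ) := Module.compHom _ φ
  have smul (b : RingAZX) (f : ℕ × ℕ × ℕ → ℚ) : b • f = φ b * f := rfl
  have ha (n : ℤ) (i : ℕ × ℕ × ℕ) : φ (unitC aUnit ^ n : RingAZXˣ) i = (α i.1 i.2.1 ^ n : ℚˣ) := by
    rw [← evalAZX_aUnit (α i.1 i.2.1) (ζ i.1) ((i.2.2 + 1 : ℕ) * δ i.1 i.2.1)]
    exact congrArg Units.val (map_zpow (Units.map (evalAZX (α i.1 i.2.1) (ζ i.1)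
      ((i.2.2 + 1 : ℕ) * δ i.1 i.2.1)).toMonoidHom) (unitC aUnit) n)
  have hz (i : ℕ × ℕ × ℕ) : φ (unitC zUnit : RingAZXˣ) i = (ζ i.1 : ℚˣ) := by
    rw [← evalAZX_zUnit (α i.1 i.2.1) (ζ i.1) ((i.2.2 + 1 : ℕ) * δ i.1 i.2.1)]
    rfl
  have hy (i : ℕ × ℕ × ℕ) : φ xInv i = (i.2.2 + 1 : ℕ) * δ i.1 i.2.1 := by
    change evalAZX _ _ _ xInv = _
    simp [evalAZX, xInv]
  have hR : Rules (unitC aUnit) (unitC zUnit) xInv (1 : ℕ × ℕ × ℕ → ℚ) fun w i => L i.1 i.2.1 i.2.2 w := {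
    gen := fun u v g h0 ht => by
      funext i
      rw [Units.smul_def, smul, Pi.mul_apply, ha]
      exact (hL _ _ _).gen u v g h0 ht
    circle := fun u v i c hc h0 ht ht' => by
      funext i
      rw [smul, Pi.mul_apply, hy]
      exact (hL _ _ _).circle u v _ c hc h0 ht ht'
    skein := fun u v l r c d hu hv => by
      funext i
      rw [Units.smul_def, smul, Pi.mul_apply, hz]
      exact (hL _ _ _).skein u v l r c d hu hv
    unknot := fun c => by
      funext i
      exact (hL _ _ _).unknot c }
  -- The unknot has value `1` in every component, so the scalar given by `exists_smul` is a preimage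
  -- of the value.
  have hβ (w : Word κ) : ∃ β : RingAZX, Typed w [] [] → w ≠ [] → φ β = fun i => L i.1 i.2.1 i.2.2 w := by
    by_cases h : Typed w [] [] ∧ w ≠ []
    · obtain ⟨β, hβ⟩ := hR.exists_smul h.1 h.2
      refine ⟨β, fun _ _ => ?_⟩
      rw [hβ, smul, mul_one]
    · exact ⟨0, fun h1 h2 => absurd ⟨h1, h2⟩ h⟩
  choose K hK using hβ
  refine ⟨K, ?_, ?_, ?_, ?_⟩
  · intro n m m' u v g h0 ht
    have ht' : Typed (u ++ m' ++ v) [] [] := by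
      obtain ⟨t, h1, h3⟩ := typed_append.1 ht
      obtain ⟨s, h1, h2⟩ := typed_append.1 h1
      exact (h1.append (g.typed h2)).append h3
    have hm : u ++ m ++ v ≠ [] := by
      cases g <;> simp
    apply hφ
    rw [hK _ ht hm, Units.smul_def, smul_eq_mul, map_mul, hK _ ht' h0, ← smul]
    exact hR.gen u v g h0 ht
  · intro u v i c hc h0 ht ht'
    apply hφ
    rw [hK _ ht' (by simp), smul_eq_mul, map_mul, hK _ ht h0, ← smul]
    exact hR.circle u v i c hc h0 ht ht'
  · intro u v l r c d hu hv
    have hu0 := ne_nil_of_typed_cons hu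
    obtain ⟨h1, h2⟩ := skein_typed hu hv
    have hcr (b : Bool) := hK (u ++ [cross l.length b] ++ v)
      ((hu.append (typed_singleton.2 (Acts.cross l r c d b))).append hv) (by simp)
    apply hφ
    rw [map_add, hcr, hcr, Units.smul_def, smul_eq_mul, map_mul, map_add,
      hK _ h1 (recolor_ne_nil _ (by simp [hu0])), hK _ h2 (recolor_ne_nil _ (by simp)), ← smul]
    exact hR.skein u v l r c d hu hv
  · intro c
    apply hφ
    rw [hK _ (by simp) (by simp), map_one]
    exact hR.unknot c

end Existence

/-! ### Reidemeister moves and curls as tangle isotopies -/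

section Diagrams

variable {κ : Type} [DecidableEq κ] {B : Type} [CommRing B] {a z : Bˣ} {y : B}

omit [DecidableEq κ] in
/-- It suffices to move the leftmost strands. -/
theorem Iso.of_shift {n : ℤ} {m m' : Word κ} {i : ℕ} {s t : List κ} (hm : Typed (Word.shift i m) s t)
    (hi : i ≤ s.length) (h : ∀ s t, Typed m s t → Iso n s t m m') :
    Iso n s t (Word.shift i m) (Word.shift i m') := by
  obtain ⟨l, s', t', rfl, rfl, rfl, h'⟩ := Typed.of_shift hm hi
  exact (h _ _ h').whisker_left l

omit [DecidableEq κ] in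
theorem iso_of_reidemeister {m m' : Word κ} (h : Reidemeister m m') {s t : List κ} (hm : Typed m s t) :
    Iso 0 s t m m' := by
  cases h with
  | two i b => exact Iso.step (Gen.two i b) hm
  | three i b₁ b₂ b₃ hb =>
    have hi : i ≤ s.length := by
      obtain ⟨r, h1, -⟩ := typed_cons.1 hm
      exact h1.pos_le
    have := Iso.of_shift (n := 0) (m := [cross 0 b₁, cross 1 b₂, cross 0 b₃])
      (m' := [cross 1 b₃, cross 0 b₂, cross 1 b₁]) (i := i) (s := s) (t := t)
      (by simpa [Letter.shift, add_comm 1, -acts_cross_succ] using hm) hi (by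
        rintro s t h
        rcases s with _ | ⟨c, _ | ⟨d, _ | ⟨e, r⟩⟩⟩ <;> simp at h
        subst h
        exact (Iso.braid c d e b₁ b₂ b₃ hb).whisker_right r)
    simpa [Letter.shift, add_comm 1] using this

omit [DecidableEq κ] in
theorem iso_of_curl {b : Bool} {m : Word κ} (h : Curl b m) {s t : List κ} (hm : Typed m s t) :
    Iso (Iso.sgn b) s t m [] := by
  cases h with
  | right i c => exact Iso.step (Gen.curl i c b) hm
  | left i c =>
    have hi : i ≤ s.length := by
      obtain ⟨r, h1, -⟩ := typed_cons.1 hm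
      exact h1.pos_le
    have := Iso.of_shift (n := Iso.sgn b) (m := [cup 0 c, cross 1 b, cap 0])
      (m' := []) (i := i) (s := s) (t := t)
      (by simpa [Letter.shift, add_comm 1, -acts_cross_succ] using hm) hi (by
        rintro s t h
        rcases s with _ | ⟨d, r⟩ <;> simp at h
        obtain ⟨rfl, rfl⟩ : d = c ∧ t = d :: r := by grind
        exact (Iso.curl_left d b).whisker_right r)
    simpa [Letter.shift, add_comm 1] using this

end Diagrams

end TiedLink

namespace TiedLink

open Letter Word

/-! ### From solutions on words to functions of diagrams and back -/

section Invariance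

variable {κ : Type} {B : Type} [CommRing B] {a z : Bˣ} {y : B}

theorem cross_prefix_ne_nil {u w : Word κ} {i : ℕ} {b : Bool} {t : List κ} (h : Typed (u ++ cross i b :: w) [] t) : u ≠ [] := by
  rintro rfl
  obtain ⟨r, h1, -⟩ := typed_cons.1 h
  have := h1.length
  simp [Letter.pos, Letter.inp, Letter.out] at this
  simp [this.2] at this

theorem cup_prefix_ne_nil {u w : Word κ} {i : ℕ} {c : κ} {t : List κ} (h : Typed (u ++ cup (i + 1) c :: w) [] t) : u ≠ [] := by
  rintro rfl
  obtain ⟨r, h1, -⟩ := typed_cons.1 h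
  simp at h1

variable [DecidableEq κ]

namespace Rules

variable {L : Word κ → B} (hL : Rules a z y (1 : B) L)
include hL

theorem gen₀ {u v m m' : Word κ} (g : Gen 0 m m') (h0 : u ++ m' ++ v ≠ []) (ht : Typed (u ++ m ++ v) [] []) :
    L (u ++ m ++ v) = L (u ++ m' ++ v) := by
  simpa using hL.gen u v g h0 ht

theorem planar {u v m m' : Word κ} (h : PlanarMove m m') (ht : Typed (u ++ m ++ v) [] []) (h0 : u ++ m' ++ v ≠ []) :
    L (u ++ m ++ v) = L (u ++ m' ++ v) := by
  cases h with
  | exchange x y hxy => exact hL.gen₀ (Gen.exchange x y hxy) h0 ht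
  | zigzag_left i c => exact hL.gen₀ (Gen.zigzag_left i c) h0 ht
  | zigzag_right i c => exact hL.gen₀ (Gen.zigzag_right i c) h0 ht
  | cap_slide i b => exact hL.gen₀ (Gen.cap_slide i b) h0 ht
  | cup_slide i c b =>
    have hu : u ≠ [] := cup_prefix_ne_nil (by simpa using ht)
    obtain ⟨t, h1, h3⟩ := typed_append.1 ht
    obtain ⟨s, h1, h2⟩ := typed_append.1 h1
    have hi : i ≤ s.length := by
      obtain ⟨r, h4, -⟩ := typed_cons.1 h2
      exact (Nat.le_succ i).trans h4.pos_le
    have := Iso.of_shift (n := 0) (m := [cup 1 c, cross 0 b]) (m' := [cup 0 c, cross 1 !b]) (i := i) (s := s) (t := t)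
      (by simpa [Letter.shift, add_comm 1, -acts_cup_succ] using h2) hi (by
        rintro s t h
        rcases s with _ | ⟨d, r⟩ <;> simp at h
        subst h
        exact (Iso.cup_slide d c b).whisker_right r)
    have := hL.iso₀ this h1 h3 (by simp [hu])
    simpa [Letter.shift, add_comm 1] using this

/-- A kink is added at the minimum, the closing strand is pushed over the tangle to its other side,
and the crossing ends up as a kink at the maximum. Both kinks contribute the same power of `a`,
which cancels. -/
theorem sphere {w : Word κ} {c : κ} (h : Typed w [c] [c]) :
    L ([cup 0 c] ++ w ++ [cap 0]) = L ([cup 0 c] ++ Word.shift 1 w ++ [cap 0]) := by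
  have hw := h.whisker_right [c]
  have hw' := h.whisker_left [c]
  have h1 := hL.iso (Iso.kink_cup c false) (u := []) (v := w ++ [cap 0]) (Typed.nil _)
    (hw.append (by simp)) (by simp)
  have h2 := hL.iso₀ (Iso.over_word c h) (u := [cup 0 c]) (v := [cap 0]) (by simp) (by simp) (by simp)
  have h3 := hL.iso (Iso.kink_cap c false) (u := [cup 0 c] ++ Word.shift 1 w) (v := [])
    (Typed.append (by simp) hw') (Typed.nil _) (by simp)
  simp [overpass] at h1 h2 h3
  rw [h2, h3] at h1
  simpa using (smul_left_cancel _ h1).symm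

/-- The recoloured function satisfies the same rules, so uniqueness identifies it with the original
one. -/
theorem recolor_perm (π : Equiv.Perm κ) {w : Word κ} (hw : Typed w [] []) (h0 : w ≠ []) :
    L w = L (Word.recolor π w) :=
  hL.unique (hL.comp_recolor π.injective) hw h0

theorem isotopyStep {w w' : Word κ} (h : IsotopyStep w w') (hw : Typed w [] []) (h0 : w ≠ []) (h0' : w' ≠ []) :
    L w = L w' := by
  cases h with
  | planar u v h => exact hL.planar h hw h0'
  | sphere T c h => exact hL.sphere h
  | rename w π => exact hL.recolor_perm π hw h0

theorem reidemeister {u v m m' : Word κ} (h : Reidemeister m m') (ht : Typed (u ++ m ++ v) [] []) (h0 : u ++ m' ++ v ≠ []) :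
    L (u ++ m ++ v) = L (u ++ m' ++ v) := by
  have hu : u ≠ [] := by
    cases h with
    | two i b => exact cross_prefix_ne_nil (by simpa using ht)
    | three i b₁ b₂ b₃ => exact cross_prefix_ne_nil (by simpa using ht)
  obtain ⟨t, h1, h3⟩ := typed_append.1 ht
  obtain ⟨s, h1, h2⟩ := typed_append.1 h1
  exact hL.iso₀ (iso_of_reidemeister h h2) h1 h3 (by simp [hu])

theorem curl {u v m : Word κ} {b : Bool} (h : Curl b m) (ht : Typed (u ++ m ++ v) [] []) (h0 : u ++ v ≠ []) :
    L (u ++ m ++ v) = a ^ Iso.sgn b • L (u ++ v) := by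
  obtain ⟨t, h1, h3⟩ := typed_append.1 ht
  obtain ⟨s, h1, h2⟩ := typed_append.1 h1
  simpa using hL.iso (iso_of_curl h h2) h1 h3 h0

omit hL in
/-- The function of diagrams which is defined by a solution of the rules. -/
def lift (hL : Rules a z y (1 : B) L) : Diagram κ → B :=
  Quot.lift (fun D => L D.word) fun D D' h => hL.isotopyStep h D.closed D.nonempty D'.nonempty

theorem lift_diagram (D : MorseDiagram κ) : hL.lift D.diagram = L D.word := rfl

end Rules

section Scalars

variable (x : RingAZ) (p : RingAZX)

theorem aUnit_smul : aUnit ^ Iso.sgn true • x = aPow 1 * x := by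
  rw [show Iso.sgn true = 1 from rfl, zpow_one, Units.smul_def, smul_eq_mul]
  rfl

theorem aUnit_inv_smul : aUnit ^ Iso.sgn false • x = aPow (-1) * x := by
  rw [show Iso.sgn false = -1 from rfl, zpow_neg_one, Units.smul_def, smul_eq_mul]
  rfl

theorem zUnit_smul : zUnit • x = zVar * x := by
  rw [Units.smul_def, smul_eq_mul]
  rfl

theorem unitC_aUnit_smul : unitC aUnit ^ Iso.sgn true • p = Polynomial.C (aPow 1) * p := by
  rw [show Iso.sgn true = 1 from rfl, zpow_one, Units.smul_def, smul_eq_mul]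
  rfl

theorem unitC_aUnit_inv_smul : unitC aUnit ^ Iso.sgn false • p = Polynomial.C (aPow (-1)) * p := by
  rw [show Iso.sgn false = -1 from rfl, zpow_neg_one, Units.smul_def, smul_eq_mul, ← map_inv]
  rfl

theorem unitC_zUnit_smul : unitC zUnit • p = Polynomial.C zVar * p := by
  rw [Units.smul_def, smul_eq_mul]
  rfl

end Scalars

theorem Rules.isTiedKauffman {L : Word ℕ → RingAZX} (hL : Rules (unitC aUnit) (unitC zUnit) xInv (1 : RingAZX) L) :
    IsTiedKauffman hL.lift where
  unknot D c h := by rw [hL.lift_diagram, h, hL.unknot]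
  circle D D' u v i c hc h h' := by
    have := D.closed
    have h1 := D.nonempty
    have := D'.closed
    simp only [hL.lift_diagram, h, h'] at *
    exact hL.circle u v i c hc ‹_› ‹_› ‹_›
  reidemeister D D' u v m m' hm h h' := by
    have h1 := D.closed
    have h2 := D'.nonempty
    simp only [hL.lift_diagram, h, h'] at *
    exact hL.reidemeister hm h1 h2
  curl_pos D D' u v m hm h h' := by
    have h1 := D.closed
    have h2 := D'.nonempty
    simp only [hL.lift_diagram, h, h'] at *
    rw [hL.curl hm h1 h2, unitC_aUnit_smul]
  curl_neg D D' u v m hm h h' := by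
    have h1 := D.closed
    have h2 := D'.nonempty
    simp only [hL.lift_diagram, h, h'] at *
    rw [hL.curl hm h1 h2, unitC_aUnit_inv_smul]
  skein Dp Dm De Df u v l r c d hu hv hp hm he hf := by
    simp only [hL.lift_diagram, hp, hm, he, hf]
    rw [← unitC_zUnit_smul]
    exact hL.skein u v l r c d hu hv

theorem recolor_unit (f : Unit → Unit) (w : Word Unit) : Word.recolor f w = w := by
  rw [show f = id from rfl, recolor_id]

theorem Rules.isKauffman {K : Word Unit → RingAZ} {y : RingAZ} (hK : Rules aUnit zUnit y (1 : RingAZ) K) :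
    IsKauffman hK.lift where
  unknot D h := by rw [hK.lift_diagram, h, hK.unknot]
  reidemeister D D' u v m m' hm h h' := by
    have h1 := D.closed
    have h2 := D'.nonempty
    simp only [hK.lift_diagram, h, h'] at *
    exact hK.reidemeister hm h1 h2
  curl_pos D D' u v m hm h h' := by
    have h1 := D.closed
    have h2 := D'.nonempty
    simp only [hK.lift_diagram, h, h'] at *
    rw [hK.curl hm h1 h2, aUnit_smul]
  curl_neg D D' u v m hm h h' := by
    have h1 := D.closed
    have h2 := D'.nonempty
    simp only [hK.lift_diagram, h, h'] at *
    rw [hK.curl hm h1 h2, aUnit_inv_smul]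
  skein Dp Dm Do Di u v i hp hm ho hi := by
    have h1 := Dp.closed
    simp only [hK.lift_diagram, hp, hm, ho, hi] at *
    obtain ⟨t, h1, h3⟩ := typed_append.1 h1
    obtain ⟨s, h4, h2⟩ := typed_append.1 h1
    have h2 := typed_singleton.1 h2
    cases h2 with
    | cross l r c d b =>
      have := hK.skein u v l r c d h4 h3
      rw [recolor_unit, recolor_unit, zUnit_smul] at this
      exact this

/-- The values of a function of diagrams on words. -/
noncomputable def wordValue (V : Diagram κ → B) (w : Word κ) : B :=
  open Classical in if h : Typed w [] [] ∧ w ≠ [] then V (MorseDiagram.diagram ⟨w, h.2, h.1⟩) else 0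

omit [DecidableEq κ] in
theorem wordValue_eq (V : Diagram κ → B) {w : Word κ} (h0 : w ≠ []) (hw : Typed w [] []) :
    wordValue V w = V (MorseDiagram.diagram ⟨w, h0, hw⟩) := dif_pos ⟨hw, h0⟩

omit [DecidableEq κ] in
-- Planar generators are already equalities in the quotient; the rules of `V` are needed only for
-- the generators `two`, `three` and `curl`.
theorem wordValue_gen {V : Diagram κ → B}
    (hr : ∀ (D D' : MorseDiagram κ) (u v m m' : Word κ), Reidemeister m m' →
      D.word = u ++ m ++ v → D'.word = u ++ m' ++ v → V D.diagram = V D'.diagram)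
    (hc : ∀ (b : Bool) (D D' : MorseDiagram κ) (u v m : Word κ), Curl b m →
      D.word = u ++ m ++ v → D'.word = u ++ v → V D.diagram = a ^ Iso.sgn b • V D'.diagram)
    {n : ℤ} {m m' : Word κ} (u v : Word κ) (g : Gen n m m') (h0' : u ++ m' ++ v ≠ [])
    (hw : Typed (u ++ m ++ v) [] []) :
    wordValue V (u ++ m ++ v) = (a ^ n) • wordValue V (u ++ m' ++ v) := by
  have hw' : Typed (u ++ m' ++ v) [] [] := by
    obtain ⟨t, h1, h3⟩ := typed_append.1 hw
    obtain ⟨s, h1, h2⟩ := typed_append.1 h1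
    exact (h1.append (g.typed h2)).append h3
  have h0 : u ++ m ++ v ≠ [] := by cases g <;> simp
  rw [wordValue_eq V h0 hw, wordValue_eq V h0' hw']
  have planar (h : PlanarMove m m') : V (MorseDiagram.diagram ⟨_, h0, hw⟩) = (a ^ (0 : ℤ)) • V (MorseDiagram.diagram ⟨_, h0', hw'⟩) := by
    rw [zpow_zero, one_smul]
    exact congrArg V (Quot.sound (IsotopyStep.planar u v h))
  have reid (h : Reidemeister m m') : V (MorseDiagram.diagram ⟨_, h0, hw⟩) = (a ^ (0 : ℤ)) • V (MorseDiagram.diagram ⟨_, h0', hw'⟩) := by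
    rw [zpow_zero, one_smul]
    exact hr _ _ u v m m' h rfl rfl
  cases g with
  | exchange x y hxy => exact planar (PlanarMove.exchange x y hxy)
  | zigzag_left i c => exact planar (PlanarMove.zigzag_left i c)
  | zigzag_right i c => exact planar (PlanarMove.zigzag_right i c)
  | cap_slide i b => exact planar (PlanarMove.cap_slide i b)
  | two i b => exact reid (Reidemeister.two i b)
  | three i => exact reid (Reidemeister.three i true true true (Or.inl rfl))
  | curl i c b => exact hc b _ _ u v _ (Curl.right i c) rfl (by simp)

theorem IsTiedKauffman.rules {V : TiedDiagram → RingAZX} (h : IsTiedKauffman V) :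
    Rules (unitC aUnit) (unitC zUnit) xInv (1 : RingAZX) (wordValue V) where
  gen := wordValue_gen h.reidemeister fun b => by
    cases b
    · simpa only [unitC_aUnit_inv_smul] using h.curl_neg
    · simpa only [unitC_aUnit_smul] using h.curl_pos
  circle u v i c hc h0 ht ht' := by
    rw [wordValue_eq V (by simp) ht', wordValue_eq V h0 ht]
    exact h.circle _ _ u v i c hc rfl rfl
  skein u v l r c d hu hv := by
    have hu0 := ne_nil_of_typed_cons hu
    have hsm := fun b => ((hu.append (typed_singleton.2 (Acts.cross l r c d b))).append hv)
    obtain ⟨h1, h2⟩ := skein_typed hu hv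
    rw [wordValue_eq V (by simp) (hsm true), wordValue_eq V (by simp) (hsm false),
      wordValue_eq V (recolor_ne_nil _ (by simp [hu0])) h1, wordValue_eq V (recolor_ne_nil _ (by simp)) h2, unitC_zUnit_smul]
    exact h.skein _ _ _ _ u v l r c d hu hv rfl rfl rfl rfl
  unknot c := by
    rw [wordValue_eq V (by simp) (by simp)]
    exact h.unknot _ c rfl

/-- A nonempty closed word uses the only colour, so there is never an untied circle and `y` is
arbitrary. -/
theorem IsKauffman.rules {V : ClassicalDiagram → RingAZ} (h : IsKauffman V) (y : RingAZ) :
    Rules aUnit zUnit y (1 : RingAZ) (wordValue V) where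
  gen := wordValue_gen h.reidemeister fun b => by
    cases b
    · simpa only [aUnit_inv_smul] using h.curl_neg
    · simpa only [aUnit_smul] using h.curl_pos
  circle u v i c hc h0 ht _ := absurd (uses_of_closed ht h0) hc
  skein u v l r c d hu hv := by
    have hu0 := ne_nil_of_typed_cons hu
    have hsm := fun b => ((hu.append (typed_singleton.2 (Acts.cross l r c d b))).append hv)
    obtain ⟨h1, h2⟩ := skein_typed hu hv
    rw [recolor_unit] at h1 h2
    rw [recolor_unit, recolor_unit]
    rw [wordValue_eq V (by simp) (hsm true), wordValue_eq V (by simp) (hsm false),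
      wordValue_eq V (by simp [hu0]) h1, wordValue_eq V (by simp) h2, zUnit_smul]
    exact h.skein _ _ _ _ u v l.length rfl rfl rfl rfl
  unknot c := by
    rw [wordValue_eq V (by simp) (by simp)]
    exact h.unknot _ rfl

theorem IsTiedKauffman.unique {V V' : TiedDiagram → RingAZX} (h : IsTiedKauffman V) (h' : IsTiedKauffman V') : V = V' := by
  funext D
  induction D using Quot.ind with
  | mk D =>
    have := h.rules.unique h'.rules D.closed D.nonempty
    rwa [wordValue_eq V D.nonempty D.closed, wordValue_eq V' D.nonempty D.closed] at this

theorem IsKauffman.unique {V V' : ClassicalDiagram → RingAZ} (h : IsKauffman V) (h' : IsKauffman V') : V = V' := by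
  funext D
  induction D using Quot.ind with
  | mk D =>
    have := (h.rules 0).unique (h'.rules 0) D.closed D.nonempty
    rwa [wordValue_eq V D.nonempty D.closed, wordValue_eq V' D.nonempty D.closed] at this

theorem exists_isTiedKauffman : ∃ L : TiedDiagram → RingAZX, IsTiedKauffman L := by
  obtain ⟨L, hL⟩ := exists_rules ℕ
  exact ⟨_, hL.isTiedKauffman⟩

/-- For a single colour the variable `x⁻¹` plays no role, so it may be specialized to `0`. -/
theorem exists_isKauffman : ∃ K : ClassicalDiagram → RingAZ, IsKauffman K := by
  obtain ⟨L, hL⟩ := exists_rules Unit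
  have h := hL.map (Polynomial.evalRingHom (0 : RingAZ))
  have ha : Units.map (Polynomial.evalRingHom (0 : RingAZ)).toMonoidHom (unitC aUnit) = aUnit := by
    ext1
    exact Polynomial.eval_C
  have hz : Units.map (Polynomial.evalRingHom (0 : RingAZ)).toMonoidHom (unitC zUnit) = zUnit := by
    ext1
    exact Polynomial.eval_C
  rw [ha, hz] at h
  exact ⟨_, h.isKauffman⟩

/-- The polynomial of a diagram all of whose components are tied together. -/
theorem IsTiedKauffman.allTied {L : TiedDiagram → RingAZX} {K : ClassicalDiagram → RingAZ} (hL : IsTiedKauffman L)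
    (hK : IsKauffman K) {D : MorseDiagram ℕ} (hD : D.AllTied) :
    L D.diagram = Polynomial.C (K D.forget.diagram) := by
  obtain ⟨c, hc⟩ : ∃ c : ℕ, ∀ d, Uses D.word d → d = c := by
    by_cases h : ∃ c, Uses D.word c
    · obtain ⟨c, hc⟩ := h
      exact ⟨c, fun d hd => hD d c hd hc⟩
    · exact ⟨0, fun d hd => absurd ⟨d, hd⟩ h⟩
  have hw : Word.recolor (fun _ => c) D.forget.word = D.word := by
    change Word.recolor _ (Word.recolor _ D.word) = _
    rw [recolor_recolor, recolor_congr (g := id) (f := (fun _ => c) ∘ fun _ => ()) fun d hd => (hc d hd).symm, recolor_id]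
  have h1 := hL.rules.comp_recolor (f := fun _ : Unit => c) fun _ _ _ => rfl
  have h2 := Rules.map (B' := RingAZX) (hK.rules 0) Polynomial.C
  -- The parameter of the circle rule can be replaced by `xInv`, since that rule is vacuous for
  -- `Unit`. Both functions then obey identical rules on words of one colour, and uniqueness
  -- applies.
  have h3 : Rules (unitC aUnit) (unitC zUnit) (xInv : RingAZX) (1 : RingAZX)
      fun w => (Polynomial.C (wordValue K w) : RingAZX) :=
    ⟨h2.gen, fun u v i c hc h0 ht _ => absurd (uses_of_closed ht h0) hc, h2.skein, h2.unknot⟩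
  have h4 := h1.unique h3 D.forget.closed D.forget.nonempty
  rw [hw] at h4
  rwa [wordValue_eq L D.nonempty D.closed, wordValue_eq K D.forget.nonempty D.forget.closed] at h4

end Invariance

end TiedLink

theorem theorem1 :
    (∃! L : TiedLink.TiedDiagram → TiedLink.RingAZX, TiedLink.IsTiedKauffman L) ∧
    (∃! K : TiedLink.ClassicalDiagram → TiedLink.RingAZ, TiedLink.IsKauffman K) ∧
    (∀ (L : TiedLink.TiedDiagram → TiedLink.RingAZX)
      (K : TiedLink.ClassicalDiagram → TiedLink.RingAZ),
      TiedLink.IsTiedKauffman L → TiedLink.IsKauffman K →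
      ∀ D : TiedLink.MorseDiagram ℕ, D.AllTied →
        L D.diagram = Polynomial.C (K D.forget.diagram)) := by
  obtain ⟨L, hL⟩ := TiedLink.exists_isTiedKauffman
  obtain ⟨K, hK⟩ := TiedLink.exists_isKauffman
  exact ⟨⟨L, hL, fun L' h => h.unique hL⟩, ⟨K, hK, fun K' h => h.unique hK⟩,
    fun L K hL hK D hD => hL.allTied hK hD⟩
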